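/- For real sequences $(a_j),(b_j),(\mu_j)$, $j\in\mathbb N$, with $\mu_j\in[a_j,b_j]$ put $$ r_\mu(z)=\frac{i}{2z^{1/2}}\prod_{j\in\mathbb N}\frac{z-\mu_j}{[(z-a_j)(z-b_j)]^{1/2}},\qquad \operatorname{Im} z>0, $$ where $z^{1/2}$ is the principal root and $[(z-a_j)(z-b_j)]^{1/2}=(z-a_j)^{1/2}(z-b_j)^{1/2}$ with principal roots; on real intervals outside the set $\mathfrak E$ below, $r_\mu(\lambda)$ denotes the boundary value $r_\mu(\lambda+i0)$. A Herglotz function is an analytic map of the open upper half-plane $\mathbb C_+$ into itself. **Theorem.** There exists a closed set $$\mathfrak E=[0,\infty)\setminus\bigcup_{j\in\mathbb N}(a_j,b_j),\qquad 0<\dots<a_{j+1}<b_{j+1}<a_j<b_j<\dots<a_1<b_1<\infty,\qquad \lim_{j\to\infty}b_j=0,$$ such that the following hold. (i) For the choice $\mu_j=b_j$, $j\in\mathbb N$, the product $r_0:=r_b$ converges in $\mathbb C_+$ and on $\mathbb R\setminus\mathfrak E$, $r_0$ is a Herglotz function, and $r_0(z)=\int_{\mathfrak E}\frac{d\sigma_0(\lambda)}{\lambda-z}$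 for $z\in\mathbb C_+$, with a nonnegative measure $\sigma_0$ supported on $\mathfrak E$ such that $\int_{\mathfrak E}\frac{d\sigma_0(\lambda)}{1+|\lambda|}<\infty$ and $\sigma_0(\{0\})>0$. (ii) There exist $c_j\in[a_j,b_j]$, $j\in\mathbb N$, such that $m:=r_c$ satisfies $$-\int_{a_j}^{c_j}m(\lambda)\,d\lambda=\int_{c_j}^{b_j}m(\lambda)\,d\lambda<\infty\quad(j\in\mathbb N),\qquad \int_{-1}^{0}m(\lambda)\,d\lambda<\infty,\qquad \sum_{j\in\mathbb N}\int_{c_j}^{b_j}m(\lambda)\,d\lambda<\infty .$$ For every such choice of $(c_j)$ the product $m$ converges in $\mathbb C_+$ and on $\mathbb R\setminus\mathfrak E$, $m$ is a Herglotz function, and $m(z)=\int_{\mathfrak E}\frac{d\rho(\lambda)}{\lambda-z}$ for $z\in\mathbb C_+$, with a nonnegative measure $\rho$ supported on $\mathfrak E$ such that $\int_{\mathfrak E}\frac{d\rho(\lambda)}{1+|\lambda|}<\infty$ and $\rho$ is absolutely continuous with respect to Lebesgue measure. -/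

import Mathlib

open MeasureTheory Filter Topology

/-- The gaps `(a j, b j)` lie in `(0, ∞)`, are ordered as
`0 < ⋯ < a (j+1) < b (j+1) < a j < b j < ⋯ < a 0 < b 0`, and accumulate only at the origin. -/
def GapsDecreaseToZero (a b : ℕ → ℝ) : Prop :=
  (∀ j, 0 < a j) ∧ (∀ j, a j < b j) ∧ (∀ j, b (j + 1) < a j) ∧ Tendsto b atTop (𝓝 0)

/-- The `j`-th factor `(z - μ_j) / [(z - a_j)(z - b_j)]^{1/2}` of the product below. The root is
the branch on the open upper half-plane that is asymptotic to `z` at infinity, that is,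
`(z - a_j)^{1/2} (z - b_j)^{1/2}` with principal roots. Since the principal root is continuous
from above along the negative half-axis (`(-t)^{1/2} = i √t`), at real `z` the expression is the
boundary value from the upper half-plane (away from `a_j`, `b_j`). -/
noncomputable def gapFactor (a b μ : ℕ → ℝ) (z : ℂ) (j : ℕ) : ℂ :=
  (z - (μ j : ℂ)) / ((z - (a j : ℂ)) ^ (1 / 2 : ℂ) * (z - (b j : ℂ)) ^ (1 / 2 : ℂ))

/-- The function `(i / (2 z^{1/2})) ∏_j (z - μ_j) / [(z - a_j)(z - b_j)]^{1/2}` with zeros `μ_j`.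
At points of a gap `(a_j, b_j)` and of `(-∞, 0)` this is the (real) boundary value from the
upper half-plane, i.e. the value of the analytic continuation across that interval. -/
noncomputable def gapProduct (a b μ : ℕ → ℝ) (z : ℂ) : ℂ :=
  Complex.I / (2 * z ^ (1 / 2 : ℂ)) * ∏' j, gapFactor a b μ z j

/-- The infinite product converges at every point of the closed upper half-plane outside `E`. -/
def GapProductConverges (E : Set ℝ) (a b μ : ℕ → ℝ) : Prop :=
  ∀ z : ℂ, 0 ≤ z.im → z ∉ (fun x : ℝ => (x : ℂ)) '' E → Multipliable (gapFactor a b μ z)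

/-- Herglotz (Nevanlinna, Pick) functions: analytic maps of the open upper half-plane to itself. -/
def IsHerglotz (f : ℂ → ℂ) : Prop :=
  DifferentiableOn ℂ f {z | 0 < z.im} ∧ ∀ z : ℂ, 0 < z.im → 0 < (f z).im

/-- `σ` is the measure in the Herglotz representation `f(z) = ∫_E dσ(λ) / (λ - z)`, `Im z > 0`:
it is carried by `E` and `∫_E dσ(λ) / (1 + |λ|) < ∞`. -/
def IsHerglotzMeasure (E : Set ℝ) (f : ℂ → ℂ) (σ : Measure ℝ) : Prop :=
  σ Eᶜ = 0 ∧ Integrable (fun t : ℝ => 1 / (1 + |t|)) σ ∧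
    ∀ z : ℂ, 0 < z.im → f z = ∫ t : ℝ, 1 / ((t : ℂ) - z) ∂σ

/-- The zeros `c_j ∈ [a_j, b_j]` are the comb-map choice, and the conditions of Parreau--Widom type
hold. With `m = gapProduct a b c`:
* `-∫_{a_j}^{c_j} m = ∫_{c_j}^{b_j} m < ∞` for all `j`,
* `∫_{-1}^0 m < ∞`,
* `∑_j ∫_{c_j}^{b_j} m < ∞`. -/
structure IsParreauWidomChoice (a b c : ℕ → ℝ) : Prop where
  mem_gap : ∀ j, c j ∈ Set.Icc (a j) (b j)
  integrable_left : ∀ j,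
    IntervalIntegrable (fun t : ℝ => gapProduct a b c (t : ℂ)) volume (a j) (c j)
  integrable_right : ∀ j,
    IntervalIntegrable (fun t : ℝ => gapProduct a b c (t : ℂ)) volume (c j) (b j)
  balanced : ∀ j,
    -(∫ t in (a j)..(c j), gapProduct a b c (t : ℂ)) = ∫ t in (c j)..(b j), gapProduct a b c (t : ℂ)
  integrable_neg : IntervalIntegrable (fun t : ℝ => gapProduct a b c (t : ℂ)) volume (-1) 0
  summable_heights : Summable fun j => ∫ t in (c j)..(b j), gapProduct a b c (t : ℂ)

/-!
Why such a set exists.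

*Geometry.* The gaps have right and left endpoints `b j = s j * β j` and `a j = s j * β (j + 1)`,
where `s j = (j + 2) / (j + 1)` and the scales `β j` decrease to `0` so fast that the logarithmic
gap lengths `log (β j / β (j + 1))` grow superexponentially. The factors `s j` leave bands between
the gaps that are thin, but not too thin: their relative length is `1 / (j + 2) ^ 2`.

*Facts for arbitrary gaps.* Since the lengths of the gaps are summable, the product converges
uniformly at a positive distance from the endpoints. Its argument is a telescoping sum, because
`arg (z - x)` increases with `x`, and stays inside `(0, π)`; this gives the Herglotz property
(`GapsDecreaseToZero.isHerglotz_gapProduct`). The representing measure comes from the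
Herglotz representation on the disc by the Cayley transform, together with the decay of the product
along the imaginary axis (`IsHerglotz.exists_isHerglotzMeasure`). It has no singular part away from
the endpoints and the origin, where the product is locally bounded, and no point masses at the
endpoints, where the singularity is an inverse square root. So the only question is whether there
is a point mass at the origin, and this is decided by the size of the product at `-ε`: a point mass
`α` contributes `α / ε`, which is not integrable at `0`
(`GapsDecreaseToZero.absolutelyContinuous`, `GapsDecreaseToZero.measure_zero_singleton_pos`).

*Zeros at the right endpoints.* At `-ε` the product is
`(1 / (2 * √ε)) * ∏ √((b j + ε) / (a j + ε))`. As `s j ≥ 1`, this is at least the same expression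
with `β j`, `β (j + 1)` in place of `b j`, `a j`, which telescopes and gives `1 / (2 * ε)` as a
lower bound, whence a point mass (`half_le_mul_gapProduct_rightEdge`).

*Balanced zeros.* In the `j`-th gap the product is `(x - c j) * w j x` with a positive weight `w j`
that depends only on the other zeros, so the balance condition says that `c j` is the
barycenter of `w j` (`gapMean`). Moving the other zeros to the right multiplies `w j` by
an increasing function, hence moves the barycenter to the right; by the Knaster--Tarski theorem the
barycenter map has a fixed point (`GapsDecreaseToZero.exists_gapMean_eq`). Near the left endpoint
of a long gap the weight behaves like a multiple of `1 / x`, which forces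
`c j * log (b j / a j) ≤ A j * b j` up to lower order terms, with a constant `A j` that depends only
on the relative lengths of the bands (`GapsDecreaseToZero.gapMean_mul_log_le`). The logarithmic
lengths are chosen after the `A j`, so that `c j / b j` is tiny, and then the products
`(∏ k < j, c k / √(a k * b k)) * √(β j) * A j` decay geometrically
(`prod_realFactor_zero_mul_le`). They control both the integral over the `j`-th gap
(`norm_balancedHeight_le`) and the integral of the product over `[-β j, -β (j + 1)]`
(`integrableOn_and_integral_norm_gapProduct_neg_le`), and these are therefore summable.
-/

/-! ### The Herglotz representation on the disc -/

/-- The Schwarz integral formula on the unit disc: a holomorphic function is recovered from the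
boundary values of its real part. -/
theorem DiffContOnCl.eq_im_add_circleAverage {f : ℂ → ℂ}
    (hf : DiffContOnCl ℂ f (Metric.ball 0 1)) {w : ℂ} (hw : w ∈ Metric.ball (0 : ℂ) 1) :
    f w = (f 0).im * Complex.I +
      Real.circleAverage (fun ζ => herglotzRieszKernel 0 w ζ • ((f ζ).re : ℂ)) 0 1 := by
  set F : ℂ → ℂ := fun w =>
    Real.circleAverage (fun ζ => herglotzRieszKernel 0 w ζ • ((f ζ).re : ℂ)) 0 1 with hF
  have hcont : ContinuousOn f (Metric.sphere 0 1) :=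
    hf.continuousOn_ball.mono Metric.sphere_subset_closedBall
  have hfi : CircleIntegrable f 0 1 := hcont.circleIntegrable zero_le_one
  have hre : CircleIntegrable (fun ζ => (f ζ).re) 0 1 :=
    (Complex.continuous_re.comp_continuousOn hcont).circleIntegrable zero_le_one
  have hrec : CircleIntegrable (fun ζ => ((f ζ).re : ℂ)) 0 1 :=
    ((Complex.continuous_ofReal.comp Complex.continuous_re).comp_continuousOn
      hcont).circleIntegrable zero_le_one
  have hFan : AnalyticOnNhd ℂ F (Metric.ball 0 1) :=
    analyticOnNhd_circleAverage_herglotzRieszKernel_smul hrec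
  have hfan : AnalyticOnNhd ℂ f (Metric.ball 0 1) :=
    hf.differentiableOn.analyticOnNhd Metric.isOpen_ball
  have hzero : ∀ x ∈ Metric.ball (0 : ℂ) 1, ((f - F) x).re = 0 := by
    intro x hx
    have h1 : (F x).re = Real.circleAverage
        ((Complex.re ∘ herglotzRieszKernel 0 x) • fun ζ => (f ζ).re) 0 1 :=
      re_circleAverage_herglotzRieszKernel_smul hre hx
    have h2 := hf.circleAverage_re_herglotzRieszKernel_smul hx
    have hint : CircleIntegrable ((Complex.re ∘ herglotzRieszKernel 0 x) • f) 0 1 := by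
      apply ContinuousOn.circleIntegrable zero_le_one
      apply ContinuousOn.smul _ hcont
      have := continuousOn_herglotzRieszKernel_sphere hx
      rw [abs_of_pos one_pos] at this
      exact Complex.continuous_re.comp_continuousOn this
    have h3 := Complex.reCLM.circleAverage_comp_comm hint
    rw [h2] at h3
    have h4 : (Complex.reCLM ∘ ((Complex.re ∘ herglotzRieszKernel 0 x) • f)) =
      ((Complex.re ∘ herglotzRieszKernel 0 x) • fun ζ => (f ζ).re) := by
      ext ζ; simp
    rw [h4, ← h1] at h3
    simp only [Pi.sub_apply, Complex.sub_re, h3]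
    simp
  -- `f` and `F` have the same real part, so they differ by an imaginary constant
  obtain ⟨c, hc⟩ := AnalyticOnNhd.eq_const_of_re_eq_const (hfan.sub hFan) hzero
    Metric.isOpen_ball ((convex_ball (0 : ℂ) 1).isConnected ⟨0, by simp⟩)
  have h0 : (0 : ℂ) ∈ Metric.ball (0 : ℂ) 1 := by simp
  have hF0 : (F 0).im = 0 := by
    have : F 0 = ((Real.circleAverage (fun ζ => (f ζ).re) 0 1 : ℝ) : ℂ) := by
      have h5 := Complex.ofRealCLM.circleAverage_comp_comm hre
      rw [Complex.ofRealCLM_apply] at h5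
      rw [← h5, hF]
      apply Real.circleAverage_congr_sphere
      intro ζ hζ
      have : ζ ≠ 0 := by rintro rfl; simp at hζ
      simp [herglotzRieszKernel_def, this]
    rw [this]; simp
  have hcre : c.re = 0 := by rw [← hc 0 h0]; exact hzero 0 h0
  have hcim : c.im = (f 0).im := by rw [← hc 0 h0]; simp [hF0]
  have hcI : c = (f 0).im * Complex.I := by
    apply Complex.ext <;> simp [hcre, hcim]
  have := hc w hw
  simp only [Pi.sub_apply] at this
  rw [← hcI, ← this]
  ring

/-- The Herglotz representation on the unit disc: a holomorphic function with nonnegative real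
part is, up to an imaginary constant, the integral of the kernel `(ζ + w) / (ζ - w)` against a
finite measure on the circle, parametrized here by the angle. -/
theorem exists_measure_eq_integral_herglotzRieszKernel {g : ℂ → ℂ}
    (hg : DifferentiableOn ℂ g (Metric.ball 0 1))
    (hre : ∀ w ∈ Metric.ball (0 : ℂ) 1, 0 ≤ (g w).re) :
    ∃ μ : Measure ℝ, IsFiniteMeasure μ ∧ ∀ w ∈ Metric.ball (0 : ℂ) 1,
      g w = (g 0).im * Complex.I + ∫ θ, herglotzRieszKernel 0 w (circleMap 0 1 θ) ∂μ := by
  -- the radii `r n` increase to `1`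
  set r : ℕ → ℝ := fun n => 1 - 1 / ((n : ℝ) + 2) with hr
  have hrpos : ∀ n, 0 ≤ r n := by
    intro n
    have : (1 : ℝ) / ((n : ℝ) + 2) ≤ 1 := by
      rw [div_le_one (by positivity)]; linarith [(Nat.cast_nonneg n : (0 : ℝ) ≤ n)]
    simp only [hr]; linarith
  have hrlt : ∀ n, r n < 1 := by
    intro n
    have : (0 : ℝ) < 1 / ((n : ℝ) + 2) := by positivity
    simp only [hr]; linarith
  have hrt : Tendsto r atTop (𝓝 1) := by
    have h1 : Tendsto (fun n : ℕ => (1 : ℝ) / ((n : ℝ) + 2)) atTop (𝓝 0) := by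
      apply Tendsto.div_atTop tendsto_const_nhds
      exact tendsto_atTop_add_const_right _ _ tendsto_natCast_atTop_atTop
    simpa [hr] using tendsto_const_nhds.sub h1
  have hmem : ∀ n, ∀ w : ℂ, ‖w‖ ≤ 1 → (r n : ℂ) * w ∈ Metric.ball (0 : ℂ) 1 := by
    intro n w hw
    rw [mem_ball_zero_iff, norm_mul, Complex.norm_real, Real.norm_of_nonneg (hrpos n)]
    calc r n * ‖w‖ ≤ r n * 1 := mul_le_mul_of_nonneg_left hw (hrpos n)
      _ < 1 := by linarith [hrlt n]
  have hfd : ∀ n, DiffContOnCl ℂ (fun w => g (r n * w)) (Metric.ball 0 1) := by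
    intro n
    have hmaps : Set.MapsTo (fun w : ℂ => (r n : ℂ) * w) (Metric.closedBall 0 1)
        (Metric.ball 0 1) := fun w hw => hmem n w (by simpa using hw)
    have : ContinuousOn (fun w => g (r n * w)) (Metric.closedBall 0 1) :=
      hg.continuousOn.comp (by fun_prop) hmaps
    refine ⟨hg.comp (by fun_prop) (hmaps.mono_left Metric.ball_subset_closedBall), ?_⟩
    rwa [closure_ball _ one_ne_zero]
  -- density of the approximating measure
  set d : ℕ → ℝ → ℝ := fun n θ => (2 * Real.pi)⁻¹ * (g (r n * circleMap 0 1 θ)).re with hd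
  have hdnn : ∀ n θ, 0 ≤ d n θ := by
    intro n θ
    have := hre _ (hmem n (circleMap 0 1 θ) (by simp [norm_circleMap_zero]))
    simp only [hd]; positivity
  have hdc : ∀ n, Continuous (d n) := by
    intro n
    have : Continuous fun θ => g (r n * circleMap 0 1 θ) := by
      refine (hg.continuousOn.comp_continuous (f := fun θ => (r n : ℂ) * circleMap 0 1 θ)
        (by fun_prop) ?_)
      intro θ; exact hmem n _ (by simp [norm_circleMap_zero])
    simp only [hd]; exact continuous_const.mul (Complex.continuous_re.comp this)
  set ν : ℕ → Measure ℝ := fun n =>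
    (volume.restrict (Set.Icc 0 (2 * Real.pi))).withDensity (fun θ => ENNReal.ofReal (d n θ)) with hν
  have hint : ∀ n (φ : ℝ → ℂ), ∫ θ, φ θ ∂(ν n) =
      ∫ θ in (0 : ℝ)..(2 * Real.pi), (d n θ : ℂ) * φ θ := by
    intro n φ
    simp only [hν]
    rw [integral_withDensity_eq_integral_toReal_smul (by have := (hdc n).measurable; fun_prop)
      (by simp), intervalIntegral.integral_of_le (by positivity),
      integral_Icc_eq_integral_Ioc]
    apply integral_congr_ae
    filter_upwards with θ
    rw [ENNReal.toReal_ofReal (hdnn n θ)]; simp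
  have hfin : ∀ n, IsFiniteMeasure (ν n) := by
    intro n
    apply isFiniteMeasure_withDensity_ofReal
    exact ((hdc n).integrableOn_Icc).2
  have hschwarz : ∀ n, ∀ w ∈ Metric.ball (0 : ℂ) 1, g (r n * w) = (g 0).im * Complex.I +
      ∫ θ, herglotzRieszKernel 0 w (circleMap 0 1 θ) ∂(ν n) := by
    intro n w hw
    have := (hfd n).eq_im_add_circleAverage hw
    simp only [mul_zero] at this
    rw [this, hint, Real.circleAverage_def, ← intervalIntegral.integral_smul]
    congr 1
    apply intervalIntegral.integral_congr
    intro θ _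
    simp [hd]; ring
  have hmass : ∀ n, (ν n).real Set.univ = (g 0).re := by
    intro n
    have h1 := hschwarz n 0 (by simp)
    have h2 : ∀ θ : ℝ, herglotzRieszKernel 0 0 (circleMap 0 1 θ) = 1 := by
      intro θ
      simp [herglotzRieszKernel_def, circleMap]
    simp only [mul_zero, h2] at h1
    have h3 := congrArg Complex.re h1
    simpa using h3.symm
  set m : ℕ → FiniteMeasure ℝ := fun n => ⟨ν n, hfin n⟩ with hm
  have hK := isCompact_setOfPred_finiteMeasure_le_of_isCompact (E := ℝ) (g 0).re.toNNReal
    (isCompact_Icc (a := (0 : ℝ)) (b := 2 * Real.pi))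
  have hmK : ∀ n, m n ∈ {μ : FiniteMeasure ℝ | μ.mass ≤ (g 0).re.toNNReal ∧
      μ (Set.Icc 0 (2 * Real.pi))ᶜ = 0} := by
    intro n
    refine ⟨?_, ?_⟩
    · have : (m n).mass = (g 0).re.toNNReal := by
        rw [← hmass n]
        ext
        rw [Real.coe_toNNReal _ measureReal_nonneg]
        rfl
      exact this.le
    · rw [FiniteMeasure.null_iff_toMeasure_null]
      simp only [hm, hν, FiniteMeasure.toMeasure_mk]
      apply withDensity_absolutelyContinuous
      rw [Measure.restrict_apply measurableSet_Icc.compl]; simp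
  -- the measures `ν n` have constant mass on a compact interval, hence a weak cluster point
  set U : Ultrafilter ℕ := Ultrafilter.of atTop with hU
  have hUle : (U : Filter ℕ) ≤ atTop := Ultrafilter.of_le _
  obtain ⟨μ, -, hμ⟩ := hK.ultrafilter_le_nhds (U.map m) (by
    rw [Ultrafilter.coe_map]
    exact le_principal_iff.2 (mem_map.2 (Filter.univ_mem' hmK)))
  have hμt : Tendsto m U (𝓝 μ) := hμ
  refine ⟨(μ : Measure ℝ), inferInstance, fun w hw => ?_⟩
  have hkc : Continuous fun θ : ℝ => herglotzRieszKernel 0 w (circleMap 0 1 θ) := by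
    have := continuousOn_herglotzRieszKernel_sphere hw
    rw [abs_of_pos one_pos] at this
    exact this.comp_continuous (continuous_circleMap 0 1)
      (fun θ => circleMap_mem_sphere 0 zero_le_one θ)
  have hkb : ∃ B, ∀ θ : ℝ, ‖herglotzRieszKernel 0 w (circleMap 0 1 θ)‖ ≤ B := by
    have := continuousOn_herglotzRieszKernel_sphere hw
    rw [abs_of_pos one_pos] at this
    obtain ⟨B, hB⟩ := (isCompact_sphere (0 : ℂ) 1).exists_bound_of_continuousOn this
    exact ⟨B, fun θ => hB _ (circleMap_mem_sphere 0 zero_le_one θ)⟩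
  obtain ⟨B, hB⟩ := hkb
  set φ : BoundedContinuousFunction ℝ ℂ := BoundedContinuousFunction.ofNormedAddCommGroup _ hkc B hB
  have h1 := (FiniteMeasure.tendsto_iff_forall_integral_rclike_tendsto ℂ).1 hμt φ
  have h2 : Tendsto (fun n => g (r n * w)) U (𝓝 (g w)) := by
    have hc : ContinuousAt g w := hg.continuousOn.continuousAt (Metric.isOpen_ball.mem_nhds hw)
    refine Tendsto.mono_left ?_ hUle
    refine hc.tendsto.comp ?_
    have : Tendsto (fun n => (r n : ℂ)) atTop (𝓝 1) := by
      exact_mod_cast (Complex.continuous_ofReal.tendsto 1).comp hrt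
    simpa using this.mul_const w
  have h3 : Tendsto (fun n => g (r n * w)) U (𝓝 ((g 0).im * Complex.I +
      ∫ θ, herglotzRieszKernel 0 w (circleMap 0 1 θ) ∂(μ : Measure ℝ))) := by
    simp_rw [fun n => hschwarz n w hw]
    exact tendsto_const_nhds.add h1
  exact tendsto_nhds_unique h2 h3

/-! ### The Herglotz representation on the half-plane -/

theorem norm_cayley_lt_one {z : ℂ} (hz : 0 < z.im) : ‖(z - Complex.I) / (z + Complex.I)‖ < 1 := by
  have hne : z + Complex.I ≠ 0 := by
    intro h; have := congrArg Complex.im h; simp at this; linarith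
  rw [norm_div, div_lt_one (norm_pos_iff.2 hne)]
  rw [← sq_lt_sq₀ (norm_nonneg _) (norm_nonneg _), ← Complex.normSq_eq_norm_sq,
    ← Complex.normSq_eq_norm_sq, Complex.normSq_apply, Complex.normSq_apply]
  simp
  nlinarith

theorem im_cayley_inv_pos {w : ℂ} (hw : ‖w‖ < 1) :
    0 < (Complex.I * ((1 + w) / (1 - w))).im := by
  have hne : 1 - w ≠ 0 := by
    intro h
    have : w = 1 := by linear_combination -h
    simp [this] at hw
  have hsq : Complex.normSq w < 1 := by
    rw [Complex.normSq_eq_norm_sq]; nlinarith [norm_nonneg w]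
  rw [Complex.normSq_apply] at hsq
  simp only [Complex.mul_im, Complex.I_re, Complex.I_im, Complex.div_re, zero_mul, one_mul, zero_add]
  rw [← add_div]
  apply div_pos _ (Complex.normSq_pos.2 hne)
  simp
  nlinarith

/-- The kernel of the disc, transported to the half-plane by the Cayley transform. With
`t = -cot (θ / 2)` the right side is `(1 + t * z) / (t - z)`. -/
theorem herglotzRieszKernel_cayley {z : ℂ} (hz : 0 < z.im) (θ : ℝ) :
    Complex.I * herglotzRieszKernel 0 ((z - Complex.I) / (z + Complex.I)) (circleMap 0 1 θ) =
      (Real.cos (θ / 2) * z - Real.sin (θ / 2)) / (Real.sin (θ / 2) * z + Real.cos (θ / 2)) := by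
  set C := Real.cos (θ / 2)
  set S := Real.sin (θ / 2)
  have hCS : C ^ 2 + S ^ 2 = 1 := Real.cos_sq_add_sin_sq _
  have hCSc : (C : ℂ) ^ 2 + (S : ℂ) ^ 2 = 1 := by exact_mod_cast hCS
  have hζ : circleMap 0 1 θ = ((C : ℂ) + S * Complex.I) ^ 2 := by
    have : circleMap 0 1 θ = Complex.exp ((θ / 2 : ℝ) * Complex.I) ^ 2 := by
      rw [circleMap_zero, ← Complex.exp_nat_mul]
      simp
      congr 1; ring
    rw [this, Complex.exp_mul_I, ← Complex.ofReal_cos, ← Complex.ofReal_sin]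
  have hne : z + Complex.I ≠ 0 := by
    intro h; have := congrArg Complex.im h; simp at this; linarith
  have hne2 : (S : ℂ) * z + C ≠ 0 := by
    intro h
    have h1 := congrArg Complex.im h
    have h2 := congrArg Complex.re h
    simp at h1 h2
    rcases h1 with h1 | h1
    · rw [h1] at h2 hCS; simp at h2; simp [h2] at hCS
    · linarith
  have hne3 : circleMap 0 1 θ - (z - Complex.I) / (z + Complex.I) ≠ 0 := by
    intro h
    have h1 : circleMap 0 1 θ = (z - Complex.I) / (z + Complex.I) := by linear_combination h
    have h2 := norm_cayley_lt_one hz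
    rw [← h1] at h2; simp at h2
  rw [herglotzRieszKernel_def, sub_zero, sub_zero]
  rw [hζ] at hne3 ⊢
  have hne4 : ((C : ℂ) + S * Complex.I) ^ 2 * (z + Complex.I) - (z - Complex.I) ≠ 0 := by
    intro h
    apply hne3
    field_simp
    linear_combination h
  have e1 : (((C : ℂ) + S * Complex.I) ^ 2 + (z - Complex.I) / (z + Complex.I)) /
      (((C : ℂ) + S * Complex.I) ^ 2 - (z - Complex.I) / (z + Complex.I)) =
      (((C : ℂ) + S * Complex.I) ^ 2 * (z + Complex.I) + (z - Complex.I)) /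
      (((C : ℂ) + S * Complex.I) ^ 2 * (z + Complex.I) - (z - Complex.I)) := by
    field_simp
  rw [e1, ← mul_div_assoc, div_eq_div_iff hne4 hne2]
  have hI : Complex.I ^ 2 = -1 := Complex.I_sq
  have e2 : ((C : ℂ) + S * Complex.I) ^ 2 * (z + Complex.I) + (z - Complex.I) =
      2 * (C + S * Complex.I) * (C * z - S) := by
    linear_combination (-(z - Complex.I)) * hCSc + (S ^ 2 * z + S ^ 2 * Complex.I + 2 * C * S) * hI
  have e3 : ((C : ℂ) + S * Complex.I) ^ 2 * (z + Complex.I) - (z - Complex.I) =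
      2 * (C + S * Complex.I) * Complex.I * (S * z + C) := by
    linear_combination ((z - Complex.I)) * hCSc + (- S ^ 2 * z + S ^ 2 * Complex.I) * hI
  rw [e2, e3]
  ring

/-- The Herglotz representation on the upper half-plane, with the finite measure
`(1 + t²)⁻¹ dσ(t)` in place of `σ`. -/
theorem IsHerglotz.exists_representation {f : ℂ → ℂ} (hf : IsHerglotz f) :
    ∃ (γ β : ℝ) (μ : Measure ℝ), 0 ≤ β ∧ IsFiniteMeasure μ ∧ ∀ z : ℂ, 0 < z.im →
      f z = γ + β * z + ∫ t : ℝ, (1 + t * z) / (t - z) ∂μ := by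
  set g : ℂ → ℂ := fun w => -Complex.I * f (Complex.I * ((1 + w) / (1 - w))) with hg
  have hgd : DifferentiableOn ℂ g (Metric.ball 0 1) := by
    apply DifferentiableOn.const_mul
    refine hf.1.comp ?_ (fun w hw => im_cayley_inv_pos (by simpa using hw))
    apply DifferentiableOn.const_mul
    apply DifferentiableOn.div (by fun_prop) (by fun_prop)
    intro w hw h
    have : w = 1 := by linear_combination -h
    simp [this] at hw
  have hgre : ∀ w ∈ Metric.ball (0 : ℂ) 1, 0 ≤ (g w).re := by
    intro w hw
    have := hf.2 _ (im_cayley_inv_pos (w := w) (by simpa using hw))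
    simp only [hg]
    simpa using this.le
  obtain ⟨ν, hνf, hν⟩ := exists_measure_eq_integral_herglotzRieszKernel hgd hgre
  -- the angles that correspond to `∞`; their mass is the coefficient of the linear term
  set s : Set ℝ := {θ | Real.sin (θ / 2) = 0} with hs
  have hsm : MeasurableSet s := by
    apply measurableSet_eq_fun <;> fun_prop
  set τ : ℝ → ℝ := fun θ => -Real.cos (θ / 2) / Real.sin (θ / 2) with hτ
  have hτm : Measurable τ := by simp only [hτ]; fun_prop
  refine ⟨-(g 0).im, ν.real s, (ν.restrict sᶜ).map τ, measureReal_nonneg,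
    inferInstance, fun z hz => ?_⟩
  set w := (z - Complex.I) / (z + Complex.I) with hw
  have hwb : w ∈ Metric.ball (0 : ℂ) 1 := mem_ball_zero_iff.2 (norm_cayley_lt_one hz)
  have hne : z + Complex.I ≠ 0 := by
    intro h; have := congrArg Complex.im h; simp at this; linarith
  have hfz : f z = Complex.I * g w := by
    have : Complex.I * ((1 + w) / (1 - w)) = z := by
      have h1 : 1 - w = 2 * Complex.I / (z + Complex.I) := by rw [hw]; field_simp; ring
      have h2 : 1 + w = 2 * z / (z + Complex.I) := by rw [hw]; field_simp; ring
      rw [h1, h2]; field_simp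
    simp only [hg, this]
    rw [← mul_assoc]; simp
  have hkc : Continuous fun θ : ℝ => herglotzRieszKernel 0 w (circleMap 0 1 θ) := by
    have := continuousOn_herglotzRieszKernel_sphere hwb
    rw [abs_of_pos one_pos] at this
    exact this.comp_continuous (continuous_circleMap 0 1)
      (fun θ => circleMap_mem_sphere 0 zero_le_one θ)
  have hki : Integrable (fun θ : ℝ => herglotzRieszKernel 0 w (circleMap 0 1 θ)) ν := by
    have := continuousOn_herglotzRieszKernel_sphere hwb
    rw [abs_of_pos one_pos] at this
    obtain ⟨B, hB⟩ := (isCompact_sphere (0 : ℂ) 1).exists_bound_of_continuousOn this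
    exact Integrable.of_bound hkc.aestronglyMeasurable B
      (ae_of_all _ fun θ => hB _ (circleMap_mem_sphere 0 zero_le_one θ))
  rw [hfz, hν w hwb, mul_add, ← integral_const_mul, ← integral_add_compl hsm (hki.const_mul _)]
  have h1 : ∫ θ in s, Complex.I * herglotzRieszKernel 0 w (circleMap 0 1 θ) ∂ν = ν.real s * z := by
    have : ∀ θ ∈ s, Complex.I * herglotzRieszKernel 0 w (circleMap 0 1 θ) = z := by
      intro θ hθ
      have hθ' : Real.sin (θ / 2) = 0 := hθ
      have hc : Real.cos (θ / 2) ≠ 0 := by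
        intro h
        have := Real.cos_sq_add_sin_sq (θ / 2)
        rw [h, hθ'] at this; simp at this
      have hc' : (Real.cos (θ / 2) : ℂ) ≠ 0 := by exact_mod_cast hc
      rw [hw, herglotzRieszKernel_cayley hz, hθ', Complex.ofReal_zero, zero_mul, zero_add, sub_zero,
        mul_div_cancel_left₀ _ hc']
    rw [setIntegral_congr_fun hsm this, setIntegral_const]
    simp
  have h2 : ∫ θ in sᶜ, Complex.I * herglotzRieszKernel 0 w (circleMap 0 1 θ) ∂ν =
      ∫ t : ℝ, (1 + t * z) / (t - z) ∂((ν.restrict sᶜ).map τ) := by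
    rw [integral_map hτm.aemeasurable]
    · apply setIntegral_congr_fun hsm.compl
      intro θ hθ
      have hθ' : Real.sin (θ / 2) ≠ 0 := hθ
      have hθc : (Real.sin (θ / 2) : ℂ) ≠ 0 := by exact_mod_cast hθ'
      simp only [hw]
      rw [herglotzRieszKernel_cayley hz]
      simp only [hτ]
      push_cast at hθc ⊢
      have e1 : (1 + -Complex.cos (θ / 2) / Complex.sin (θ / 2) * z) =
        (Complex.sin (θ / 2) - Complex.cos (θ / 2) * z) / Complex.sin (θ / 2) := by
        field_simp; ring
      have e2 : (-Complex.cos (θ / 2) / Complex.sin (θ / 2) - z) =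
        -(Complex.sin (θ / 2) * z + Complex.cos (θ / 2)) / Complex.sin (θ / 2) := by
        field_simp; ring
      rw [e1, e2, div_div_div_cancel_right₀ hθc, div_neg, ← neg_div]
      congr 1; ring
    · apply Measurable.aestronglyMeasurable; fun_prop
  rw [h1, h2]
  have : Complex.I * ((g 0).im * Complex.I) = -((g 0).im : ℂ) := by
    linear_combination ((g 0).im : ℂ) * Complex.I_sq
  rw [this]
  push_cast; ring

/-! ### Measures dominated through their Poisson integrals -/

/-- The Poisson integral of `σ` is at most the imaginary part of `f`. This is what local upper
bounds on `σ` are derived from. -/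
def PoissonIntegralLE (f : ℂ → ℂ) (σ : Measure ℝ) : Prop :=
  ∀ z : ℂ, 0 < z.im →
    ∫⁻ t, ENNReal.ofReal (z.im / ((t - z.re) ^ 2 + z.im ^ 2)) ∂σ ≤ ENNReal.ofReal (f z).im

namespace PoissonIntegralLE

variable {f : ℂ → ℂ} {σ : Measure ℝ}

theorem measure_closedBall_le (h : PoissonIntegralLE f σ) (x : ℝ) {y : ℝ} (hy : 0 < y) :
    σ (Metric.closedBall x y) ≤ ENNReal.ofReal (2 * y * (f (x + y * Complex.I)).im) := by
  have h1 := h (x + y * Complex.I) (by simpa using hy)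
  simp only [Complex.add_im, Complex.ofReal_im, Complex.mul_im, Complex.ofReal_re, Complex.I_im,
    mul_one, Complex.I_re, mul_zero, add_zero, zero_add, Complex.add_re, Complex.mul_re,
    sub_zero] at h1
  have h2 : σ (Metric.closedBall x y) ≤ ENNReal.ofReal (2 * y) *
      ∫⁻ t, ENNReal.ofReal (y / ((t - x) ^ 2 + y ^ 2)) ∂σ := by
    rw [← lintegral_const_mul _ (by fun_prop)]
    calc σ (Metric.closedBall x y) = ∫⁻ t in Metric.closedBall x y, 1 ∂σ := by simp
      _ ≤ ∫⁻ t in Metric.closedBall x y,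
          ENNReal.ofReal (2 * y) * ENNReal.ofReal (y / ((t - x) ^ 2 + y ^ 2)) ∂σ := by
        apply setLIntegral_mono (by fun_prop)
        intro t ht
        rw [← ENNReal.ofReal_mul (by positivity), ← ENNReal.ofReal_one]
        apply ENNReal.ofReal_le_ofReal
        rw [Metric.mem_closedBall, Real.dist_eq] at ht
        have : (t - x) ^ 2 ≤ y ^ 2 := by rw [← sq_abs]; gcongr
        rw [← mul_div_assoc, le_div_iff₀ (by positivity)]
        nlinarith
      _ ≤ _ := setLIntegral_le_lintegral _ _
  refine h2.trans ?_
  rw [ENNReal.ofReal_mul (p := 2 * y) (by positivity)]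
  exact mul_le_mul_right h1 _

/-- A bound for `Im f` along a sequence of heights tending to `0`, for each point of `s`, bounds `σ`
on `s` by a multiple of Lebesgue measure, by the Besicovitch covering theorem. -/
theorem measure_le_mul_volume [SFinite σ] (h : PoissonIntegralLE f σ) {s : Set ℝ} {C : ℝ}
    (hC : 0 ≤ C)
    (hs : ∀ x ∈ s, ∃ᶠ y : ℝ in 𝓝[>] 0, (f (x + y * Complex.I)).im ≤ C) :
    σ s ≤ ENNReal.ofReal C * volume s := by
  have key := (Besicovitch.vitaliFamily σ).measure_le_of_frequently_le (ρ := σ)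
    (C.toNNReal • volume) Measure.AbsolutelyContinuous.rfl s (fun x hx => ?_)
  · simpa [ENNReal.ofReal, Measure.smul_apply] using key
  · have h1 := (hs x hx).and_eventually (self_mem_nhdsWithin)
    refine (Besicovitch.tendsto_filterAt σ x).frequently (h1.mono ?_)
    rintro y ⟨hy1, hy⟩
    have hy : 0 < y := hy
    refine (h.measure_closedBall_le x hy).trans ?_
    rw [Measure.smul_apply, Real.volume_closedBall, ENNReal.smul_def, smul_eq_mul,
      ← ENNReal.ofReal, ← ENNReal.ofReal_mul hC]
    apply ENNReal.ofReal_le_ofReal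
    nlinarith

/-- There is no singular part where `Im f` is bounded along vertical lines. -/
theorem measure_eq_zero_of_volume_eq_zero [SFinite σ] (h : PoissonIntegralLE f σ) {s : Set ℝ}
    (hs : ∀ x ∈ s, ∃ C : ℝ, ∀ᶠ y : ℝ in 𝓝[>] 0, (f (x + y * Complex.I)).im ≤ C)
    (h0 : volume s = 0) : σ s = 0 := by
  have hcov : s ⊆ ⋃ n : ℕ,
      {x ∈ s | ∃ᶠ y : ℝ in 𝓝[>] 0, (f (x + y * Complex.I)).im ≤ n} := by
    intro x hx
    obtain ⟨C, hC⟩ := hs x hx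
    obtain ⟨n, hn⟩ := exists_nat_ge C
    exact Set.mem_iUnion.2 ⟨n, hx, (hC.mono fun y hy => hy.trans hn).frequently⟩
  refine measure_mono_null hcov (measure_iUnion_null fun n => ?_)
  have h1 := h.measure_le_mul_volume (C := n) (Nat.cast_nonneg n)
    (s := {x ∈ s | ∃ᶠ y : ℝ in 𝓝[>] 0, (f (x + y * Complex.I)).im ≤ n}) (fun x hx => hx.2)
  rw [measure_mono_null (Set.sep_subset _ _) h0, mul_zero] at h1
  exact le_antisymm h1 bot_le

theorem measure_eq_zero_of_tendsto [SFinite σ] (h : PoissonIntegralLE f σ) {s : Set ℝ}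
    (hs : ∀ x ∈ s, Tendsto (fun y : ℝ => (f (x + y * Complex.I)).im) (𝓝[>] 0) (𝓝 0)) :
    σ s = 0 := by
  have hcov : s ⊆ ⋃ n : ℕ, s ∩ Metric.closedBall 0 n := by
    intro x hx
    obtain ⟨n, hn⟩ := exists_nat_ge |x|
    exact Set.mem_iUnion.2 ⟨n, hx, by simpa using hn⟩
  refine measure_mono_null hcov (measure_iUnion_null fun n => ?_)
  have h1 : ∀ ε : ℝ, 0 < ε → σ (s ∩ Metric.closedBall 0 n) ≤ ENNReal.ofReal (ε * (2 * n)) := by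
    intro ε hε
    refine (h.measure_le_mul_volume hε.le (fun x hx => ?_)).trans ?_
    · exact (((hs x hx.1).eventually_lt_const hε).mono fun y hy => hy.le).frequently
    · rw [ENNReal.ofReal_mul hε.le]
      gcongr
      refine (measure_mono Set.inter_subset_right).trans ?_
      rw [Real.volume_closedBall]
  have h2 : Tendsto (fun ε : ℝ => ENNReal.ofReal (ε * (2 * n))) (𝓝[>] 0) (𝓝 0) := by
    have : Tendsto (fun ε : ℝ => ENNReal.ofReal (ε * (2 * n))) (𝓝 0)
        (𝓝 (ENNReal.ofReal (0 * (2 * n)))) := by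
      exact (ENNReal.continuous_ofReal.comp (by fun_prop)).tendsto 0
    rw [zero_mul, ENNReal.ofReal_zero] at this
    exact this.mono_left nhdsWithin_le_nhds
  exact le_antisymm (ge_of_tendsto h2 (by filter_upwards [self_mem_nhdsWithin] with ε hε
                                          using h1 ε hε)) bot_le

theorem measure_singleton_eq_zero (h : PoissonIntegralLE f σ) {x : ℝ}
    (hx : Tendsto (fun y : ℝ => y * ‖f (x + y * Complex.I)‖) (𝓝[>] 0) (𝓝 0)) :
    σ {x} = 0 := by
  have h1 : Tendsto (fun y : ℝ => ENNReal.ofReal (2 * (y * ‖f (x + y * Complex.I)‖)))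
      (𝓝[>] 0) (𝓝 0) := by
    have := (ENNReal.continuous_ofReal.tendsto (2 * 0)).comp (hx.const_mul 2)
    rwa [mul_zero, ENNReal.ofReal_zero] at this
  refine le_antisymm (ge_of_tendsto h1 ?_) bot_le
  filter_upwards [self_mem_nhdsWithin] with y hy
  have hy : 0 < y := hy
  calc σ {x} ≤ σ (Metric.closedBall x y) := measure_mono (by simpa using hy.le)
    _ ≤ _ := h.measure_closedBall_le x hy
    _ ≤ _ := by
      apply ENNReal.ofReal_le_ofReal
      rw [mul_assoc]
      gcongr
      exact (le_abs_self _).trans (Complex.abs_im_le_norm _)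

end PoissonIntegralLE

/-! ### Cauchy transforms -/

theorem im_herglotz_kernel (t : ℝ) {z : ℂ} (hz : 0 < z.im) :
    ((1 + t * z) / (t - z)).im = (1 + t ^ 2) * (z.im / ((t - z.re) ^ 2 + z.im ^ 2)) := by
  have : (t - z.re) ^ 2 + z.im ^ 2 ≠ 0 := by positivity
  rw [Complex.div_im]
  have h : Complex.normSq (t - z) = (t - z.re) ^ 2 + z.im ^ 2 := by
    rw [Complex.normSq_apply]; simp; ring
  rw [h]
  simp
  field_simp
  ring

theorem ofReal_sub_ne_zero (t : ℝ) {z : ℂ} (hz : 0 < z.im) : (t : ℂ) - z ≠ 0 := by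
  intro h; have := congrArg Complex.im h; simp at this; linarith

theorem norm_inv_ofReal_sub_le (t : ℝ) {z : ℂ} (hz : 0 < z.im) : ‖1 / ((t : ℂ) - z)‖ ≤ 1 / z.im := by
  rw [norm_div, norm_one]
  apply one_div_le_one_div_of_le hz
  have := Complex.abs_im_le_norm ((t : ℂ) - z)
  simp at this
  exact (le_abs_self _).trans this

theorem herglotz_kernel_eq (t : ℝ) {z : ℂ} (hz : 0 < z.im) :
    (1 + t * z) / (t - z) = z + (1 + z ^ 2) * (1 / (t - z)) := by
  have := ofReal_sub_ne_zero t hz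
  field_simp; ring

theorem integrable_herglotz_kernel (μ : Measure ℝ) [IsFiniteMeasure μ] {z : ℂ} (hz : 0 < z.im) :
    Integrable (fun t : ℝ => (1 + t * z) / (t - z)) μ := by
  simp_rw [fun t => herglotz_kernel_eq t hz]
  refine (integrable_const _).add (Integrable.const_mul ?_ _)
  refine Integrable.of_bound (Measurable.aestronglyMeasurable (by fun_prop)) (1 / z.im)
    (ae_of_all _ fun t => norm_inv_ofReal_sub_le t hz)

/-- A Herglotz function that decays along the imaginary axis, and whose imaginary part vanishes on
the real line off a set `E ⊆ [0, ∞)`, is the Cauchy transform of a measure carried by `E`. -/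
theorem IsHerglotz.exists_isHerglotzMeasure {f : ℂ → ℂ} (hf : IsHerglotz f) {E : Set ℝ}
    (hE : E ⊆ Set.Ici 0)
    (him : ∀ x ∉ E, Tendsto (fun y : ℝ => (f (x + y * Complex.I)).im) (𝓝[>] 0) (𝓝 0))
    (hdecay : Tendsto (fun y : ℝ => f (y * Complex.I)) atTop (𝓝 0)) :
    ∃ σ : Measure ℝ, SFinite σ ∧ IsHerglotzMeasure E f σ ∧ PoissonIntegralLE f σ := by
  obtain ⟨γ, β, μ, hβ, hμ, hrep⟩ := hf.exists_representation
  set σ : Measure ℝ := μ.withDensity (fun t => ENNReal.ofReal (1 + t ^ 2)) with hσ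
  have hdm : Measurable fun t : ℝ => ENNReal.ofReal (1 + t ^ 2) := by fun_prop
  have hfim : ∀ z : ℂ, 0 < z.im → (f z).im = β * z.im +
      ∫ t : ℝ, (1 + t ^ 2) * (z.im / ((t - z.re) ^ 2 + z.im ^ 2)) ∂μ := by
    intro z hz
    rw [hrep z hz]
    have h1 := Complex.imCLM.integral_comp_comm (integrable_herglotz_kernel μ hz)
    simp only [Complex.imCLM_apply, im_herglotz_kernel _ hz] at h1
    rw [h1]; simp
  have hfimi : ∀ z : ℂ, 0 < z.im →
      Integrable (fun t : ℝ => (1 + t ^ 2) * (z.im / ((t - z.re) ^ 2 + z.im ^ 2))) μ := by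
    intro z hz
    have h1 := (integrable_herglotz_kernel μ hz).im
    refine h1.congr (ae_of_all _ fun t => ?_)
    exact im_herglotz_kernel t hz
  have hP : PoissonIntegralLE f σ := by
    intro z hz
    rw [hσ, lintegral_withDensity_eq_lintegral_mul _ hdm (by fun_prop), hfim z hz]
    have h1 : ∀ t : ℝ, ((fun t : ℝ => ENNReal.ofReal (1 + t ^ 2)) *
        fun t : ℝ => ENNReal.ofReal (z.im / ((t - z.re) ^ 2 + z.im ^ 2))) t =
        ENNReal.ofReal ((1 + t ^ 2) * (z.im / ((t - z.re) ^ 2 + z.im ^ 2))) := by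
      intro t
      rw [ENNReal.ofReal_mul (by positivity)]; rfl
    simp_rw [h1]
    rw [← ofReal_integral_eq_lintegral_ofReal (hfimi z hz) (ae_of_all _ fun t => by positivity)]
    apply ENNReal.ofReal_le_ofReal
    nlinarith
  have hσE : σ Eᶜ = 0 := hP.measure_eq_zero_of_tendsto fun x hx => him x hx
  have hμσ : μ ≪ σ := by
    apply withDensity_absolutelyContinuous' hdm.aemeasurable
    exact ae_of_all _ fun t => (ENNReal.ofReal_pos.2 (by positivity)).ne'
  have hμE : μ Eᶜ = 0 := hμσ hσE
  have hnn : ∀ᵐ t ∂μ, 0 ≤ t := by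
    refine measure_mono_null ?_ hμE
    intro t ht ht'
    exact ht (hE ht')
  -- the behaviour of `f (i * y)` as `y → ∞` determines `β` and `γ`
  set y : ℕ → ℝ := fun n => n + 2 with hy
  have hyt : Tendsto y atTop atTop :=
    tendsto_atTop_add_const_right _ _ tendsto_natCast_atTop_atTop
  have hy2 : ∀ n, 2 ≤ y n := fun n => by simp [hy]
  have hypos : ∀ n, 0 < ((y n : ℂ) * Complex.I).im := fun n => by
    simp; linarith [hy2 n]
  have hft : Tendsto (fun n => f (y n * Complex.I)) atTop (𝓝 0) := hdecay.comp hyt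
  have hβ0 : β = 0 := by
    refine le_antisymm ?_ hβ
    have h1 : Tendsto (fun n => (f (y n * Complex.I)).im) atTop (𝓝 0) := by
      exact (Complex.continuous_im.tendsto 0).comp hft
    refine ge_of_tendsto h1 (Eventually.of_forall fun n => ?_)
    rw [hfim _ (hypos n)]
    have h2 : 0 ≤ ∫ t : ℝ, (1 + t ^ 2) * (((y n : ℂ) * Complex.I).im /
        ((t - ((y n : ℂ) * Complex.I).re) ^ 2 + ((y n : ℂ) * Complex.I).im ^ 2)) ∂μ :=
      integral_nonneg fun t => by have := (hypos n).le; positivity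
    have h3 : ((y n : ℂ) * Complex.I).im = y n := by simp
    rw [h3] at h2 ⊢
    nlinarith [hy2 n]
  -- minus the real part of the kernel at `i * y n`; it tends to `t`
  set F : ℕ → ℝ → ℝ := fun n t => t * ((y n ^ 2 - 1) / (t ^ 2 + y n ^ 2)) with hF
  have hFre : ∀ (n : ℕ) (t : ℝ),
      ((1 + (t : ℂ) * (y n * Complex.I)) / (t - y n * Complex.I)).re = -F n t := by
    intro n t
    have h0 : t ^ 2 + y n ^ 2 ≠ 0 := by have := hy2 n; positivity
    have h : Complex.normSq ((t : ℂ) - y n * Complex.I) = t ^ 2 + y n ^ 2 := by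
      rw [Complex.normSq_apply]; simp; ring
    rw [Complex.div_re, h]
    simp [hF]
    field_simp
    ring
  have hFi : ∀ n, Integrable (F n) μ := by
    intro n
    have h1 := (integrable_herglotz_kernel μ (hypos n)).re.neg
    refine h1.congr (ae_of_all _ fun t => ?_)
    have := hFre n t
    simp only [Pi.neg_apply, RCLike.re_to_complex]
    rw [this, neg_neg]
  have hFint : ∀ n, ∫ t, F n t ∂μ = γ - (f (y n * Complex.I)).re := by
    intro n
    have h1 := Complex.reCLM.integral_comp_comm (integrable_herglotz_kernel μ (hypos n))
    simp only [Complex.reCLM_apply, hFre, integral_neg] at h1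
    rw [hrep _ (hypos n), hβ0]
    simp only [Complex.add_re, Complex.ofReal_re, Complex.ofReal_zero, zero_mul, Complex.zero_re]
    linarith
  have hFlim : Tendsto (fun n => ∫ t, F n t ∂μ) atTop (𝓝 γ) := by
    simp_rw [hFint]
    have h1 : Tendsto (fun n => (f (y n * Complex.I)).re) atTop (𝓝 0) := by
      exact (Complex.continuous_re.tendsto 0).comp hft
    simpa using tendsto_const_nhds.sub h1
  have hFpt : ∀ t, Tendsto (fun n => F n t) atTop (𝓝 t) := by
    intro t
    have h1 : Tendsto (fun n => (y n ^ 2)⁻¹) atTop (𝓝 0) :=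
      tendsto_inv_atTop_zero.comp ((tendsto_pow_atTop two_ne_zero).comp hyt)
    have h2 : Tendsto (fun n => t * ((1 - (y n ^ 2)⁻¹) / (t ^ 2 * (y n ^ 2)⁻¹ + 1))) atTop
        (𝓝 (t * ((1 - 0) / (t ^ 2 * 0 + 1)))) :=
      ((tendsto_const_nhds.sub h1).div ((h1.const_mul _).add_const 1) (by simp)).const_mul t
    simp only [mul_zero, sub_zero, zero_add, div_one, mul_one] at h2
    refine h2.congr fun n => ?_
    have : y n ≠ 0 := by linarith [hy2 n]
    have h0 : t ^ 2 + y n ^ 2 ≠ 0 := by positivity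
    simp only [hF]
    field_simp
  have hFnn : ∀ n, ∀ᵐ t ∂μ, 0 ≤ F n t := by
    intro n
    filter_upwards [hnn] with t ht
    have h1 : 0 ≤ y n ^ 2 - 1 := by nlinarith [hy2 n]
    simp only [hF]; positivity
  -- Fatou's lemma gives the first moment of `μ`, which is the integrability condition on `σ`
  have hti : Integrable (fun t : ℝ => t) μ := by
    refine ⟨aestronglyMeasurable_id, ?_⟩
    have h1 : ∫⁻ t, ‖t‖ₑ ∂μ ≤ liminf (fun n => ∫⁻ t, ‖F n t‖ₑ ∂μ) atTop := by
      refine le_trans (lintegral_mono_ae (ae_of_all _ fun t => ?_))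
        (lintegral_liminf_le' fun n => (hFi n).1.enorm)
      exact ((continuous_enorm.tendsto t).comp (hFpt t)).liminf_eq.ge
    have h2 : ∀ n, ∫⁻ t, ‖F n t‖ₑ ∂μ = ENNReal.ofReal (∫ t, F n t ∂μ) := by
      intro n
      rw [ofReal_integral_eq_lintegral_ofReal (hFi n) (hFnn n)]
      apply lintegral_congr_ae
      filter_upwards [hFnn n] with t ht
      exact Real.enorm_eq_ofReal ht
    simp_rw [h2] at h1
    have h3 := ((ENNReal.continuous_ofReal.tendsto γ).comp hFlim).liminf_eq
    simp only [Function.comp_def] at h3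
    rw [h3] at h1
    exact h1.trans_lt ENNReal.ofReal_lt_top
  have hγ : ∫ t, t ∂μ = γ := by
    refine tendsto_nhds_unique ?_ hFlim
    refine tendsto_integral_of_dominated_convergence (fun t => |t|) (fun n => (hFi n).1)
      hti.abs (fun n => ae_of_all _ fun t => ?_) (ae_of_all _ hFpt)
    simp only [hF, norm_mul, Real.norm_eq_abs]
    have h1 : |(y n ^ 2 - 1) / (t ^ 2 + y n ^ 2)| ≤ 1 := by
      have h0 : 0 < t ^ 2 + y n ^ 2 := by have := hy2 n; positivity
      rw [abs_of_nonneg (div_nonneg (by nlinarith [hy2 n]) h0.le), div_le_one h0]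
      nlinarith [sq_nonneg t]
    exact mul_le_of_le_one_right (abs_nonneg _) h1
  refine ⟨σ, inferInstance, ⟨hσE, ?_, fun z hz => ?_⟩, hP⟩
  · rw [hσ, integrable_withDensity_iff hdm (by simp)]
    refine Integrable.mono' ((integrable_const (1 : ℝ)).add hti.abs)
      (Measurable.aestronglyMeasurable (by fun_prop)) (ae_of_all _ fun t => ?_)
    rw [ENNReal.toReal_ofReal (by positivity), Real.norm_of_nonneg (by positivity)]
    simp only [Pi.add_apply]
    rw [div_mul_eq_mul_div, one_mul, div_le_iff₀ (by positivity)]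
    nlinarith [abs_nonneg t, sq_abs t]
  · rw [hσ, integral_withDensity_eq_integral_toReal_smul hdm (by simp), hrep z hz, hβ0, ← hγ,
      ← integral_complex_ofReal, Complex.ofReal_zero, zero_mul, add_zero,
      ← integral_add (f := fun t : ℝ => (t : ℂ)) hti.ofReal (integrable_herglotz_kernel μ hz)]
    apply integral_congr_ae
    filter_upwards with t
    have := ofReal_sub_ne_zero t hz
    rw [ENNReal.toReal_ofReal (by positivity)]
    simp only [Complex.real_smul]
    push_cast
    field_simp
    ring

/-- The Cauchy transform of a measure on `[0, ∞)` extends to the negative half-line. -/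
theorem IsHerglotzMeasure.tendsto_neg {f : ℂ → ℂ} {σ : Measure ℝ} {E : Set ℝ}
    (hE : E ⊆ Set.Ici 0) (hσ : IsHerglotzMeasure E f σ) {ε : ℝ} (hε : 0 < ε) :
    Tendsto (fun y : ℝ => f ((-ε : ℝ) + y * Complex.I)) (𝓝[>] 0)
      (𝓝 ((∫ t : ℝ, 1 / (t + ε) ∂σ : ℝ) : ℂ)) := by
  have hnn : ∀ᵐ t ∂σ, 0 ≤ t := by
    refine measure_mono_null ?_ hσ.1
    intro t ht ht'
    exact ht (hE ht')
  rw [← integral_complex_ofReal]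
  have h1 : ∀ᶠ y : ℝ in 𝓝[>] 0, ∫ t : ℝ, 1 / ((t : ℂ) - ((-ε : ℝ) + y * Complex.I)) ∂σ =
      f ((-ε : ℝ) + y * Complex.I) := by
    filter_upwards [self_mem_nhdsWithin] with y hy
    have hy : 0 < y := hy
    rw [hσ.2.2 _ (by simpa using hy)]
  refine Tendsto.congr' h1 ?_
  refine tendsto_integral_filter_of_dominated_convergence
    (fun t => (1 + 1 / ε) * (1 / (1 + |t|))) ?_ ?_ (hσ.2.1.const_mul _) ?_
  · exact Eventually.of_forall fun y => Measurable.aestronglyMeasurable (by fun_prop)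
  · refine Eventually.of_forall fun y => ?_
    filter_upwards [hnn] with t ht
    have h2 : t + ε ≤ ‖(t : ℂ) - ((-ε : ℝ) + y * Complex.I)‖ := by
      have := Complex.re_le_norm ((t : ℂ) - ((-ε : ℝ) + y * Complex.I))
      simpa using this
    rw [norm_div, norm_one, abs_of_nonneg ht]
    calc 1 / ‖(t : ℂ) - ((-ε : ℝ) + y * Complex.I)‖ ≤ 1 / (t + ε) :=
          one_div_le_one_div_of_le (by positivity) h2
      _ ≤ (1 + 1 / ε) * (1 / (1 + t)) := by
        rw [mul_one_div, div_le_div_iff₀ (by positivity) (by positivity)]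
        have : 0 ≤ t * (1 / ε) := by positivity
        have h3 : 1 / ε * ε = 1 := by field_simp
        nlinarith
  · filter_upwards [hnn] with t ht
    have hne : (t : ℂ) - ((-ε : ℝ) + (0 : ℝ) * Complex.I) ≠ 0 := by
      intro h
      have := congrArg Complex.re h
      simp at this; linarith
    have h2 : ContinuousAt (fun y : ℝ => 1 / ((t : ℂ) - ((-ε : ℝ) + y * Complex.I))) 0 :=
      ContinuousAt.div (by fun_prop) (by fun_prop) hne
    have h3 := h2.tendsto.mono_left (nhdsWithin_le_nhds (s := Set.Ioi 0))
    convert h3 using 2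
    push_cast; simp

/-! ### Square roots on the closed upper half-plane -/

theorem cpow_half_eq {w : ℂ} (hw : 0 ≤ w.im) :
    w ^ (1 / 2 : ℂ) = (√((‖w‖ + w.re) / 2) : ℝ) + (√((‖w‖ - w.re) / 2) : ℝ) * Complex.I := by
  rw [one_div]
  apply Complex.ext
  · rw [Complex.cpow_inv_two_re]; simp
  · rw [Complex.cpow_inv_two_im_eq_sqrt hw]; simp

theorem cpow_half_re_nonneg (w : ℂ) : 0 ≤ (w ^ (1 / 2 : ℂ)).re := by
  rw [one_div, Complex.cpow_inv_two_re]; positivity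

theorem cpow_half_im_nonneg {w : ℂ} (hw : 0 ≤ w.im) : 0 ≤ (w ^ (1 / 2 : ℂ)).im := by
  rw [one_div, Complex.cpow_inv_two_im_eq_sqrt hw]; positivity

theorem cpow_half_mul_self (w : ℂ) : w ^ (1 / 2 : ℂ) * w ^ (1 / 2 : ℂ) = w := by
  rw [← pow_two, one_div]; exact Complex.cpow_nat_inv_pow w two_ne_zero

theorem norm_cpow_half (w : ℂ) : ‖w ^ (1 / 2 : ℂ)‖ = √‖w‖ := by
  have h := congrArg norm (cpow_half_mul_self w)
  rw [norm_mul] at h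
  rw [← h, Real.sqrt_mul_self (norm_nonneg _)]

theorem cpow_half_ne_zero {w : ℂ} (hw : w ≠ 0) : w ^ (1 / 2 : ℂ) ≠ 0 := by
  intro h
  have := cpow_half_mul_self w
  rw [h, zero_mul] at this
  exact hw this.symm

theorem continuousOn_cpow_half : ContinuousOn (fun w : ℂ => w ^ (1 / 2 : ℂ)) {w | 0 ≤ w.im} := by
  have : ContinuousOn (fun w : ℂ =>
      ((√((‖w‖ + w.re) / 2) : ℝ) : ℂ) + (√((‖w‖ - w.re) / 2) : ℝ) * Complex.I)
      {w | 0 ≤ w.im} := by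
    apply Continuous.continuousOn
    fun_prop
  exact this.congr fun w hw => cpow_half_eq hw

theorem cpow_half_of_nonneg {x : ℝ} (hx : 0 ≤ x) : (x : ℂ) ^ (1 / 2 : ℂ) = (√x : ℝ) := by
  rw [cpow_half_eq (by simp)]
  simp [abs_of_nonneg hx]

theorem cpow_half_of_nonpos {x : ℝ} (hx : x ≤ 0) :
    (x : ℂ) ^ (1 / 2 : ℂ) = (√(-x) : ℝ) * Complex.I := by
  rw [cpow_half_eq (by simp), Complex.norm_real, Real.norm_of_nonpos hx, Complex.ofReal_re,
    neg_add_cancel, zero_div, Real.sqrt_zero, Complex.ofReal_zero, zero_add]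
  congr 3; ring

theorem norm_le_norm_add_of_quadrant {u v : ℂ} (hu : 0 ≤ u.re) (hu' : 0 ≤ u.im) (hv : 0 ≤ v.re)
    (hv' : 0 ≤ v.im) : ‖v‖ ≤ ‖u + v‖ := by
  rw [← sq_le_sq₀ (norm_nonneg _) (norm_nonneg _), ← Complex.normSq_eq_norm_sq,
    ← Complex.normSq_eq_norm_sq, Complex.normSq_apply, Complex.normSq_apply]
  simp only [Complex.add_re, Complex.add_im]
  nlinarith [mul_nonneg hu hv, mul_nonneg hu' hv']

/-! ### Convergence of the product -/

/-- The factors differ from `1` by at most a multiple of the length of the gap. The roots `u`, `v` of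
`z - a j`, `z - b j` lie in one quadrant, so `u + v` is not small and `v - u` is of the size of
`(b j - a j) / ‖v‖`. -/
theorem norm_gapFactor_sub_one_le {a b μ : ℕ → ℝ} {j : ℕ} (hab : a j < b j)
    (hμ : μ j ∈ Set.Icc (a j) (b j)) {z : ℂ} (hz : 0 ≤ z.im) {η : ℝ} (hη : 0 < η)
    (ha : η ≤ ‖z - a j‖) (hb : η ≤ ‖z - b j‖) :
    ‖gapFactor a b μ z j - 1‖ ≤ 2 * (b j - a j) / η := by
  have hza : z - a j ≠ 0 := norm_pos_iff.1 (hη.trans_le ha)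
  have hzb : z - b j ≠ 0 := norm_pos_iff.1 (hη.trans_le hb)
  set u := (z - (a j : ℂ)) ^ (1 / 2 : ℂ) with hu
  set v := (z - (b j : ℂ)) ^ (1 / 2 : ℂ) with hv
  have hia : 0 ≤ (z - (a j : ℂ)).im := by simpa using hz
  have hib : 0 ≤ (z - (b j : ℂ)).im := by simpa using hz
  have hu0 : u ≠ 0 := cpow_half_ne_zero hza
  have hv0 : v ≠ 0 := cpow_half_ne_zero hzb
  have huu : u * u = z - a j := cpow_half_mul_self _
  have hvv : v * v = z - b j := cpow_half_mul_self _
  have hq : ‖v‖ ≤ ‖u + v‖ := norm_le_norm_add_of_quadrant (cpow_half_re_nonneg _)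
    (cpow_half_im_nonneg hia) (cpow_half_re_nonneg _) (cpow_half_im_nonneg hib)
  have e : gapFactor a b μ z j - 1 = ((z - μ j - v * v) + v * (v - u)) / (u * v) := by
    rw [gapFactor, ← hu, ← hv]
    field_simp; ring
  have h1 : ‖z - μ j - v * v‖ ≤ b j - a j := by
    rw [hvv]
    have : z - μ j - (z - b j) = ((b j - μ j : ℝ) : ℂ) := by push_cast; ring
    rw [this, Complex.norm_real, Real.norm_of_nonneg (by linarith [hμ.2])]
    linarith [hμ.1]
  have h2 : ‖v * (v - u)‖ ≤ b j - a j := by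
    have h3 : ‖(u + v) * (v - u)‖ = b j - a j := by
      have : (u + v) * (v - u) = ((-(b j - a j) : ℝ) : ℂ) := by
        push_cast; linear_combination hvv - huu
      rw [this, Complex.norm_real, norm_neg, Real.norm_of_nonneg (by linarith)]
    rw [norm_mul] at h3 ⊢
    rw [← h3]
    gcongr
  have huv : η ≤ ‖u * v‖ := by
    rw [norm_mul, hu, hv, norm_cpow_half, norm_cpow_half]
    calc η = √η * √η := (Real.mul_self_sqrt hη.le).symm
      _ ≤ _ := by gcongr
  rw [e, norm_div]
  apply div_le_div₀ (by linarith) _ hη huv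
  exact (norm_add_le _ _).trans (by linarith)

/-- `z` keeps the distance `η` from all endpoints of the gaps. -/
def AwayFromEdges (a b : ℕ → ℝ) (η : ℝ) (z : ℂ) : Prop :=
  ∀ k, η ≤ ‖z - a k‖ ∧ η ≤ ‖z - b k‖

theorem AwayFromEdges.mono {a b : ℕ → ℝ} {η η' : ℝ} {z : ℂ} (h : AwayFromEdges a b η z)
    (hη : η' ≤ η) : AwayFromEdges a b η' z :=
  fun k => ⟨hη.trans (h k).1, hη.trans (h k).2⟩

namespace GapsDecreaseToZero

variable {a b : ℕ → ℝ}

theorem b_pos (h : GapsDecreaseToZero a b) (j : ℕ) : 0 < b j := (h.1 j).trans (h.2.1 j)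

theorem b_antitone (h : GapsDecreaseToZero a b) : Antitone b :=
  antitone_nat_of_succ_le fun n => ((h.2.2.1 n).trans (h.2.1 n)).le

theorem b_lt_a (h : GapsDecreaseToZero a b) {k j : ℕ} (hkj : k < j) : b j < a k :=
  (h.b_antitone (Nat.succ_le_of_lt hkj)).trans_lt (h.2.2.1 k)

/-- The gaps are disjoint subintervals of `[0, b 0]`. -/
theorem sum_length_le (h : GapsDecreaseToZero a b) (n : ℕ) :
    ∑ k ∈ Finset.range n, (b k - a k) ≤ b 0 := by
  have : ∀ n, ∑ k ∈ Finset.range (n + 1), (b k - a k) ≤ b 0 - a n := by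
    intro n
    induction n with
    | zero => simp
    | succ n ih =>
      rw [Finset.sum_range_succ]
      linarith [h.2.2.1 n]
  cases n with
  | zero => simpa using (h.b_pos 0).le
  | succ n => linarith [this n, h.1 n]

theorem summable_length (h : GapsDecreaseToZero a b) : Summable fun k => b k - a k :=
  summable_of_sum_range_le (fun k => by linarith [h.2.1 k]) h.sum_length_le

theorem summable_bound (h : GapsDecreaseToZero a b) (η : ℝ) :
    Summable fun k => 2 * (b k - a k) / η := by
  simpa [mul_div_assoc, div_eq_mul_inv, mul_assoc] using
    (h.summable_length.mul_right η⁻¹).mul_left 2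

theorem norm_prod_gapFactor_le_of_forall_mem (h : GapsDecreaseToZero a b) {μ : ℕ → ℝ}
    (hμ : ∀ j, μ j ∈ Set.Icc (a j) (b j)) {η : ℝ} {z : ℂ} (hz : 0 ≤ z.im) (hη : 0 < η)
    {s : Finset ℕ} (hs : ∀ k ∈ s, η ≤ ‖z - a k‖ ∧ η ≤ ‖z - b k‖) :
    ‖∏ k ∈ s, gapFactor a b μ z k‖ ≤ Real.exp (2 * b 0 / η) := by
  obtain ⟨n, hn⟩ := s.exists_nat_subset_range
  calc ‖∏ k ∈ s, gapFactor a b μ z k‖ = ∏ k ∈ s, ‖gapFactor a b μ z k‖ := norm_prod _ _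
    _ ≤ ∏ k ∈ s, Real.exp (2 * (b k - a k) / η) := by
      apply Finset.prod_le_prod (fun _ _ => norm_nonneg _)
      intro k hk
      have h1 := _root_.norm_gapFactor_sub_one_le (h.2.1 k) (hμ k) hz hη (hs k hk).1 (hs k hk).2
      have h2 : ‖gapFactor a b μ z k‖ ≤ ‖gapFactor a b μ z k - 1‖ + 1 := by
        simpa using norm_add_le (gapFactor a b μ z k - 1) 1
      linarith [Real.add_one_le_exp (2 * (b k - a k) / η)]
    _ = Real.exp (∑ k ∈ s, 2 * (b k - a k) / η) := (Real.exp_sum _ _).symm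
    _ ≤ _ := by
      apply Real.exp_le_exp.2
      rw [← Finset.sum_div, ← Finset.mul_sum]
      have : ∑ k ∈ s, (b k - a k) ≤ ∑ k ∈ Finset.range n, (b k - a k) :=
        Finset.sum_le_sum_of_subset_of_nonneg hn fun k _ _ => by linarith [h.2.1 k]
      have := this.trans (h.sum_length_le n)
      gcongr

section

variable {μ : ℕ → ℝ} {η : ℝ} {z : ℂ} (h : GapsDecreaseToZero a b)
  (hμ : ∀ j, μ j ∈ Set.Icc (a j) (b j)) (hz : 0 ≤ z.im) (hη : 0 < η)
  (hzη : AwayFromEdges a b η z)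

include h hμ hz hη hzη

theorem norm_gapFactor_sub_one_le (k : ℕ) :
    ‖gapFactor a b μ z k - 1‖ ≤ 2 * (b k - a k) / η :=
  _root_.norm_gapFactor_sub_one_le (h.2.1 k) (hμ k) hz hη (hzη k).1 (hzη k).2

theorem summable_gapFactor_sub_one : Summable fun k => gapFactor a b μ z k - 1 :=
  Summable.of_norm_bounded (h.summable_bound η)
    (h.norm_gapFactor_sub_one_le hμ hz hη hzη)

theorem multipliable_gapFactor : Multipliable (gapFactor a b μ z) := by
  have := multipliable_one_add_of_summable (h.summable_gapFactor_sub_one hμ hz hη hzη).norm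
  simpa using this

theorem norm_gapProduct_le :
    ‖gapProduct a b μ z‖ ≤ 1 / (2 * √‖z‖) * Real.exp (2 * b 0 / η) := by
  rw [gapProduct, norm_mul, norm_div, norm_mul, norm_cpow_half]
  simp only [Complex.norm_I, Complex.norm_ofNat]
  gcongr
  refine le_of_tendsto (h.multipliable_gapFactor hμ hz hη hzη).hasProd.norm
    (Eventually.of_forall fun s => ?_)
  rw [← norm_prod]
  exact h.norm_prod_gapFactor_le_of_forall_mem hμ hz hη fun k _ => hzη k

end

theorem awayFromEdges_im (z : ℂ) : AwayFromEdges a b z.im z := by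
  intro k
  constructor
  · simpa using (le_abs_self _).trans (Complex.abs_im_le_norm (z - a k))
  · simpa using (le_abs_self _).trans (Complex.abs_im_le_norm (z - b k))

theorem _root_.AwayFromEdges.add_mul_I {η x : ℝ} (hx : AwayFromEdges a b η (x : ℂ)) (y : ℝ) :
    AwayFromEdges a b η (x + y * Complex.I) := by
  have key : ∀ e : ℝ, ‖(x : ℂ) - e‖ ≤ ‖(x : ℂ) + y * Complex.I - e‖ := by
    intro e
    have h1 : (x : ℂ) - e = ((x - e : ℝ) : ℂ) := by push_cast; ring
    have h2 := Complex.abs_re_le_norm ((x : ℂ) + y * Complex.I - e)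
    rw [h1, Complex.norm_real, Real.norm_eq_abs]
    simpa using h2
  exact fun k => ⟨(hx k).1.trans (key _), (hx k).2.trans (key _)⟩

theorem tendsto_gapFactor {μ : ℕ → ℝ} {x : ℝ} {k : ℕ} (ha : x ≠ a k) (hb : x ≠ b k) :
    Tendsto (fun y : ℝ => gapFactor a b μ (x + y * Complex.I) k) (𝓝[>] 0)
      (𝓝 (gapFactor a b μ x k)) := by
  have hline : ∀ e : ℝ, Tendsto (fun y : ℝ => ((x : ℂ) + y * Complex.I - e) ^ (1 / 2 : ℂ)) (𝓝[>] 0)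
      (𝓝 (((x : ℂ) - e) ^ (1 / 2 : ℂ))) := by
    intro e
    have h1 : ContinuousWithinAt (fun w : ℂ => w ^ (1 / 2 : ℂ)) {w | 0 ≤ w.im} ((x : ℂ) - e) :=
      continuousOn_cpow_half _ (by simp)
    refine h1.tendsto.comp (tendsto_nhdsWithin_iff.2 ⟨?_, ?_⟩)
    · have : Continuous fun y : ℝ => (x : ℂ) + y * Complex.I - e := by fun_prop
      have := (this.tendsto 0).mono_left (nhdsWithin_le_nhds (s := Set.Ioi 0))
      simpa using this
    · filter_upwards [self_mem_nhdsWithin] with y hy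
      have hy : 0 < y := hy
      simpa using hy.le
  have ha' : (x : ℂ) - a k ≠ 0 := by
    rw [← Complex.ofReal_sub, Complex.ofReal_ne_zero]; exact sub_ne_zero.2 ha
  have hb' : (x : ℂ) - b k ≠ 0 := by
    rw [← Complex.ofReal_sub, Complex.ofReal_ne_zero]; exact sub_ne_zero.2 hb
  have hnum : Tendsto (fun y : ℝ => (x : ℂ) + y * Complex.I - μ k) (𝓝[>] 0)
      (𝓝 ((x : ℂ) - μ k)) := by
    have : Continuous fun y : ℝ => (x : ℂ) + y * Complex.I - μ k := by fun_prop
    have := (this.tendsto 0).mono_left (nhdsWithin_le_nhds (s := Set.Ioi 0))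
    simpa using this
  exact hnum.div ((hline _).mul (hline _))
    (mul_ne_zero (cpow_half_ne_zero ha') (cpow_half_ne_zero hb'))

/-- The boundary values are attained vertically. -/
theorem tendsto_gapProduct (h : GapsDecreaseToZero a b) {μ : ℕ → ℝ}
    (hμ : ∀ j, μ j ∈ Set.Icc (a j) (b j)) {x η : ℝ} (hx0 : x ≠ 0) (hη : 0 < η)
    (hx : AwayFromEdges a b η (x : ℂ)) :
    Tendsto (fun y : ℝ => gapProduct a b μ (x + y * Complex.I)) (𝓝[>] 0)
      (𝓝 (gapProduct a b μ x)) := by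
  have hne : ∀ k, x ≠ a k ∧ x ≠ b k := by
    intro k
    constructor
    · rintro rfl; have := (hx k).1; simp at this; linarith
    · rintro rfl; have := (hx k).2; simp at this; linarith
  have h1 : Tendsto (fun y : ℝ => ∏' k, gapFactor a b μ (x + y * Complex.I) k) (𝓝[>] 0)
      (𝓝 (∏' k, gapFactor a b μ x k)) := by
    have := tendsto_tprod_one_add_of_dominated_convergence (h.summable_bound η)
      (f := fun (y : ℝ) k => gapFactor a b μ (x + y * Complex.I) k - 1)
      (g := fun k => gapFactor a b μ x k - 1) (𝓕 := 𝓝[>] (0 : ℝ))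
      (fun k => (tendsto_gapFactor (hne k).1 (hne k).2).sub_const 1) ?_
    · simpa using this
    · filter_upwards [self_mem_nhdsWithin] with y hy k
      have hy : 0 < y := hy
      exact h.norm_gapFactor_sub_one_le hμ (by simpa using hy.le) hη (hx.add_mul_I y) k
  have h2 : Tendsto (fun y : ℝ => ((x : ℂ) + y * Complex.I) ^ (1 / 2 : ℂ)) (𝓝[>] 0)
      (𝓝 ((x : ℂ) ^ (1 / 2 : ℂ))) := by
    have h1 : ContinuousWithinAt (fun w : ℂ => w ^ (1 / 2 : ℂ)) {w | 0 ≤ w.im} (x : ℂ) :=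
      continuousOn_cpow_half _ (by simp)
    refine h1.tendsto.comp (tendsto_nhdsWithin_iff.2 ⟨?_, ?_⟩)
    · have : Continuous fun y : ℝ => (x : ℂ) + y * Complex.I := by fun_prop
      have := (this.tendsto 0).mono_left (nhdsWithin_le_nhds (s := Set.Ioi 0))
      simpa using this
    · filter_upwards [self_mem_nhdsWithin] with y hy
      have hy : 0 < y := hy
      simpa using hy.le
  have hx0' : (x : ℂ) ≠ 0 := by exact_mod_cast hx0
  exact (tendsto_const_nhds.div (h2.const_mul 2)
    (mul_ne_zero two_ne_zero (cpow_half_ne_zero hx0'))).mul h1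

theorem tendsto_gapProduct_mul_I_atTop (h : GapsDecreaseToZero a b) {μ : ℕ → ℝ}
    (hμ : ∀ j, μ j ∈ Set.Icc (a j) (b j)) :
    Tendsto (fun y : ℝ => gapProduct a b μ (y * Complex.I)) atTop (𝓝 0) := by
  have h1 : Tendsto (fun y : ℝ => 1 / (2 * √y) * Real.exp (2 * b 0 / 1)) atTop (𝓝 0) := by
    have h2 : Tendsto (fun y : ℝ => 1 / (2 * √y)) atTop (𝓝 0) := by
      apply Tendsto.div_atTop tendsto_const_nhds
      exact Real.tendsto_sqrt_atTop.const_mul_atTop two_pos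
    simpa using h2.mul_const (Real.exp (2 * b 0 / 1))
  refine squeeze_zero_norm' ?_ h1
  filter_upwards [eventually_ge_atTop 1] with y hy
  have hz : ((y : ℂ) * Complex.I).im = y := by simp
  have h3 := h.norm_gapProduct_le hμ (z := y * Complex.I) (by rw [hz]; linarith) one_pos
    ((awayFromEdges_im _).mono (hz.symm ▸ hy))
  have hn : ‖(y : ℂ) * Complex.I‖ = y := by
    simp; linarith
  rwa [hn] at h3

theorem differentiableOn_gapProduct (h : GapsDecreaseToZero a b) {μ : ℕ → ℝ}
    (hμ : ∀ j, μ j ∈ Set.Icc (a j) (b j)) :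
    DifferentiableOn ℂ (gapProduct a b μ) {z | 0 < z.im} := by
  have hslit : ∀ e : ℝ, ∀ z : ℂ, 0 < z.im →
      DifferentiableAt ℂ (fun z : ℂ => (z - e) ^ (1 / 2 : ℂ)) z := by
    intro e z hz
    apply DifferentiableAt.cpow (by fun_prop) (by fun_prop)
    right; simpa using hz.ne'
  have hne : ∀ e : ℝ, ∀ z : ℂ, 0 < z.im → z - e ≠ 0 := by
    intro e z hz h
    have := congrArg Complex.im h; simp at this; linarith
  have hfac : ∀ k, ∀ z : ℂ, 0 < z.im → DifferentiableAt ℂ (fun z => gapFactor a b μ z k) z := by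
    intro k z hz
    exact DifferentiableAt.div (by fun_prop) ((hslit _ z hz).mul (hslit _ z hz))
      (mul_ne_zero (cpow_half_ne_zero (hne _ z hz)) (cpow_half_ne_zero (hne _ z hz)))
  intro z₀ hz₀
  have hz₀ : 0 < z₀.im := hz₀
  apply DifferentiableAt.differentiableWithinAt
  have hopen : IsOpen {z : ℂ | z₀.im / 2 < z.im} := isOpen_lt continuous_const Complex.continuous_im
  have hη : 0 < z₀.im / 2 := by linarith
  have hU : HasProdLocallyUniformlyOn (fun k z => 1 + (gapFactor a b μ z k - 1))
      (fun z => ∏' k, (1 + (gapFactor a b μ z k - 1))) {z : ℂ | z₀.im / 2 < z.im} := by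
    apply Summable.hasProdLocallyUniformlyOn_nat_one_add hopen (h.summable_bound (z₀.im / 2))
    · refine Eventually.of_forall fun k z hz => ?_
      have hz : z₀.im / 2 < z.im := hz
      exact h.norm_gapFactor_sub_one_le hμ (by linarith) hη
        ((awayFromEdges_im z).mono hz.le) k
    · intro k z hz
      have hz : z₀.im / 2 < z.im := hz
      exact ((hfac k z (by linarith)).continuousAt.sub continuousAt_const).continuousWithinAt
  have hd : DifferentiableOn ℂ (fun z => ∏' k, (1 + (gapFactor a b μ z k - 1)))
      {z : ℂ | z₀.im / 2 < z.im} := by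
    refine TendstoLocallyUniformlyOn.differentiableOn
      (hasProdLocallyUniformlyOn_iff_tendstoLocallyUniformlyOn.1 hU) ?_ hopen
    refine Eventually.of_forall fun s => ?_
    intro z hz
    have hz : z₀.im / 2 < z.im := hz
    apply DifferentiableAt.differentiableWithinAt
    apply DifferentiableAt.fun_finsetProd
    intro k _
    exact ((hfac k z (by linarith)).sub_const 1).const_add 1
  have hd0 := hd.differentiableAt (hopen.mem_nhds (show z₀.im / 2 < z₀.im by linarith))
  simp only [add_sub_cancel] at hd0
  have h1 := hslit 0 z₀ hz₀
  simp only [Complex.ofReal_zero, sub_zero] at h1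
  have h2 : z₀ ≠ 0 := by simpa using hne 0 z₀ hz₀
  exact (DifferentiableAt.div (by fun_prop) (h1.const_mul 2)
    (mul_ne_zero two_ne_zero (cpow_half_ne_zero h2))).mul hd0

end GapsDecreaseToZero

/-! ### The Herglotz property -/

theorem arg_eq_sub_arctan {w : ℂ} (hw : 0 < w.im) :
    w.arg = Real.pi / 2 - Real.arctan (w.re / w.im) := by
  set t := w.re / w.im with ht
  have h1 : 0 < √(1 + t ^ 2) := Real.sqrt_pos.2 (by positivity)
  have hcos : Real.cos (Real.pi / 2 - Real.arctan t) = t / √(1 + t ^ 2) := by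
    rw [Real.cos_pi_div_two_sub, Real.sin_arctan]
  have hsin : Real.sin (Real.pi / 2 - Real.arctan t) = 1 / √(1 + t ^ 2) := by
    rw [Real.sin_pi_div_two_sub, Real.cos_arctan]
  have key : w = ((w.im * √(1 + t ^ 2) : ℝ) : ℂ) *
      (Complex.cos ((Real.pi / 2 - Real.arctan t : ℝ) : ℂ) +
        Complex.sin ((Real.pi / 2 - Real.arctan t : ℝ) : ℂ) * Complex.I) := by
    rw [← Complex.ofReal_cos, ← Complex.ofReal_sin, hcos, hsin]
    have hre : w.re = w.im * t := by rw [ht]; field_simp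
    apply Complex.ext
    · simp only [Complex.mul_re, Complex.add_re, Complex.ofReal_re, Complex.ofReal_im,
        Complex.I_re, Complex.I_im, Complex.add_im, Complex.mul_im, mul_zero, sub_zero, zero_mul,
        add_zero]
      rw [hre]; field_simp
    · simp only [Complex.mul_re, Complex.add_re, Complex.ofReal_re, Complex.ofReal_im,
        Complex.I_re, Complex.I_im, Complex.add_im, Complex.mul_im, mul_zero, zero_mul,
        add_zero, zero_add, mul_one]
      field_simp
  conv_lhs => rw [key]
  rw [Complex.arg_mul_cos_add_sin_mul_I (by positivity)]
  constructor
  · linarith [Real.arctan_lt_pi_div_two t, Real.pi_pos]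
  · linarith [Real.neg_pi_div_two_lt_arctan t]

theorem arg_sub_mono {z : ℂ} (hz : 0 < z.im) {x y : ℝ} (hxy : x ≤ y) :
    (z - x).arg ≤ (z - y).arg := by
  rw [arg_eq_sub_arctan (by simpa using hz), arg_eq_sub_arctan (by simpa using hz)]
  have : Real.arctan ((z - y).re / (z - y).im) ≤ Real.arctan ((z - x).re / (z - x).im) := by
    apply Real.arctan_mono
    simp only [Complex.sub_re, Complex.ofReal_re, Complex.sub_im, Complex.ofReal_im, sub_zero]
    gcongr
  linarith

theorem arg_pos_of_im_pos {w : ℂ} (hw : 0 < w.im) : 0 < w.arg := by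
  rw [arg_eq_sub_arctan hw]; linarith [Real.arctan_lt_pi_div_two (w.re / w.im)]

theorem arg_lt_pi_of_im_pos {w : ℂ} (hw : 0 < w.im) : w.arg < Real.pi := by
  rw [arg_eq_sub_arctan hw]; linarith [Real.neg_pi_div_two_lt_arctan (w.re / w.im)]

/-- `θ` is an argument of `w`, without the restriction to the principal branch. -/
def HasArg (w : ℂ) (θ : ℝ) : Prop := w = ‖w‖ * Complex.exp (θ * Complex.I)

theorem hasArg_arg (w : ℂ) : HasArg w w.arg := (Complex.norm_mul_exp_arg_mul_I w).symm

namespace HasArg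

variable {w₁ w₂ : ℂ} {θ₁ θ₂ : ℝ}

theorem mul (h₁ : HasArg w₁ θ₁) (h₂ : HasArg w₂ θ₂) : HasArg (w₁ * w₂) (θ₁ + θ₂) := by
  unfold HasArg at *
  conv_lhs => rw [h₁, h₂]
  rw [norm_mul]
  push_cast
  rw [add_mul, Complex.exp_add]
  ring

theorem inv (h₁ : HasArg w₁ θ₁) : HasArg w₁⁻¹ (-θ₁) := by
  unfold HasArg at *
  conv_lhs => rw [h₁]
  rw [norm_inv, mul_inv, ← Complex.exp_neg]
  push_cast
  rw [neg_mul]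

theorem div (h₁ : HasArg w₁ θ₁) (h₂ : HasArg w₂ θ₂) : HasArg (w₁ / w₂) (θ₁ - θ₂) := by
  rw [div_eq_mul_inv, sub_eq_add_neg]
  exact h₁.mul h₂.inv

theorem cpow_half {w : ℂ} (hw : w ≠ 0) : HasArg (w ^ (1 / 2 : ℂ)) (w.arg / 2) := by
  unfold HasArg
  have hexp : w ^ (1 / 2 : ℂ) =
      Complex.exp ((Real.log ‖w‖ / 2 : ℝ)) * Complex.exp ((w.arg / 2 : ℝ) * Complex.I) := by
    rw [Complex.cpow_def_of_ne_zero hw, ← Complex.exp_add, Complex.log]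
    congr 1
    push_cast
    ring
  have hn : ‖w ^ (1 / 2 : ℂ)‖ = Real.exp (Real.log ‖w‖ / 2) := by
    rw [hexp, norm_mul, Complex.norm_exp_ofReal_mul_I, mul_one, ← Complex.ofReal_exp,
      Complex.norm_real, Real.norm_of_nonneg (Real.exp_pos _).le]
  rw [hn, hexp, Complex.ofReal_exp]

theorem im_eq (h₁ : HasArg w₁ θ₁) : w₁.im = ‖w₁‖ * Real.sin θ₁ := by
  unfold HasArg at h₁
  conv_lhs => rw [h₁]
  rw [Complex.im_ofReal_mul, Complex.exp_ofReal_mul_I_im]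

end HasArg

/-- The sine is quasiconcave on `[0, π]`. -/
theorem Real.min_sin_le_sin {x y t : ℝ} (hx : 0 ≤ x) (hxt : x ≤ t) (hty : t ≤ y)
    (hy : y ≤ Real.pi) : min (Real.sin x) (Real.sin y) ≤ Real.sin t := by
  rcases le_total t (Real.pi / 2) with ht | ht
  · exact (min_le_left _ _).trans
      (Real.sin_le_sin_of_le_of_le_pi_div_two (by linarith [Real.pi_pos]) ht hxt)
  · refine (min_le_right _ _).trans ?_
    rw [← Real.sin_pi_sub y, ← Real.sin_pi_sub t]
    exact Real.sin_le_sin_of_le_of_le_pi_div_two (by linarith [Real.pi_pos]) (by linarith)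
      (by linarith)

namespace GapsDecreaseToZero

variable {a b : ℕ → ℝ}

theorem tprod_gapFactor_ne_zero (h : GapsDecreaseToZero a b) {μ : ℕ → ℝ}
    (hμ : ∀ j, μ j ∈ Set.Icc (a j) (b j)) {z : ℂ} (hz : 0 < z.im) :
    ∏' k, gapFactor a b μ z k ≠ 0 := by
  have hne : ∀ e : ℝ, z - e ≠ 0 := by
    intro e h
    have := congrArg Complex.im h; simp at this; linarith
  have hs := (h.summable_gapFactor_sub_one hμ hz.le hz (awayFromEdges_im z)).norm
  have := tprod_one_add_ne_zero_of_summable (f := fun k => gapFactor a b μ z k - 1) (fun k => ?_) hs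
  · simpa using this
  · rw [add_sub_cancel]
    exact div_ne_zero (hne _) (mul_ne_zero (cpow_half_ne_zero (hne _)) (cpow_half_ne_zero (hne _)))

/-- The arguments of the partial products stay in a fixed compact part of `(0, π)`: the
contributions of the gaps telescope, because `arg (z - x)` increases with `x`. -/
theorem exists_hasArg_partialProduct (h : GapsDecreaseToZero a b) {μ : ℕ → ℝ}
    (hμ : ∀ j, μ j ∈ Set.Icc (a j) (b j)) {z : ℂ} (hz : 0 < z.im) (n : ℕ) :
    ∃ θ : ℝ, HasArg (Complex.I / (2 * z ^ (1 / 2 : ℂ)) *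
        ∏ k ∈ Finset.range n, gapFactor a b μ z k) θ ∧
      (Real.pi - (z - b 0).arg) / 2 ≤ θ ∧ θ ≤ Real.pi - z.arg := by
  have hz0 : z ≠ 0 := by rintro rfl; simp at hz
  have him : ∀ e : ℝ, 0 < (z - e).im := fun e => by simpa using hz
  have hne : ∀ e : ℝ, z - e ≠ 0 := by
    intro e h
    have := him e; rw [h] at this; simp at this
  have hpre : HasArg (Complex.I / (2 * z ^ (1 / 2 : ℂ))) (Real.pi / 2 - (0 + z.arg / 2)) := by
    refine HasArg.div ?_ (HasArg.mul ?_ (HasArg.cpow_half hz0))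
    · have := hasArg_arg Complex.I
      rwa [Complex.arg_I] at this
    · unfold HasArg; simp
  have hfac : ∀ k, HasArg (gapFactor a b μ z k)
      ((z - μ k).arg - ((z - a k).arg / 2 + (z - b k).arg / 2)) := fun k =>
    (hasArg_arg _).div ((HasArg.cpow_half (hne _)).mul (HasArg.cpow_half (hne _)))
  have hprod : ∀ n, HasArg (∏ k ∈ Finset.range n, gapFactor a b μ z k)
      (∑ k ∈ Finset.range n, ((z - μ k).arg - ((z - a k).arg / 2 + (z - b k).arg / 2))) := by
    intro n
    induction n with
    | zero => unfold HasArg; simp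
    | succ n ih => rw [Finset.prod_range_succ, Finset.sum_range_succ]; exact ih.mul (hfac n)
  have htel : ∀ n, ∑ k ∈ Finset.range n, ((z - b k).arg - (z - a k).arg) ≤
      (z - b 0).arg - z.arg := by
    have hzarg : ∀ e : ℝ, 0 < e → z.arg ≤ (z - e).arg := fun e he => by
      simpa using arg_sub_mono hz (x := 0) he.le
    have : ∀ n, ∑ k ∈ Finset.range (n + 1), ((z - b k).arg - (z - a k).arg) ≤
        (z - b 0).arg - (z - a n).arg := by
      intro n
      induction n with
      | zero => simp
      | succ n ih =>
        rw [Finset.sum_range_succ]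
        linarith [arg_sub_mono hz (h.2.2.1 n).le]
    intro m
    cases m with
    | zero => simpa using hzarg _ (h.b_pos 0)
    | succ m => linarith [this m, hzarg _ (h.1 m)]
  refine ⟨_, hpre.mul (hprod n), ?_, ?_⟩
  · have h1 : ∑ k ∈ Finset.range n, (-((z - b k).arg - (z - a k).arg) / 2) ≤
        ∑ k ∈ Finset.range n, ((z - μ k).arg - ((z - a k).arg / 2 + (z - b k).arg / 2)) := by
      apply Finset.sum_le_sum
      intro k _
      linarith [arg_sub_mono hz (hμ k).1]
    rw [← Finset.sum_div, Finset.sum_neg_distrib] at h1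
    linarith [htel n]
  · have h1 : ∑ k ∈ Finset.range n, ((z - μ k).arg - ((z - a k).arg / 2 + (z - b k).arg / 2)) ≤
        ∑ k ∈ Finset.range n, (((z - b k).arg - (z - a k).arg) / 2) := by
      apply Finset.sum_le_sum
      intro k _
      linarith [arg_sub_mono hz (hμ k).2]
    rw [← Finset.sum_div] at h1
    linarith [htel n, arg_lt_pi_of_im_pos (him (b 0))]

/-- As the arguments of the partial products stay in a compact part of `(0, π)`, the imaginary part
of the limit is at least a positive multiple of its modulus. -/
theorem isHerglotz_gapProduct (h : GapsDecreaseToZero a b) {μ : ℕ → ℝ}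
    (hμ : ∀ j, μ j ∈ Set.Icc (a j) (b j)) : IsHerglotz (gapProduct a b μ) := by
  refine ⟨h.differentiableOn_gapProduct hμ, fun z hz => ?_⟩
  have hz0 : z ≠ 0 := by rintro rfl; simp at hz
  have hpos := arg_pos_of_im_pos hz
  have hlt := arg_lt_pi_of_im_pos (w := z - b 0) (by simpa using hz)
  have hpos0 := arg_pos_of_im_pos (w := z - b 0) (by simpa using hz)
  set s := min (Real.sin ((Real.pi - (z - b 0).arg) / 2)) (Real.sin (Real.pi - z.arg)) with hs
  have hs0 : 0 < s := by
    apply lt_min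
    · apply Real.sin_pos_of_pos_of_lt_pi <;> linarith [Real.pi_pos]
    · rw [Real.sin_pi_sub]
      exact Real.sin_pos_of_pos_of_lt_pi hpos (arg_lt_pi_of_im_pos hz)
  have hlim : Tendsto (fun n => Complex.I / (2 * z ^ (1 / 2 : ℂ)) *
      ∏ k ∈ Finset.range n, gapFactor a b μ z k) atTop (𝓝 (gapProduct a b μ z)) :=
    ((h.multipliable_gapFactor hμ hz.le hz
      (awayFromEdges_im z)).hasProd.tendsto_prod_nat).const_mul _
  have hne : gapProduct a b μ z ≠ 0 :=
    mul_ne_zero (div_ne_zero Complex.I_ne_zero (mul_ne_zero two_ne_zero (cpow_half_ne_zero hz0)))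
      (h.tprod_gapFactor_ne_zero hμ hz)
  have hle : s * ‖gapProduct a b μ z‖ ≤ (gapProduct a b μ z).im := by
    refine le_of_tendsto_of_tendsto' (hlim.norm.const_mul s)
      ((Complex.continuous_im.tendsto _).comp hlim) fun n => ?_
    obtain ⟨θ, hθ, h1, h2⟩ := h.exists_hasArg_partialProduct hμ hz n
    rw [Function.comp_apply, hθ.im_eq, mul_comm]
    gcongr
    exact Real.min_sin_le_sin (by linarith) h1 h2 (by linarith)
  exact (mul_pos hs0 (norm_pos_iff.2 hne)).trans_le hle

end GapsDecreaseToZero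

/-! ### Boundary values on the real line -/

/-- The modulus of the `k`-th factor of the product at the real point `x`. -/
noncomputable def realFactor (a b μ : ℕ → ℝ) (x : ℝ) (k : ℕ) : ℝ :=
  |x - μ k| / (√|x - a k| * √|x - b k|)

theorem realFactor_nonneg (a b μ : ℕ → ℝ) (x : ℝ) (k : ℕ) : 0 ≤ realFactor a b μ x k := by
  unfold realFactor; positivity

/-- In the gap `(a j, b j)`, the product equals `(x - μ j)` times this positive weight, which does
not depend on `μ j`: the factors of the gaps to the right of `x` have index `k < j`, those of the
gaps to the left have index `k > j`. -/
noncomputable def gapWeight (a b μ : ℕ → ℝ) (j : ℕ) (x : ℝ) : ℝ :=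
  1 / (2 * √x) * (∏ k ∈ Finset.range j, realFactor a b μ x k) *
    (∏' i, realFactor a b μ x (i + (j + 1))) / (√(x - a j) * √(b j - x))

/-- Without convergence, the two infinite products could take unrelated default values. -/
theorem tprod_ofReal_of_summable {r : ℕ → ℝ} (hr : Summable fun k => r k - 1) :
    Multipliable r ∧ ∏' k, (r k : ℂ) = ((∏' k, r k : ℝ) : ℂ) := by
  have h1 : Multipliable r := by
    have := Real.multipliable_one_add_of_summable hr
    simpa using this
  refine ⟨h1, ?_⟩
  exact (h1.hasProd.map Complex.ofRealHom Complex.continuous_ofReal).tprod_eq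

section

variable {a b μ : ℕ → ℝ} {x : ℝ} {k : ℕ}

theorem gapFactor_of_lt (hab : a k < b k) (hμ : μ k ∈ Set.Icc (a k) (b k)) (hx : x < a k) :
    gapFactor a b μ x k = realFactor a b μ x k := by
  have h1 := cpow_half_of_nonpos (x := x - a k) (by linarith)
  have h2 := cpow_half_of_nonpos (x := x - b k) (by linarith)
  have ha : 0 < √(-(x - a k)) := Real.sqrt_pos.2 (by linarith)
  have hb : 0 < √(-(x - b k)) := Real.sqrt_pos.2 (by linarith)
  have ha' : ((√(-(x - a k)) : ℝ) : ℂ) ≠ 0 := by exact_mod_cast ha.ne'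
  have hb' : ((√(-(x - b k)) : ℝ) : ℂ) ≠ 0 := by exact_mod_cast hb.ne'
  push_cast at h1 h2
  rw [gapFactor, realFactor, h1, h2, abs_of_neg (by linarith : x - a k < 0),
    abs_of_neg (by linarith : x - b k < 0), abs_of_neg (by linarith [hμ.1] : x - μ k < 0)]
  have hden : ((√(-(x - a k)) : ℝ) : ℂ) * Complex.I * (((√(-(x - b k)) : ℝ) : ℂ) * Complex.I) =
      -(((√(-(x - a k)) : ℝ) : ℂ) * ((√(-(x - b k)) : ℝ) : ℂ)) := by
    linear_combination (((√(-(x - a k)) : ℝ) : ℂ) * ((√(-(x - b k)) : ℝ) : ℂ)) * Complex.I_sq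
  rw [hden, div_neg, ← neg_div]
  push_cast
  rfl

theorem gapFactor_of_gt (hab : a k < b k) (hμ : μ k ∈ Set.Icc (a k) (b k)) (hx : b k < x) :
    gapFactor a b μ x k = realFactor a b μ x k := by
  have h1 := cpow_half_of_nonneg (x := x - a k) (by linarith)
  have h2 := cpow_half_of_nonneg (x := x - b k) (by linarith)
  push_cast at h1 h2
  rw [gapFactor, realFactor, h1, h2, abs_of_pos (by linarith : 0 < x - a k),
    abs_of_pos (by linarith : 0 < x - b k), abs_of_pos (by linarith [hμ.2] : 0 < x - μ k)]
  push_cast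
  rfl

theorem gapFactor_of_mem (hx : x ∈ Set.Ioo (a k) (b k)) :
    gapFactor a b μ x k = -Complex.I * ((x - μ k) / (√(x - a k) * √(b k - x)) : ℝ) := by
  have h1 := cpow_half_of_nonneg (x := x - a k) (by linarith [hx.1])
  have h2 := cpow_half_of_nonpos (x := x - b k) (by linarith [hx.2])
  rw [neg_sub] at h2
  have ha : 0 < √(x - a k) := Real.sqrt_pos.2 (by linarith [hx.1])
  have hb : 0 < √(b k - x) := Real.sqrt_pos.2 (by linarith [hx.2])
  have ha' : ((√(x - a k) : ℝ) : ℂ) ≠ 0 := by exact_mod_cast ha.ne'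
  have hb' : ((√(b k - x) : ℝ) : ℂ) ≠ 0 := by exact_mod_cast hb.ne'
  push_cast at h1 h2
  rw [gapFactor, h1, h2]
  have hI := Complex.I_sq
  push_cast
  rw [mul_div_assoc', div_eq_div_iff (mul_ne_zero ha' (mul_ne_zero hb' Complex.I_ne_zero))
    (mul_ne_zero ha' hb')]
  linear_combination ((x : ℂ) - μ k) * (√(x - a k) : ℝ) * (√(b k - x) : ℝ) * hI

end

namespace GapsDecreaseToZero

variable {a b μ : ℕ → ℝ}

/-- The endpoints of the gaps accumulate only at the origin. -/
theorem exists_awayFromEdges (h : GapsDecreaseToZero a b) {z : ℂ} (hz0 : z ≠ 0)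
    (hz : ∀ k, z ≠ a k ∧ z ≠ b k) : ∃ η : ℝ, 0 < η ∧ AwayFromEdges a b η z := by
  have hbt : Tendsto (fun k => (b k : ℂ)) atTop (𝓝 0) := by
    exact_mod_cast (Complex.continuous_ofReal.tendsto 0).comp h.2.2.2
  have hat' : Tendsto a atTop (𝓝 0) :=
    squeeze_zero (fun k => (h.1 k).le) (fun k => (h.2.1 k).le) h.2.2.2
  have hat : Tendsto (fun k => (a k : ℂ)) atTop (𝓝 0) := by
    exact_mod_cast (Complex.continuous_ofReal.tendsto 0).comp hat'
  have hc := (hat.isCompact_insert_range.union hbt.isCompact_insert_range).isClosed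
  set D := insert 0 (Set.range fun k => (a k : ℂ)) ∪ insert 0 (Set.range fun k => (b k : ℂ))
  have hzD : z ∉ D := by
    rintro ((h1 | ⟨k, hk⟩) | (h1 | ⟨k, hk⟩))
    · exact hz0 h1
    · exact (hz k).1 hk.symm
    · exact hz0 h1
    · exact (hz k).2 hk.symm
  have hDne : D.Nonempty := ⟨0, Or.inl (Set.mem_insert _ _)⟩
  refine ⟨Metric.infDist z D, (hc.notMem_iff_infDist_pos hDne).1 hzD, fun k => ⟨?_, ?_⟩⟩
  · rw [← dist_eq_norm]
    exact Metric.infDist_le_dist_of_mem (Or.inl (Set.mem_insert_of_mem _ ⟨k, rfl⟩))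
  · rw [← dist_eq_norm]
    exact Metric.infDist_le_dist_of_mem (Or.inr (Set.mem_insert_of_mem _ ⟨k, rfl⟩))

theorem exists_awayFromEdges_ofReal (h : GapsDecreaseToZero a b) {x : ℝ} (hx0 : x ≠ 0)
    (hx : ∀ k, x ≠ a k ∧ x ≠ b k) : ∃ η : ℝ, 0 < η ∧ AwayFromEdges a b η (x : ℂ) :=
  h.exists_awayFromEdges (by exact_mod_cast hx0) (fun k => by exact_mod_cast hx k)

theorem a_notMem_gaps (h : GapsDecreaseToZero a b) (j : ℕ) : a j ∉ ⋃ k, Set.Ioo (a k) (b k) := by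
  rw [Set.mem_iUnion]
  rintro ⟨k, h1, h2⟩
  rcases lt_trichotomy k j with hkj | rfl | hkj
  · linarith [h.b_lt_a hkj, h.2.1 j]
  · exact lt_irrefl _ h1
  · linarith [h.b_lt_a hkj]

theorem b_notMem_gaps (h : GapsDecreaseToZero a b) (j : ℕ) : b j ∉ ⋃ k, Set.Ioo (a k) (b k) := by
  rw [Set.mem_iUnion]
  rintro ⟨k, h1, h2⟩
  rcases lt_trichotomy k j with hkj | rfl | hkj
  · linarith [h.b_lt_a hkj]
  · exact lt_irrefl _ h2
  · linarith [h.b_lt_a hkj, h.2.1 j]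

theorem isClosed_spectrum (a b : ℕ → ℝ) : IsClosed (Set.Ici (0 : ℝ) \ ⋃ j, Set.Ioo (a j) (b j)) :=
  isClosed_Ici.sdiff (isOpen_iUnion fun _ => isOpen_Ioo)

theorem gapProductConverges (h : GapsDecreaseToZero a b) (hμ : ∀ j, μ j ∈ Set.Icc (a j) (b j)) :
    GapProductConverges (Set.Ici (0 : ℝ) \ ⋃ j, Set.Ioo (a j) (b j)) a b μ := by
  intro z hz hzE
  have hne : ∀ e : ℝ, 0 ≤ e → e ∉ (⋃ j, Set.Ioo (a j) (b j)) → z ≠ e := by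
    rintro e he he' rfl
    exact hzE ⟨e, ⟨he, he'⟩, rfl⟩
  obtain ⟨η, hη, hzη⟩ := h.exists_awayFromEdges (z := z) (by
      have := hne 0 le_rfl (fun h0 => by
        obtain ⟨k, hk⟩ := Set.mem_iUnion.1 h0
        linarith [h.1 k, hk.1])
      simpa using this)
    (fun k => ⟨hne _ (h.1 k).le (h.a_notMem_gaps k), hne _ (h.b_pos k).le (h.b_notMem_gaps k)⟩)
  exact h.multipliable_gapFactor hμ hz hη hzη

theorem summable_realFactor_sub_one_neg (h : GapsDecreaseToZero a b)
    (hμ : ∀ j, μ j ∈ Set.Icc (a j) (b j)) {x : ℝ} (hx : x < 0) :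
    Summable fun k => realFactor a b μ x k - 1 := by
  obtain ⟨η, hη, hxη⟩ := h.exists_awayFromEdges_ofReal hx.ne
    (fun k => ⟨by linarith [h.1 k], by linarith [h.b_pos k]⟩)
  have hfac : ∀ k, gapFactor a b μ x k = realFactor a b μ x k := fun k =>
    gapFactor_of_lt (h.2.1 k) (hμ k) (by linarith [h.1 k])
  have := h.summable_gapFactor_sub_one hμ (by simp) hη hxη
  simp only [hfac] at this
  exact_mod_cast this

theorem gapProduct_of_neg (h : GapsDecreaseToZero a b) (hμ : ∀ j, μ j ∈ Set.Icc (a j) (b j))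
    {x : ℝ} (hx : x < 0) :
    gapProduct a b μ x = ((1 / (2 * √(-x)) * ∏' k, realFactor a b μ x k : ℝ) : ℂ) := by
  have hfac : ∀ k, gapFactor a b μ x k = realFactor a b μ x k := fun k =>
    gapFactor_of_lt (h.2.1 k) (hμ k) (by linarith [h.1 k])
  have hs : (((√(-x)) : ℝ) : ℂ) ≠ 0 := by
    exact_mod_cast (Real.sqrt_pos.2 (by linarith : 0 < -x)).ne'
  rw [gapProduct, cpow_half_of_nonpos hx.le]
  simp only [hfac]
  rw [(tprod_ofReal_of_summable (h.summable_realFactor_sub_one_neg hμ hx)).2]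
  push_cast
  congr 1
  field_simp

/-- To the right of `a j`, the product over the gaps `k > j` converges. -/
theorem summable_realFactor_sub_one_tail (h : GapsDecreaseToZero a b)
    (hμ : ∀ j, μ j ∈ Set.Icc (a j) (b j)) {x : ℝ} {j : ℕ} (hx : a j ≤ x) :
    Summable fun k => realFactor a b μ x (k + (j + 1)) - 1 := by
  have hlt : ∀ k, b (k + (j + 1)) < x := fun k => (h.b_lt_a (by omega)).trans_le hx
  have hη : 0 < x - b (j + 1) := by linarith [h.2.2.1 j]
  have hfac : ∀ k, gapFactor a b μ x (k + (j + 1)) = realFactor a b μ x (k + (j + 1)) := fun k =>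
    gapFactor_of_gt (h.2.1 _) (hμ _) (hlt k)
  have hb : ∀ k, ‖realFactor a b μ x (k + (j + 1)) - 1‖ ≤
      2 * (b (k + (j + 1)) - a (k + (j + 1))) / (x - b (j + 1)) := by
    intro k
    have hbk : b (k + (j + 1)) ≤ b (j + 1) := h.b_antitone (by omega)
    have h1 := _root_.norm_gapFactor_sub_one_le (z := (x : ℂ)) (h.2.1 (k + (j + 1))) (hμ _) (by simp) hη
      (by rw [← Complex.ofReal_sub, Complex.norm_real]
          exact le_trans (by linarith [h.2.1 (k + (j + 1))]) (le_abs_self _))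
      (by rw [← Complex.ofReal_sub, Complex.norm_real]
          exact le_trans (by linarith) (le_abs_self _))
    rw [hfac, ← Complex.ofReal_one, ← Complex.ofReal_sub, Complex.norm_real] at h1
    exact h1
  exact Summable.of_norm_bounded
    ((summable_nat_add_iff (j + 1)).2 (h.summable_bound (x - b (j + 1)))) hb

theorem gapProduct_of_mem_gap (h : GapsDecreaseToZero a b) (hμ : ∀ j, μ j ∈ Set.Icc (a j) (b j))
    {x : ℝ} {j : ℕ} (hx : x ∈ Set.Ioo (a j) (b j)) :
    gapProduct a b μ x = (((x - μ j) * gapWeight a b μ j x : ℝ) : ℂ) := by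
  have hx0 : 0 < x := (h.1 j).trans hx.1
  have htail : ∀ k, gapFactor a b μ x (k + (j + 1)) = realFactor a b μ x (k + (j + 1)) := fun k =>
    gapFactor_of_gt (h.2.1 _) (hμ _) ((h.b_lt_a (by omega)).trans hx.1)
  have hhead : ∀ k ∈ Finset.range j, gapFactor a b μ x k = realFactor a b μ x k := fun k hk =>
    gapFactor_of_lt (h.2.1 _) (hμ _) (hx.2.trans (h.b_lt_a (Finset.mem_range.1 hk)))
  obtain ⟨hm, ht⟩ := tprod_ofReal_of_summable (h.summable_realFactor_sub_one_tail hμ hx.1.le)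
  have hmC : Multipliable fun k => gapFactor a b μ x (k + (j + 1)) := by
    simp only [htail]
    exact ⟨_, hm.hasProd.map Complex.ofRealHom Complex.continuous_ofReal⟩
  rw [gapProduct, ← hmC.prod_mul_tprod_nat_mul', Finset.prod_range_succ,
    Finset.prod_congr rfl hhead, gapFactor_of_mem hx, cpow_half_of_nonneg hx0.le]
  simp only [htail]
  rw [ht, gapWeight]
  push_cast
  have hI := Complex.I_sq
  linear_combination (-((x : ℂ) - μ j) * (∏ k ∈ Finset.range j, (realFactor a b μ x k : ℂ)) *
    ((∏' i, realFactor a b μ x (i + (j + 1)) : ℝ) : ℂ) * ((√(x - a j) : ℝ) : ℂ)⁻¹ *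
    ((√(b j - x) : ℝ) : ℂ)⁻¹ * ((√x : ℝ) : ℂ)⁻¹ / 2) * hI

theorem im_gapProduct_eq_zero (h : GapsDecreaseToZero a b) (hμ : ∀ j, μ j ∈ Set.Icc (a j) (b j))
    {x : ℝ} (hx : x ∉ Set.Ici (0 : ℝ) \ ⋃ j, Set.Ioo (a j) (b j)) :
    (gapProduct a b μ x).im = 0 := by
  rcases lt_or_ge x 0 with hx0 | hx0
  · rw [h.gapProduct_of_neg hμ hx0, Complex.ofReal_im]
  · have : x ∈ ⋃ j, Set.Ioo (a j) (b j) := by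
      by_contra hc; exact hx ⟨hx0, hc⟩
    obtain ⟨j, hj⟩ := Set.mem_iUnion.1 this
    rw [h.gapProduct_of_mem_gap hμ hj, Complex.ofReal_im]

theorem exists_isHerglotzMeasure (h : GapsDecreaseToZero a b)
    (hμ : ∀ j, μ j ∈ Set.Icc (a j) (b j)) :
    ∃ σ : Measure ℝ, SFinite σ ∧
      IsHerglotzMeasure (Set.Ici (0 : ℝ) \ ⋃ j, Set.Ioo (a j) (b j)) (gapProduct a b μ) σ ∧
      PoissonIntegralLE (gapProduct a b μ) σ := by
  refine (h.isHerglotz_gapProduct hμ).exists_isHerglotzMeasure Set.sdiff_subset ?_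
    (h.tendsto_gapProduct_mul_I_atTop hμ)
  intro x hx
  have hx0 : x ≠ 0 := by
    rintro rfl
    refine hx ⟨Set.self_mem_Ici, fun h0 => ?_⟩
    obtain ⟨k, hk⟩ := Set.mem_iUnion.1 h0
    linarith [h.1 k, hk.1]
  have hne : ∀ k, x ≠ a k ∧ x ≠ b k := by
    intro k
    constructor
    · rintro rfl; exact hx ⟨(h.1 k).le, h.a_notMem_gaps k⟩
    · rintro rfl; exact hx ⟨(h.b_pos k).le, h.b_notMem_gaps k⟩
  obtain ⟨η, hη, hxη⟩ := h.exists_awayFromEdges_ofReal hx0 hne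
  have := (Complex.continuous_im.tendsto _).comp (h.tendsto_gapProduct hμ hx0 hη hxη)
  rwa [h.im_gapProduct_eq_zero hμ hx] at this

/-- On the negative half-line the product is the Cauchy transform of its Herglotz measure. -/
theorem gapProduct_neg_eq_integral (h : GapsDecreaseToZero a b)
    (hμ : ∀ j, μ j ∈ Set.Icc (a j) (b j)) {σ : Measure ℝ}
    (hσ : IsHerglotzMeasure (Set.Ici (0 : ℝ) \ ⋃ j, Set.Ioo (a j) (b j)) (gapProduct a b μ) σ)
    {ε : ℝ} (hε : 0 < ε) :
    gapProduct a b μ ((-ε : ℝ) : ℂ) = ((∫ t : ℝ, 1 / (t + ε) ∂σ : ℝ) : ℂ) := by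
  obtain ⟨η, hη, hxη⟩ := h.exists_awayFromEdges_ofReal (x := -ε) (by linarith)
    (fun k => ⟨by linarith [h.1 k], by linarith [h.b_pos k]⟩)
  exact tendsto_nhds_unique (h.tendsto_gapProduct hμ (by linarith) hη hxη)
    (hσ.tendsto_neg Set.sdiff_subset hε)

end GapsDecreaseToZero

/-! ### Point masses and absolute continuity -/

/-- The `j`-th factor has at most an inverse square root singularity at the endpoints of its gap. -/
theorem norm_gapFactor_edge_le {a b μ : ℕ → ℝ} {j : ℕ} (hab : a j < b j)
    (hμ : μ j ∈ Set.Icc (a j) (b j)) {e : ℝ} (he : e = a j ∨ e = b j) {y : ℝ} (hy : 0 < y)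
    (hy1 : y ≤ 1) :
    ‖gapFactor a b μ (e + y * Complex.I) j‖ ≤ (1 + (b j - a j)) / (√y * √(b j - a j)) := by
  have hL : 0 < b j - a j := by linarith
  have key : ∀ x : ℝ, ‖(e : ℂ) + y * Complex.I - x‖ ≤ y + |e - x| := by
    intro x
    have : (e : ℂ) + y * Complex.I - x = (y : ℂ) * Complex.I + ((e - x : ℝ) : ℂ) := by
      push_cast; ring
    rw [this]
    refine (norm_add_le _ _).trans ?_
    rw [norm_mul, Complex.norm_I, mul_one, Complex.norm_real, Complex.norm_real,
      Real.norm_of_nonneg hy.le, Real.norm_eq_abs]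
  have hnum : ‖(e : ℂ) + y * Complex.I - μ j‖ ≤ 1 + (b j - a j) := by
    refine (key _).trans ?_
    have : |e - μ j| ≤ b j - a j := by
      rcases he with rfl | rfl <;> rw [abs_le] <;> constructor <;> linarith [hμ.1, hμ.2]
    linarith
  have him : ∀ x : ℝ, y ≤ ‖(e : ℂ) + y * Complex.I - x‖ := by
    intro x
    have := Complex.abs_im_le_norm ((e : ℂ) + y * Complex.I - x)
    simp only [Complex.sub_im, Complex.add_im, Complex.ofReal_im, Complex.mul_im,
      Complex.ofReal_re, Complex.I_im, mul_one, Complex.I_re, mul_zero, add_zero, zero_add,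
      sub_zero] at this
    exact (le_abs_self _).trans this
  have hre : ∀ x : ℝ, |e - x| ≤ ‖(e : ℂ) + y * Complex.I - x‖ := by
    intro x
    have := Complex.abs_re_le_norm ((e : ℂ) + y * Complex.I - x)
    simpa using this
  rw [gapFactor, norm_div, norm_mul, norm_cpow_half, norm_cpow_half]
  have hden : √y * √(b j - a j) ≤
      √‖(e : ℂ) + y * Complex.I - a j‖ * √‖(e : ℂ) + y * Complex.I - b j‖ := by
    rcases he with rfl | rfl
    · refine mul_le_mul (Real.sqrt_le_sqrt (him _)) (Real.sqrt_le_sqrt ?_) (by positivity)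
        (by positivity)
      have := hre (b j)
      rw [abs_sub_comm] at this
      exact (le_abs_self _).trans this
    · rw [mul_comm]
      refine mul_le_mul (Real.sqrt_le_sqrt ?_) (Real.sqrt_le_sqrt (him _)) (by positivity)
        (by positivity)
      exact (le_abs_self _).trans (hre (a j))
  exact div_le_div₀ (by linarith) hnum (by positivity) hden

namespace GapsDecreaseToZero

variable {a b μ : ℕ → ℝ}

/-- An endpoint of the `j`-th gap keeps a positive distance from the endpoints of all other gaps. -/
theorem exists_le_abs_sub_edges (h : GapsDecreaseToZero a b) {j : ℕ} {e : ℝ}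
    (he : e = a j ∨ e = b j) :
    ∃ η : ℝ, 0 < η ∧ ∀ k, k ≠ j → η ≤ |e - a k| ∧ η ≤ |e - b k| := by
  have hae : a j ≤ e := by rcases he with rfl | rfl <;> linarith [h.2.1 j]
  have heb : e ≤ b j := by rcases he with rfl | rfl <;> linarith [h.2.1 j]
  have hhead : ∃ η : ℝ, 0 < η ∧ ∀ k, k < j → η ≤ a k - b j := by
    cases j with
    | zero => exact ⟨1, one_pos, fun k hk => by omega⟩
    | succ j =>
      refine ⟨a j - b (j + 1), by linarith [h.2.2.1 j], fun k hk => ?_⟩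
      rcases (Nat.lt_succ_iff.1 hk).lt_or_eq with hkj | rfl
      · linarith [h.b_lt_a hkj, h.2.1 j]
      · exact le_rfl
  obtain ⟨η, hη, hηk⟩ := hhead
  have h2 : 0 < a j - b (j + 1) := by linarith [h.2.2.1 j]
  refine ⟨min η (a j - b (j + 1)), lt_min hη h2, fun k hk => ?_⟩
  rcases lt_or_gt_of_ne hk with hkj | hkj
  · have h3 := hηk k hkj
    have h4 := h.2.1 k
    constructor
    · rw [abs_sub_comm]
      exact ((min_le_left _ _).trans (by linarith)).trans (le_abs_self _)
    · rw [abs_sub_comm]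
      exact ((min_le_left _ _).trans (by linarith)).trans (le_abs_self _)
  · have h3 := h.b_antitone (Nat.succ_le_of_lt hkj)
    have h4 := h.2.1 k
    constructor
    · exact ((min_le_right _ _).trans (by simp only [Nat.succ_eq_add_one] at h3; linarith)).trans
        (le_abs_self _)
    · exact ((min_le_right _ _).trans (by simp only [Nat.succ_eq_add_one] at h3; linarith)).trans
        (le_abs_self _)

/-- The product is `O(1 / √y)` at height `y` above an endpoint, so there is no point mass there. -/
theorem tendsto_mul_norm_gapProduct_edge (h : GapsDecreaseToZero a b)
    (hμ : ∀ j, μ j ∈ Set.Icc (a j) (b j)) {j : ℕ} {e : ℝ} (he : e = a j ∨ e = b j) :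
    Tendsto (fun y : ℝ => y * ‖gapProduct a b μ (e + y * Complex.I)‖) (𝓝[>] 0) (𝓝 0) := by
  obtain ⟨η, hη, hηk⟩ := h.exists_le_abs_sub_edges he
  have he0 : 0 < e := by rcases he with rfl | rfl <;> [exact h.1 j; exact h.b_pos j]
  have hL : 0 < b j - a j := by linarith [h.2.1 j]
  set L := b j - a j
  set B := Real.exp (2 * b 0 / η)
  have hB : 0 < B := Real.exp_pos _
  have hre : ∀ (y x : ℝ), |e - x| ≤ ‖(e : ℂ) + y * Complex.I - x‖ := by
    intro y x
    have := Complex.abs_re_le_norm ((e : ℂ) + y * Complex.I - x)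
    simpa using this
  have hbound : ∀ y : ℝ, 0 < y → y ≤ 1 → ‖gapProduct a b μ (e + y * Complex.I)‖ ≤
      1 / (2 * √e) * ((1 + (1 + L) / (√y * √L)) * B) := by
    intro y hy hy1
    set z : ℂ := e + y * Complex.I
    have hzim : z.im = y := by simp [z]
    have hz : 0 ≤ z.im := by rw [hzim]; exact hy.le
    have hfin : ∀ s : Finset ℕ, ‖∏ k ∈ s, gapFactor a b μ z k‖ ≤
        (1 + (1 + L) / (√y * √L)) * B := by
      intro s
      have hs : ∀ k ∈ s.erase j, η ≤ ‖z - a k‖ ∧ η ≤ ‖z - b k‖ := fun k hk =>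
        ⟨(hηk k (Finset.ne_of_mem_erase hk)).1.trans (hre y _),
          (hηk k (Finset.ne_of_mem_erase hk)).2.trans (hre y _)⟩
      have h1 := h.norm_prod_gapFactor_le_of_forall_mem hμ hz hη hs
      have h0 : 0 ≤ (1 + L) / (√y * √L) := by positivity
      by_cases hj : j ∈ s
      · rw [← Finset.mul_prod_erase s _ hj, norm_mul]
        have h2 := norm_gapFactor_edge_le (h.2.1 j) (hμ j) he hy hy1
        exact mul_le_mul (h2.trans (by linarith)) h1 (norm_nonneg _) (by linarith)
      · rw [Finset.erase_eq_of_notMem hj] at h1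
        nlinarith
    have hm := h.multipliable_gapFactor hμ hz (by rw [hzim]; exact hy) (awayFromEdges_im z)
    have h3 : ‖∏' k, gapFactor a b μ z k‖ ≤ (1 + (1 + L) / (√y * √L)) * B := by
      refine le_of_tendsto hm.hasProd.norm (Eventually.of_forall fun s => ?_)
      rw [← norm_prod]
      exact hfin s
    have hze : e ≤ ‖z‖ := by
      have := hre y 0
      simp only [sub_zero, Complex.ofReal_zero] at this
      exact (le_abs_self _).trans this
    rw [gapProduct, norm_mul, norm_div, norm_mul, norm_cpow_half, Complex.norm_I,
      Complex.norm_ofNat]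
    gcongr
  have hlim : Tendsto (fun y : ℝ => 1 / (2 * √e) * ((y + √y * ((1 + L) / √L)) * B)) (𝓝[>] 0)
      (𝓝 0) := by
    have hc : Continuous fun y : ℝ => 1 / (2 * √e) * ((y + √y * ((1 + L) / √L)) * B) := by fun_prop
    have := (hc.tendsto 0).mono_left (nhdsWithin_le_nhds (s := Set.Ioi 0))
    simpa using this
  refine squeeze_zero' ?_ ?_ hlim
  · filter_upwards [self_mem_nhdsWithin] with y hy
    have hy : 0 < y := hy
    positivity
  · filter_upwards [Ioc_mem_nhdsGT one_pos] with y hy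
    calc y * ‖gapProduct a b μ (e + y * Complex.I)‖
        ≤ y * (1 / (2 * √e) * ((1 + (1 + L) / (√y * √L)) * B)) := by
          have := hbound y hy.1 hy.2
          have := hy.1
          gcongr
      _ = 1 / (2 * √e) * ((y + √y * ((1 + L) / √L)) * B) := by
          have h1 : y = √y * √y := (Real.mul_self_sqrt hy.1.le).symm
          have h2 : √y ≠ 0 := (Real.sqrt_pos.2 hy.1).ne'
          have h3 : √L ≠ 0 := (Real.sqrt_pos.2 hL).ne'
          have h4 : y * ((1 + L) / (√y * √L)) = √y * ((1 + L) / √L) := by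
            conv_lhs => rw [h1]
            rw [Real.sqrt_mul_self (Real.sqrt_nonneg y)]
            field_simp
          linear_combination (1 / (2 * √e) * B) * h4

theorem measure_zero_singleton_eq_zero (h : GapsDecreaseToZero a b)
    (hμ : ∀ j, μ j ∈ Set.Icc (a j) (b j)) {ρ : Measure ℝ}
    (hρ : IsHerglotzMeasure (Set.Ici (0 : ℝ) \ ⋃ j, Set.Ioo (a j) (b j)) (gapProduct a b μ) ρ)
    (hint : IntervalIntegrable (fun t : ℝ => gapProduct a b μ (t : ℂ)) volume (-1) 0) :
    ρ {0} = 0 := by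
  by_contra hne
  have hnn : ∀ᵐ t ∂ρ, 0 ≤ t := by
    refine measure_mono_null ?_ hρ.1
    intro t ht ht'
    exact ht ht'.1
  have hfin : ρ {0} < ⊤ := by
    refine lt_of_le_of_lt (measure_mono ?_) (hρ.2.1.measure_ge_lt_top one_pos)
    intro t ht
    rw [Set.mem_singleton_iff] at ht
    simp [ht]
  have hpos : 0 < ρ.real {0} := ENNReal.toReal_pos hne hfin.ne
  -- a point mass `α` at the origin would give `α / ε ≤ gapProduct (-ε)`
  have hlow : ∀ ε : ℝ, 0 < ε → ρ.real {0} * ε⁻¹ ≤ ‖gapProduct a b μ ((-ε : ℝ) : ℂ)‖ := by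
    intro ε hε
    rw [h.gapProduct_neg_eq_integral hμ hρ hε, Complex.norm_real]
    have hi : Integrable (fun t : ℝ => 1 / (t + ε)) ρ := by
      refine Integrable.mono' (hρ.2.1.const_mul (1 + 1 / ε))
        (Measurable.aestronglyMeasurable (by fun_prop)) ?_
      filter_upwards [hnn] with t ht
      rw [Real.norm_of_nonneg (by positivity), abs_of_nonneg ht, mul_one_div,
        div_le_div_iff₀ (by positivity) (by positivity)]
      have h3 : 1 / ε * ε = 1 := by field_simp
      have : 0 ≤ t * (1 / ε) := by positivity
      nlinarith
    have h1 : ∫ t in ({0} : Set ℝ), 1 / (t + ε) ∂ρ ≤ ∫ t, 1 / (t + ε) ∂ρ := by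
      refine setIntegral_le_integral hi ?_
      filter_upwards [hnn] with t ht
      simp only [Pi.zero_apply]
      positivity
    rw [integral_singleton] at h1
    simp only [zero_add, smul_eq_mul, one_div] at h1 ⊢
    exact h1.trans (le_abs_self _)
  have hinv : IntervalIntegrable (fun t : ℝ => t⁻¹) volume (-1) 0 := by
    rw [intervalIntegrable_iff] at hint ⊢
    refine Integrable.mono' (hint.norm.const_mul (ρ.real {0})⁻¹)
      (Measurable.aestronglyMeasurable (by fun_prop)) ?_
    rw [Set.uIoc_of_le (by norm_num : (-1 : ℝ) ≤ 0), ae_restrict_iff' measurableSet_Ioc]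
    have h0 : ∀ᵐ t : ℝ, t ≠ 0 := by simp [ae_iff]
    filter_upwards [h0] with t ht0 ht
    have ht' : 0 < -t := by
      have := lt_of_le_of_ne ht.2 ht0
      linarith
    have h1 := hlow (-t) ht'
    rw [neg_neg] at h1
    rw [norm_inv, Real.norm_of_nonpos ht.2, inv_mul_eq_div, le_div_iff₀ hpos]
    linarith
  rw [intervalIntegrable_inv_iff] at hinv
  norm_num at hinv

/-- If the product is integrable up to the origin along the negative half-line, its Herglotz
measure is absolutely continuous. -/
theorem absolutelyContinuous (h : GapsDecreaseToZero a b) (hμ : ∀ j, μ j ∈ Set.Icc (a j) (b j))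
    {ρ : Measure ℝ} [SFinite ρ]
    (hρ : IsHerglotzMeasure (Set.Ici (0 : ℝ) \ ⋃ j, Set.Ioo (a j) (b j)) (gapProduct a b μ) ρ)
    (hP : PoissonIntegralLE (gapProduct a b μ) ρ)
    (hint : IntervalIntegrable (fun t : ℝ => gapProduct a b μ (t : ℂ)) volume (-1) 0) :
    ρ ≪ volume := by
  intro s hs
  set D : Set ℝ := {0} ∪ (Set.range a ∪ Set.range b) with hD
  have hD0 : ρ D = 0 := by
    refine measure_union_null (h.measure_zero_singleton_eq_zero hμ hρ hint)
      (measure_union_null ?_ ?_)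
    · rw [← Set.iUnion_singleton_eq_range]
      exact measure_iUnion_null fun j => hP.measure_singleton_eq_zero
        (h.tendsto_mul_norm_gapProduct_edge hμ (Or.inl rfl))
    · rw [← Set.iUnion_singleton_eq_range]
      exact measure_iUnion_null fun j => hP.measure_singleton_eq_zero
        (h.tendsto_mul_norm_gapProduct_edge hμ (Or.inr rfl))
  have hsD : ρ (s \ D) = 0 := by
    refine hP.measure_eq_zero_of_volume_eq_zero ?_ (measure_mono_null Set.sdiff_subset hs)
    intro x hx
    have hx0 : x ≠ 0 := fun h0 => hx.2 (Or.inl h0)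
    obtain ⟨η, hη, hxη⟩ := h.exists_awayFromEdges_ofReal hx0 (fun k =>
      ⟨fun h0 => hx.2 (Or.inr (Or.inl ⟨k, h0.symm⟩)),
        fun h0 => hx.2 (Or.inr (Or.inr ⟨k, h0.symm⟩))⟩)
    refine ⟨1 / (2 * √|x|) * Real.exp (2 * b 0 / η), ?_⟩
    filter_upwards [self_mem_nhdsWithin] with y hy
    have hy : 0 < y := hy
    have h1 := h.norm_gapProduct_le hμ (by simpa using hy.le) hη (hxη.add_mul_I y)
    have h2 : |x| ≤ ‖(x : ℂ) + y * Complex.I‖ := by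
      simpa using Complex.abs_re_le_norm ((x : ℂ) + y * Complex.I)
    have h3 : 0 < |x| := abs_pos.2 hx0
    refine ((le_abs_self _).trans (Complex.abs_im_le_norm _)).trans (h1.trans ?_)
    gcongr
  refine measure_mono_null ?_ (measure_union_null hsD hD0)
  intro x hx
  by_cases hxD : x ∈ D
  · exact Or.inr hxD
  · exact Or.inl ⟨hx, hxD⟩

/-- If the product grows like `1 / ε` at `-ε`, its Herglotz measure has a point mass at `0`. -/
theorem measure_zero_singleton_pos (h : GapsDecreaseToZero a b)
    (hμ : ∀ j, μ j ∈ Set.Icc (a j) (b j)) {σ : Measure ℝ}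
    (hσ : IsHerglotzMeasure (Set.Ici (0 : ℝ) \ ⋃ j, Set.Ioo (a j) (b j)) (gapProduct a b μ) σ)
    {c : ℝ} (hc : 0 < c)
    (hlow : ∀ ε : ℝ, 0 < ε → ε ≤ 1 → c ≤ ε * (gapProduct a b μ ((-ε : ℝ) : ℂ)).re) :
    0 < σ {0} := by
  by_contra hne
  have hzero : σ {0} = 0 := le_antisymm (not_lt.1 hne) bot_le
  have hnn : ∀ᵐ t ∂σ, 0 < t := by
    have h1 : σ (Set.Iic 0) = 0 := by
      refine measure_mono_null (t := {0} ∪ (Set.Ici (0 : ℝ) \ ⋃ j, Set.Ioo (a j) (b j))ᶜ) ?_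
        (measure_union_null hzero hσ.1)
      intro t ht
      rcases eq_or_lt_of_le (Set.mem_Iic.1 ht) with h0 | h0
      · exact Or.inl h0
      · exact Or.inr fun h2 => absurd h2.1 (by simpa using h0)
    refine measure_mono_null ?_ h1
    intro t ht
    exact Set.mem_Iic.2 (not_lt.1 fun h0 => ht h0)
  have hlim : Tendsto (fun ε : ℝ => ∫ t, ε * (1 / (t + ε)) ∂σ) (𝓝[>] 0) (𝓝 (∫ t : ℝ, 0 ∂σ)) := by
    refine tendsto_integral_filter_of_dominated_convergence (fun t => 1 / (1 + |t|)) ?_ ?_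
      hσ.2.1 ?_
    · exact Eventually.of_forall fun y => Measurable.aestronglyMeasurable (by fun_prop)
    · filter_upwards [Ioc_mem_nhdsGT one_pos] with ε hε
      filter_upwards [hnn] with t ht
      have := hε.1
      rw [Real.norm_of_nonneg (by positivity), abs_of_pos ht, mul_one_div,
        div_le_div_iff₀ (by positivity) (by positivity)]
      nlinarith [hε.2]
    · filter_upwards [hnn] with t ht
      have h1 : ContinuousAt (fun ε : ℝ => ε * (1 / (t + ε))) 0 :=
        continuousAt_id.mul (ContinuousAt.div (by fun_prop) (by fun_prop) (by simpa using ht.ne'))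
      have := h1.tendsto.mono_left (nhdsWithin_le_nhds (s := Set.Ioi 0))
      simpa using this
  rw [integral_zero] at hlim
  have : c ≤ 0 := by
    refine ge_of_tendsto hlim ?_
    filter_upwards [Ioc_mem_nhdsGT one_pos] with ε hε
    have h1 := hlow ε hε.1 hε.2
    rwa [h.gapProduct_neg_eq_integral hμ hσ hε.1, Complex.ofReal_re, ← integral_const_mul] at h1
  linarith

end GapsDecreaseToZero

/-! ### Fixed points, telescoping products, arcsine integrals -/

/-- A monotone self-map of a box has a fixed point (Knaster and Tarski). -/
theorem exists_fixedPoint_of_monotone_box {a b : ℕ → ℝ} (hab : ∀ j, a j ≤ b j)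
    (T : (ℕ → ℝ) → ℕ → ℝ)
    (hT : ∀ c : ℕ → ℝ, (∀ j, c j ∈ Set.Icc (a j) (b j)) → ∀ j, T c j ∈ Set.Icc (a j) (b j))
    (hmono : ∀ c c' : ℕ → ℝ, (∀ j, c j ∈ Set.Icc (a j) (b j)) →
      (∀ j, c' j ∈ Set.Icc (a j) (b j)) → (∀ j, c j ≤ c' j) → ∀ j, T c j ≤ T c' j) :
    ∃ c : ℕ → ℝ, (∀ j, c j ∈ Set.Icc (a j) (b j)) ∧ ∀ j, T c j = c j := by
  set S : Set (ℕ → ℝ) := {c | (∀ j, c j ∈ Set.Icc (a j) (b j)) ∧ ∀ j, c j ≤ T c j} with hS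
  have haS : a ∈ S :=
    ⟨fun j => ⟨le_rfl, hab j⟩, fun j => (hT a (fun j => ⟨le_rfl, hab j⟩) j).1⟩
  set m : ℕ → ℝ := fun j => sSup ((fun c : ℕ → ℝ => c j) '' S) with hm
  have hbdd : ∀ j, BddAbove ((fun c : ℕ → ℝ => c j) '' S) := by
    rintro j
    refine ⟨b j, ?_⟩
    rintro _ ⟨c, hc, rfl⟩
    exact (hc.1 j).2
  have hle : ∀ c ∈ S, ∀ j, c j ≤ m j := fun c hc j => le_csSup (hbdd j) ⟨c, hc, rfl⟩
  have hmbox : ∀ j, m j ∈ Set.Icc (a j) (b j) := by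
    refine fun j => ⟨hle a haS j, csSup_le ⟨_, a, haS, rfl⟩ ?_⟩
    rintro _ ⟨c, hc, rfl⟩
    exact (hc.1 j).2
  have hmS : ∀ j, m j ≤ T m j := by
    refine fun j => csSup_le ⟨_, a, haS, rfl⟩ ?_
    rintro _ ⟨c, hc, rfl⟩
    exact (hc.2 j).trans (hmono c m hc.1 hmbox (hle c hc) j)
  have hTS : T m ∈ S := ⟨hT m hmbox, hmono m (T m) hmbox (hT m hmbox) hmS⟩
  exact ⟨m, hmbox, fun j => le_antisymm (hle _ hTS j) (hmS j)⟩

/-- An inequality version of telescoping. -/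
theorem div_le_prod_range_div {u v : ℕ → ℝ} (hu : ∀ i, 0 < u i) (hv : ∀ i, 0 < v i)
    (huv : ∀ i, v i ≤ u (i + 1)) (n : ℕ) :
    u 0 / v n ≤ ∏ i ∈ Finset.range (n + 1), u i / v i := by
  induction n with
  | zero => simp
  | succ n ih =>
    rw [Finset.prod_range_succ]
    calc u 0 / v (n + 1) ≤ u 0 / v n * (u (n + 1) / v (n + 1)) := by
          have h0 := hu 0; have h1 := hv n; have h2 := hv (n + 1)
          rw [div_mul_div_comm, div_le_div_iff₀ h2 (by positivity)]
          nlinarith [mul_le_mul_of_nonneg_left (huv n) (mul_pos h0 h2).le]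
      _ ≤ _ := by
          have := (div_pos (hu (n + 1)) (hv (n + 1))).le
          gcongr

theorem integral_inv_sqrt_sub {a b : ℝ} (hab : a < b) :
    IntegrableOn (fun x => 1 / √(x - a)) (Set.Ioo a b) ∧
      ∫ x in Set.Ioo a b, 1 / √(x - a) = 2 * √(b - a) := by
  have hfun : ∀ x : ℝ, 0 ≤ x → x ^ (-(1 / 2) : ℝ) = 1 / √x := by
    intro x hx
    rw [Real.rpow_neg hx, ← Real.sqrt_eq_rpow, one_div]
  have hi : IntervalIntegrable (fun x : ℝ => x ^ (-(1 / 2) : ℝ)) volume 0 (b - a) :=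
    intervalIntegral.intervalIntegrable_rpow' (by norm_num)
  have hi2 := hi.comp_sub_right a
  rw [zero_add, sub_add_cancel] at hi2
  have h1 : IntegrableOn (fun x : ℝ => (x - a) ^ (-(1 / 2) : ℝ)) (Set.Ioo a b) :=
    ((intervalIntegrable_iff_integrableOn_Ioo_of_le hab.le).1 hi2)
  have hcongr : Set.EqOn (fun x : ℝ => (x - a) ^ (-(1 / 2) : ℝ)) (fun x => 1 / √(x - a))
      (Set.Ioo a b) := fun x hx => hfun _ (by linarith [hx.1])
  refine ⟨h1.congr_fun hcongr measurableSet_Ioo, ?_⟩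
  rw [← setIntegral_congr_fun measurableSet_Ioo hcongr, ← integral_Ioc_eq_integral_Ioo,
    ← intervalIntegral.integral_of_le hab.le,
    intervalIntegral.integral_comp_sub_right (fun x : ℝ => x ^ (-(1 / 2) : ℝ)) a, sub_self,
    integral_rpow (Or.inl (by norm_num))]
  rw [Real.sqrt_eq_rpow, Real.zero_rpow (by norm_num)]
  norm_num
  ring

theorem integral_inv_sqrt_sub' {a b : ℝ} (hab : a < b) :
    IntegrableOn (fun x => 1 / √(b - x)) (Set.Ioo a b) ∧
      ∫ x in Set.Ioo a b, 1 / √(b - x) = 2 * √(b - a) := by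
  obtain ⟨h1, h2⟩ := integral_inv_sqrt_sub (neg_lt_neg hab)
  have himg : (fun x : ℝ => -x) ⁻¹' Set.Ioo (-b) (-a) = Set.Ioo a b := by
    ext x
    simp only [Set.mem_preimage, Set.mem_Ioo, neg_lt_neg_iff]
    exact and_comm
  have hmp : MeasurePreserving (fun x : ℝ => -x) (volume.restrict (Set.Ioo a b))
      (volume.restrict (Set.Ioo (-b) (-a))) := by
    have := (Measure.measurePreserving_neg (volume : Measure ℝ)).restrict_preimage
      (measurableSet_Ioo (a := -b) (b := -a))
    rwa [himg] at this
  have hfun : (fun x : ℝ => 1 / √(b - x)) = (fun x => 1 / √(x - -b)) ∘ fun x : ℝ => -x := by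
    ext x; simp only [Function.comp_apply]; ring_nf
  constructor
  · rw [hfun]
    exact (hmp.integrable_comp h1.1).2 h1
  · rw [hfun]
    have h3 := hmp.integral_comp (Homeomorph.neg ℝ).measurableEmbedding
      (fun x => 1 / √(x - -b))
    refine h3.trans ?_
    rw [h2]
    ring_nf

/-- The integral is in fact `π`; any absolute bound serves. -/
theorem integral_arcsine {a b : ℝ} (hab : a < b) :
    IntegrableOn (fun x => 1 / (√(x - a) * √(b - x))) (Set.Ioo a b) ∧
      ∫ x in Set.Ioo a b, 1 / (√(x - a) * √(b - x)) ≤ 6 := by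
  obtain ⟨h1, h2⟩ := integral_inv_sqrt_sub hab
  obtain ⟨h3, h4⟩ := integral_inv_sqrt_sub' hab
  set L := b - a with hL
  have hL0 : 0 < L := by linarith
  have hs : 0 < √(L / 2) := Real.sqrt_pos.2 (by positivity)
  have hdom : ∀ x ∈ Set.Ioo a b, 1 / (√(x - a) * √(b - x)) ≤
      1 / √(L / 2) * (1 / √(x - a) + 1 / √(b - x)) := by
    intro x hx
    have hxa : 0 < √(x - a) := Real.sqrt_pos.2 (by linarith [hx.1])
    have hxb : 0 < √(b - x) := Real.sqrt_pos.2 (by linarith [hx.2])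
    rcases le_total (L / 2) (x - a) with hc | hc
    · have h5 : √(L / 2) ≤ √(x - a) := Real.sqrt_le_sqrt hc
      calc 1 / (√(x - a) * √(b - x)) = 1 / √(x - a) * (1 / √(b - x)) := by rw [one_div_mul_one_div]
        _ ≤ 1 / √(L / 2) * (1 / √(b - x)) := by gcongr
        _ ≤ _ := by
          gcongr
          linarith [one_div_pos.2 hxa]
    · have h5 : √(L / 2) ≤ √(b - x) := Real.sqrt_le_sqrt (by linarith)
      calc 1 / (√(x - a) * √(b - x)) = 1 / √(b - x) * (1 / √(x - a)) := by
            rw [one_div_mul_one_div, mul_comm]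
        _ ≤ 1 / √(L / 2) * (1 / √(x - a)) := by gcongr
        _ ≤ _ := by
          gcongr
          linarith [one_div_pos.2 hxb]
  have hI : IntegrableOn (fun x => 1 / √(L / 2) * (1 / √(x - a) + 1 / √(b - x))) (Set.Ioo a b) :=
    (h1.add h3).const_mul _
  have hI2 : IntegrableOn (fun x => 1 / (√(x - a) * √(b - x))) (Set.Ioo a b) := by
    refine Integrable.mono' hI (Measurable.aestronglyMeasurable (by fun_prop)) ?_
    rw [ae_restrict_iff' measurableSet_Ioo]
    refine ae_of_all _ fun x hx => ?_
    rw [Real.norm_of_nonneg (by positivity)]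
    exact hdom x hx
  refine ⟨hI2, ?_⟩
  calc ∫ x in Set.Ioo a b, 1 / (√(x - a) * √(b - x))
      ≤ ∫ x in Set.Ioo a b, 1 / √(L / 2) * (1 / √(x - a) + 1 / √(b - x)) :=
        setIntegral_mono_on hI2 hI measurableSet_Ioo hdom
    _ = 1 / √(L / 2) * (2 * √L + 2 * √L) := by
        rw [integral_const_mul, integral_add h1 h3, h2, h4]
    _ ≤ 6 := by
        have h6 : √(L / 2) * √2 = √L := by
          rw [← Real.sqrt_mul (by positivity)]; congr 1; ring
        have h7 : √2 ≤ 3 / 2 := by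
          rw [Real.sqrt_le_left (by norm_num)]; norm_num
        rw [div_mul_eq_mul_div, one_mul, div_le_iff₀ hs, ← h6]
        nlinarith

/-! ### The weights in the gaps -/

namespace GapsDecreaseToZero

variable {a b μ : ℕ → ℝ}

theorem realFactor_pos_of_lt (h : GapsDecreaseToZero a b) (hμ : ∀ j, μ j ∈ Set.Icc (a j) (b j))
    {x : ℝ} {k : ℕ} (hx : x < a k) : 0 < realFactor a b μ x k := by
  have h1 := h.2.1 k
  have h2 := (hμ k).1
  refine div_pos (abs_pos.2 (by linarith)) (mul_pos (Real.sqrt_pos.2 (abs_pos.2 ?_))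
    (Real.sqrt_pos.2 (abs_pos.2 ?_))) <;> linarith

theorem realFactor_of_lt (h : GapsDecreaseToZero a b) (hμ : ∀ j, μ j ∈ Set.Icc (a j) (b j))
    {x : ℝ} {k : ℕ} (hx : x < a k) :
    realFactor a b μ x k = (μ k - x) / (√(a k - x) * √(b k - x)) := by
  have h1 := h.2.1 k
  have h2 := (hμ k).1
  rw [realFactor, abs_of_neg (by linarith), abs_of_neg (by linarith), abs_of_neg (by linarith)]
  simp only [neg_sub]

theorem realFactor_of_gt (h : GapsDecreaseToZero a b) (hμ : ∀ j, μ j ∈ Set.Icc (a j) (b j))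
    {x : ℝ} {k : ℕ} (hx : b k < x) :
    realFactor a b μ x k = (x - μ k) / (√(x - a k) * √(x - b k)) := by
  have h1 := h.2.1 k
  have h2 := (hμ k).2
  rw [realFactor, abs_of_pos (by linarith), abs_of_pos (by linarith), abs_of_pos (by linarith)]

theorem realFactor_le_of_gt (h : GapsDecreaseToZero a b) (hμ : ∀ j, μ j ∈ Set.Icc (a j) (b j))
    {x : ℝ} {k : ℕ} (hx : b k < x) :
    √(x - b k) / √(x - a k) ≤ realFactor a b μ x k ∧
      realFactor a b μ x k ≤ (√(x - b k) / √(x - a k))⁻¹ := by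
  have h1 := h.2.1 k
  have ha : 0 < √(x - a k) := Real.sqrt_pos.2 (by linarith)
  have hb : 0 < √(x - b k) := Real.sqrt_pos.2 (by linarith)
  have ha2 : √(x - a k) * √(x - a k) = x - a k := Real.mul_self_sqrt (by linarith)
  have hb2 : √(x - b k) * √(x - b k) = x - b k := Real.mul_self_sqrt (by linarith)
  rw [h.realFactor_of_gt hμ hx, inv_div]
  constructor
  · rw [div_le_div_iff₀ ha (by positivity)]
    calc √(x - b k) * (√(x - a k) * √(x - b k)) = (x - b k) * √(x - a k) := by
          linear_combination √(x - a k) * hb2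
      _ ≤ _ := by have := (hμ k).2; gcongr
  · rw [div_le_div_iff₀ (by positivity) hb]
    calc (x - μ k) * √(x - b k) ≤ (x - a k) * √(x - b k) := by have := (hμ k).1; gcongr
      _ = _ := by linear_combination (-√(x - b k)) * ha2

/-- Bounds for the product over the gaps to the left of `x`, by telescoping. -/
theorem prod_realFactor_tail_bounds (h : GapsDecreaseToZero a b)
    (hμ : ∀ j, μ j ∈ Set.Icc (a j) (b j)) {x q : ℝ} {j : ℕ} (hx : a j ≤ x) (hq : 0 < q)
    (hq1 : q ≤ 1) (hqb : b (j + 1) ≤ (1 - q) * a j) (n : ℕ) :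
    √q ≤ ∏ i ∈ Finset.range n, realFactor a b μ x (i + (j + 1)) ∧
      ∏ i ∈ Finset.range n, realFactor a b μ x (i + (j + 1)) ≤ (√q)⁻¹ := by
  have hsq : 0 < √q := Real.sqrt_pos.2 hq
  have hsq1 : √q ≤ 1 := Real.sqrt_le_iff.2 ⟨zero_le_one, by simpa using hq1⟩
  have hlt : ∀ k, b (k + (j + 1)) < x := fun k => (h.b_lt_a (by omega)).trans_le hx
  set u : ℕ → ℝ := fun i => √(x - b (i + (j + 1)))
  set v : ℕ → ℝ := fun i => √(x - a (i + (j + 1)))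
  have hu : ∀ i, 0 < u i := fun i => Real.sqrt_pos.2 (by linarith [hlt i])
  have hv : ∀ i, 0 < v i := fun i =>
    Real.sqrt_pos.2 (by linarith [hlt i, h.2.1 (i + (j + 1))])
  have huv : ∀ i, v i ≤ u (i + 1) := by
    intro i
    apply Real.sqrt_le_sqrt
    have := h.2.2.1 (i + (j + 1))
    rw [show i + 1 + (j + 1) = i + (j + 1) + 1 by ring]
    linarith
  have haj := h.1 j
  have hx0 : 0 < x := haj.trans_le hx
  have hlow : ∀ n, √q ≤ ∏ i ∈ Finset.range n, u i / v i := by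
    intro n
    cases n with
    | zero => simpa using hsq1
    | succ n =>
      refine le_trans ?_ (div_le_prod_range_div hu hv huv n)
      rw [le_div_iff₀ (hv n), ← Real.sqrt_mul hq.le]
      apply Real.sqrt_le_sqrt
      have h3 := h.1 (n + (j + 1))
      rw [zero_add]
      nlinarith
  have hP0 : 0 < ∏ i ∈ Finset.range n, u i / v i :=
    Finset.prod_pos fun i _ => div_pos (hu i) (hv i)
  constructor
  · refine (hlow n).trans (Finset.prod_le_prod (fun i _ => (div_pos (hu i) (hv i)).le) fun i _ => ?_)
    exact (h.realFactor_le_of_gt hμ (hlt i)).1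
  · refine (Finset.prod_le_prod (fun i _ => realFactor_nonneg _ _ _ _ _) fun i _ =>
      (h.realFactor_le_of_gt hμ (hlt i)).2).trans ?_
    rw [Finset.prod_inv_distrib]
    exact inv_anti₀ hsq (hlow n)

theorem tprod_realFactor_tail_bounds (h : GapsDecreaseToZero a b)
    (hμ : ∀ j, μ j ∈ Set.Icc (a j) (b j)) {x q : ℝ} {j : ℕ} (hx : a j ≤ x) (hq : 0 < q)
    (hq1 : q ≤ 1) (hqb : b (j + 1) ≤ (1 - q) * a j) :
    √q ≤ ∏' i, realFactor a b μ x (i + (j + 1)) ∧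
      ∏' i, realFactor a b μ x (i + (j + 1)) ≤ (√q)⁻¹ := by
  have hm := (tprod_ofReal_of_summable
    (h.summable_realFactor_sub_one_tail hμ hx)).1.hasProd.tendsto_prod_nat
  exact ⟨ge_of_tendsto' hm fun n => (h.prod_realFactor_tail_bounds hμ hx hq hq1 hqb n).1,
    le_of_tendsto' hm fun n => (h.prod_realFactor_tail_bounds hμ hx hq hq1 hqb n).2⟩

theorem prod_realFactor_head_le (h : GapsDecreaseToZero a b)
    (hμ : ∀ j, μ j ∈ Set.Icc (a j) (b j)) {x r : ℝ} {j : ℕ} (hx0 : 0 ≤ x) (hx : x ≤ b j)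
    (hr : 0 < r) (hrb : ∀ k < j, b j ≤ (1 - r) * a k) :
    ∏ k ∈ Finset.range j, realFactor a b μ x k ≤
      (r⁻¹) ^ j * ∏ k ∈ Finset.range j, realFactor a b μ 0 k := by
  rw [← Finset.card_range j, ← Finset.prod_const, Finset.card_range, ← Finset.prod_mul_distrib]
  refine Finset.prod_le_prod (fun k _ => realFactor_nonneg _ _ _ _ _) fun k hk => ?_
  have hkj := Finset.mem_range.1 hk
  have hxk : x < a k := hx.trans_lt (h.b_lt_a hkj)
  have ha := h.1 k
  have hab := h.2.1 k
  have hμk := (hμ k).1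
  rw [h.realFactor_of_lt hμ hxk, h.realFactor_of_lt hμ ha, sub_zero, sub_zero, sub_zero]
  have hbj := hrb k hkj
  have h1 : √r * √(a k) ≤ √(a k - x) := by
    rw [← Real.sqrt_mul hr.le]; apply Real.sqrt_le_sqrt; nlinarith
  have h2 : √r * √(b k) ≤ √(b k - x) := by
    rw [← Real.sqrt_mul hr.le]; apply Real.sqrt_le_sqrt
    have hr1 : r ≤ 1 := by
      by_contra hc
      have := h.b_pos j
      nlinarith
    nlinarith
  have hsr : √r * √r = r := Real.mul_self_sqrt hr.le
  have hsa : 0 < √(a k) := Real.sqrt_pos.2 ha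
  have hsb : 0 < √(b k) := Real.sqrt_pos.2 (ha.trans hab)
  have hr0 : 0 < √r := Real.sqrt_pos.2 hr
  calc (μ k - x) / (√(a k - x) * √(b k - x)) ≤ μ k / ((√r * √(a k)) * (√r * √(b k))) := by
        apply div_le_div₀ (by linarith) (by linarith) (by positivity)
        gcongr
    _ = μ k / (r * (√(a k) * √(b k))) := by
        congr 1; linear_combination (√(a k) * √(b k)) * hsr
    _ = _ := by rw [div_mul_eq_div_div, div_div, inv_mul_eq_div, div_div, mul_comm r]

theorem le_prod_realFactor_head (h : GapsDecreaseToZero a b)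
    (hμ : ∀ j, μ j ∈ Set.Icc (a j) (b j)) {x : ℝ} {j : ℕ} (hx0 : 0 ≤ x) (hx : x ≤ b j / 2) :
    (2⁻¹ : ℝ) ^ j * ∏ k ∈ Finset.range j, realFactor a b μ 0 k ≤
      ∏ k ∈ Finset.range j, realFactor a b μ x k := by
  rw [← Finset.card_range j, ← Finset.prod_const, Finset.card_range, ← Finset.prod_mul_distrib]
  refine Finset.prod_le_prod (fun k _ => mul_nonneg (by positivity) (realFactor_nonneg _ _ _ _ _))
    fun k hk => ?_
  have hkj := Finset.mem_range.1 hk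
  have hbj := h.b_pos j
  have hba := h.b_lt_a hkj
  have hxk : x < a k := by linarith
  have ha := h.1 k
  have hab := h.2.1 k
  have hμk := (hμ k).1
  rw [h.realFactor_of_lt hμ hxk, h.realFactor_of_lt hμ ha, sub_zero, sub_zero, sub_zero,
    ← mul_div_assoc]
  have hsa : 0 < √(a k - x) := Real.sqrt_pos.2 (by linarith)
  have hsb : 0 < √(b k - x) := Real.sqrt_pos.2 (by linarith)
  apply div_le_div₀ (by linarith) (by linarith) (by positivity)
  have h1 : √(a k - x) ≤ √(a k) := Real.sqrt_le_sqrt (by linarith)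
  have h2 : √(b k - x) ≤ √(b k) := Real.sqrt_le_sqrt (by linarith)
  gcongr

theorem gapWeight_le (h : GapsDecreaseToZero a b) (hμ : ∀ j, μ j ∈ Set.Icc (a j) (b j))
    {x r q : ℝ} {j : ℕ} (hx : x ∈ Set.Ioo (a j) (b j)) (hr : 0 < r)
    (hrb : ∀ k < j, b j ≤ (1 - r) * a k) (hq : 0 < q) (hq1 : q ≤ 1)
    (hqb : b (j + 1) ≤ (1 - q) * a j) :
    gapWeight a b μ j x ≤ 1 / (2 * √x) *
      ((r⁻¹) ^ j * (∏ k ∈ Finset.range j, realFactor a b μ 0 k) * (√q)⁻¹) *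
        (1 / (√(x - a j) * √(b j - x))) := by
  have h0 := h.1 j
  have h1 := h.prod_realFactor_head_le hμ (by linarith [hx.1]) hx.2.le hr hrb
  obtain ⟨h2, h3⟩ := h.tprod_realFactor_tail_bounds hμ hx.1.le hq hq1 hqb
  have h4 : 0 ≤ ∏ k ∈ Finset.range j, realFactor a b μ 0 k :=
    Finset.prod_nonneg fun k _ => realFactor_nonneg _ _ _ _ _
  rw [gapWeight, mul_one_div, mul_assoc (1 / (2 * √x))]
  have h5 : 0 ≤ ∏' i, realFactor a b μ x (i + (j + 1)) := (Real.sqrt_nonneg q).trans h2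
  gcongr

theorem le_gapWeight (h : GapsDecreaseToZero a b) (hμ : ∀ j, μ j ∈ Set.Icc (a j) (b j))
    {x q : ℝ} {j : ℕ} (hx : x ∈ Set.Ioo (a j) (b j)) (hx2 : x ≤ b j / 2) (hq : 0 < q)
    (hq1 : q ≤ 1) (hqb : b (j + 1) ≤ (1 - q) * a j) :
    1 / (2 * √x) * ((2⁻¹ : ℝ) ^ j * (∏ k ∈ Finset.range j, realFactor a b μ 0 k) * √q) *
        (1 / (√(x - a j) * √(b j - x))) ≤ gapWeight a b μ j x := by
  have h0 := h.1 j
  have h1 := h.le_prod_realFactor_head hμ (by linarith [hx.1]) hx2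
  obtain ⟨h2, h3⟩ := h.tprod_realFactor_tail_bounds hμ hx.1.le hq hq1 hqb
  have h4 : 0 ≤ ∏ k ∈ Finset.range j, realFactor a b μ x k :=
    Finset.prod_nonneg fun k _ => realFactor_nonneg _ _ _ _ _
  rw [gapWeight, mul_one_div, mul_assoc (1 / (2 * √x))]
  gcongr

/-- Every gap is at a positive relative distance from its neighbours. -/
theorem exists_ratios (h : GapsDecreaseToZero a b) (j : ℕ) :
    ∃ r q : ℝ, 0 < r ∧ (∀ k < j, b j ≤ (1 - r) * a k) ∧ 0 < q ∧ q ≤ 1 ∧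
      b (j + 1) ≤ (1 - q) * a j := by
  have hq : ∀ j, 0 < 1 - b (j + 1) / a j := by
    intro j
    have := (div_lt_one (h.1 j)).2 (h.2.2.1 j)
    linarith
  have hqe : ∀ j, b (j + 1) = (1 - (1 - b (j + 1) / a j)) * a j := by
    intro j
    have := (h.1 j).ne'
    field_simp; ring
  have hr : ∃ r : ℝ, 0 < r ∧ ∀ k < j, b j ≤ (1 - r) * a k := by
    cases j with
    | zero => exact ⟨1, one_pos, fun k hk => by omega⟩
    | succ j =>
      refine ⟨_, hq j, fun k hk => ?_⟩
      have hak : a j ≤ a k := by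
        rcases (Nat.lt_succ_iff.1 hk).lt_or_eq with hkj | rfl
        · linarith [h.b_lt_a hkj, h.2.1 j]
        · exact le_rfl
      have h1 : 0 ≤ b (j + 1) / a j := (div_pos (h.b_pos _) (h.1 j)).le
      calc b (j + 1) = (1 - (1 - b (j + 1) / a j)) * a j := hqe j
        _ ≤ _ := by
          rw [sub_sub_cancel]; gcongr
  obtain ⟨r, hr0, hrb⟩ := hr
  have hb1 : 0 ≤ b (j + 1) / a j := (div_pos (h.b_pos _) (h.1 j)).le
  exact ⟨r, _, hr0, hrb, hq j, by linarith, (hqe j).le⟩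

theorem gapWeight_pos (h : GapsDecreaseToZero a b) (hμ : ∀ j, μ j ∈ Set.Icc (a j) (b j))
    {x : ℝ} {j : ℕ} (hx : x ∈ Set.Ioo (a j) (b j)) : 0 < gapWeight a b μ j x := by
  obtain ⟨r, q, -, -, hq, hq1, hqb⟩ := h.exists_ratios j
  obtain ⟨h2, -⟩ := h.tprod_realFactor_tail_bounds hμ hx.1.le hq hq1 hqb
  have h1 : 0 < √x := Real.sqrt_pos.2 ((h.1 j).trans hx.1)
  have h3 : 0 < ∏ k ∈ Finset.range j, realFactor a b μ x k :=
    Finset.prod_pos fun k hk =>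
      h.realFactor_pos_of_lt hμ (hx.2.trans (h.b_lt_a (Finset.mem_range.1 hk)))
  have h4 : 0 < ∏' i, realFactor a b μ x (i + (j + 1)) := (Real.sqrt_pos.2 hq).trans_le h2
  have h5 : 0 < √(x - a j) := Real.sqrt_pos.2 (by linarith [hx.1])
  have h6 : 0 < √(b j - x) := Real.sqrt_pos.2 (by linarith [hx.2])
  unfold gapWeight
  positivity

theorem aestronglyMeasurable_gapWeight (h : GapsDecreaseToZero a b)
    (hμ : ∀ j, μ j ∈ Set.Icc (a j) (b j)) (j : ℕ) :
    AEStronglyMeasurable (gapWeight a b μ j) (volume.restrict (Set.Ioo (a j) (b j))) := by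
  have hm : ∀ k, Measurable fun x => realFactor a b μ x k := by
    intro k
    have hd : ∀ e : ℝ, Measurable fun x : ℝ => |x - e| := fun e =>
      (continuous_abs.comp (continuous_id.sub continuous_const)).measurable
    exact (hd _).div (((hd _).sqrt).mul ((hd _).sqrt))
  have hQ : AEStronglyMeasurable (fun x => ∏' i, realFactor a b μ x (i + (j + 1)))
      (volume.restrict (Set.Ioo (a j) (b j))) := by
    refine aestronglyMeasurable_of_tendsto_ae (u := atTop)
      (f := fun n x => ∏ i ∈ Finset.range n, realFactor a b μ x (i + (j + 1))) (fun n => ?_) ?_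
    · exact (Finset.measurable_prod _ fun i _ => hm _).aestronglyMeasurable
    · rw [ae_restrict_iff' measurableSet_Ioo]
      refine ae_of_all _ fun x hx => ?_
      exact (tprod_ofReal_of_summable
        (h.summable_realFactor_sub_one_tail hμ hx.1.le)).1.hasProd.tendsto_prod_nat
  have h1 : Measurable fun x : ℝ => 1 / (2 * √x) := by fun_prop
  have h2 : Measurable fun x => ∏ k ∈ Finset.range j, realFactor a b μ x k :=
    Finset.measurable_prod _ fun i _ => hm _
  have h3 : Measurable fun x : ℝ => (√(x - a j) * √(b j - x))⁻¹ := by fun_prop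
  have := ((h1.mul h2).aestronglyMeasurable.mul hQ).mul h3.aestronglyMeasurable
  refine this.congr (ae_of_all _ fun x => ?_)
  simp [gapWeight, div_eq_mul_inv]

theorem integrableOn_gapWeight (h : GapsDecreaseToZero a b)
    (hμ : ∀ j, μ j ∈ Set.Icc (a j) (b j)) (j : ℕ) :
    IntegrableOn (gapWeight a b μ j) (Set.Ioo (a j) (b j)) := by
  obtain ⟨r, q, hr, hrb, hq, hq1, hqb⟩ := h.exists_ratios j
  have h4 : 0 ≤ ∏ k ∈ Finset.range j, realFactor a b μ 0 k :=
    Finset.prod_nonneg fun k _ => realFactor_nonneg _ _ _ _ _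
  refine Integrable.mono' ((integral_arcsine (h.2.1 j)).1.const_mul (1 / (2 * √(a j)) *
      ((r⁻¹) ^ j * (∏ k ∈ Finset.range j, realFactor a b μ 0 k) * (√q)⁻¹)))
    (h.aestronglyMeasurable_gapWeight hμ j) ?_
  rw [ae_restrict_iff' measurableSet_Ioo]
  refine ae_of_all _ fun x hx => ?_
  rw [Real.norm_of_nonneg (h.gapWeight_pos hμ hx).le]
  refine (h.gapWeight_le hμ hx hr hrb hq hq1 hqb).trans ?_
  have h5 : √(a j) ≤ √x := Real.sqrt_le_sqrt hx.1.le
  have h6 : 0 < √(a j) := Real.sqrt_pos.2 (h.1 j)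
  gcongr

theorem integrableOn_mul_gapWeight (h : GapsDecreaseToZero a b)
    (hμ : ∀ j, μ j ∈ Set.Icc (a j) (b j)) (j : ℕ) {φ : ℝ → ℝ} (hφ : Continuous φ) :
    IntegrableOn (fun x => φ x * gapWeight a b μ j x) (Set.Ioo (a j) (b j)) := by
  obtain ⟨B, hB⟩ := (isCompact_Icc (a := a j) (b := b j)).exists_bound_of_continuousOn
    hφ.continuousOn
  refine Integrable.bdd_mul (c := B) (h.integrableOn_gapWeight hμ j) hφ.aestronglyMeasurable ?_
  rw [ae_restrict_iff' measurableSet_Ioo]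
  exact ae_of_all _ fun x hx => hB x (Set.Ioo_subset_Icc_self hx)

/-! ### Balanced zeros -/

/-- The barycenter of the weight in the `j`-th gap. The integral of the product over the gap vanishes
if and only if `μ j` is this barycenter. -/
noncomputable def _root_.gapMean (a b μ : ℕ → ℝ) (j : ℕ) : ℝ :=
  (∫ x in Set.Ioo (a j) (b j), x * gapWeight a b μ j x) /
    ∫ x in Set.Ioo (a j) (b j), gapWeight a b μ j x

theorem integral_gapWeight_pos (h : GapsDecreaseToZero a b)
    (hμ : ∀ j, μ j ∈ Set.Icc (a j) (b j)) (j : ℕ) :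
    0 < ∫ x in Set.Ioo (a j) (b j), gapWeight a b μ j x := by
  rw [setIntegral_pos_iff_support_of_nonneg_ae _ (h.integrableOn_gapWeight hμ j)]
  · have : Set.Ioo (a j) (b j) ⊆
        Function.support (gapWeight a b μ j) ∩ Set.Ioo (a j) (b j) :=
      fun x hx => ⟨(h.gapWeight_pos hμ hx).ne', hx⟩
    refine lt_of_lt_of_le ?_ (measure_mono this)
    simp [h.2.1 j]
  · rw [EventuallyLE, ae_restrict_iff' measurableSet_Ioo]
    exact ae_of_all _ fun x hx => (h.gapWeight_pos hμ hx).le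

theorem integral_sub_mul_gapWeight (h : GapsDecreaseToZero a b)
    (hμ : ∀ j, μ j ∈ Set.Icc (a j) (b j)) (j : ℕ) (m : ℝ) :
    ∫ x in Set.Ioo (a j) (b j), (x - m) * gapWeight a b μ j x =
      (gapMean a b μ j - m) * ∫ x in Set.Ioo (a j) (b j), gapWeight a b μ j x := by
  have h1 : ∀ x, (x - m) * gapWeight a b μ j x =
      x * gapWeight a b μ j x - m * gapWeight a b μ j x := fun x => by ring
  simp_rw [h1]
  rw [integral_sub (f := fun x => x * gapWeight a b μ j x)
    (h.integrableOn_mul_gapWeight hμ j continuous_id)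
    ((h.integrableOn_gapWeight hμ j).const_mul m), integral_const_mul, gapMean, sub_mul,
    div_mul_cancel₀ _ (h.integral_gapWeight_pos hμ j).ne']

theorem gapMean_mem (h : GapsDecreaseToZero a b) (hμ : ∀ j, μ j ∈ Set.Icc (a j) (b j)) (j : ℕ) :
    gapMean a b μ j ∈ Set.Icc (a j) (b j) := by
  have hpos := h.integral_gapWeight_pos hμ j
  constructor
  · have h1 : 0 ≤ ∫ x in Set.Ioo (a j) (b j), (x - a j) * gapWeight a b μ j x :=
      setIntegral_nonneg measurableSet_Ioo fun x hx =>
        mul_nonneg (by linarith [hx.1]) (h.gapWeight_pos hμ hx).le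
    rw [h.integral_sub_mul_gapWeight hμ] at h1
    nlinarith
  · have h1 : ∫ x in Set.Ioo (a j) (b j), (x - b j) * gapWeight a b μ j x ≤ 0 :=
      setIntegral_nonpos measurableSet_Ioo fun x hx =>
        mul_nonpos_of_nonpos_of_nonneg (by linarith [hx.2]) (h.gapWeight_pos hμ hx).le
    rw [h.integral_sub_mul_gapWeight hμ] at h1
    nlinarith

/-- For `c ≤ c'` the quotient of the two factors increases with `x` on either side of the gap, stated
without division. -/
theorem realFactor_cross {c c' : ℕ → ℝ}
    (hc : ∀ j, c j ∈ Set.Icc (a j) (b j)) (hc' : ∀ j, c' j ∈ Set.Icc (a j) (b j)) {x y : ℝ}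
    {k : ℕ} (hle : c k ≤ c' k) (hxy : x ≤ y) (hk : y < a k ∨ b k < x) :
    realFactor a b c' x k * realFactor a b c y k ≤
      realFactor a b c' y k * realFactor a b c x k := by
  have key : |x - c' k| * |y - c k| ≤ |y - c' k| * |x - c k| := by
    have h1 := (hc k).1; have h2 := (hc k).2; have h3 := (hc' k).1; have h4 := (hc' k).2
    rcases hk with hk | hk
    · rw [abs_of_neg (by linarith), abs_of_neg (by linarith), abs_of_neg (by linarith),
        abs_of_neg (by linarith)]
      nlinarith [mul_nonneg (sub_nonneg.2 hle) (sub_nonneg.2 hxy)]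
    · rw [abs_of_pos (by linarith), abs_of_pos (by linarith), abs_of_pos (by linarith),
        abs_of_pos (by linarith)]
      nlinarith [mul_nonneg (sub_nonneg.2 hle) (sub_nonneg.2 hxy)]
  simp only [realFactor]
  rw [div_mul_div_comm, div_mul_div_comm, mul_comm (√|y - a k| * √|y - b k|)]
  gcongr

/-- The part of the weight in the `j`-th gap that depends on the zeros. -/
noncomputable def _root_.otherFactors (a b μ : ℕ → ℝ) (j : ℕ) (x : ℝ) : ℝ :=
  (∏ k ∈ Finset.range j, realFactor a b μ x k) * ∏' i, realFactor a b μ x (i + (j + 1))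

theorem otherFactors_pos (h : GapsDecreaseToZero a b) (hμ : ∀ j, μ j ∈ Set.Icc (a j) (b j))
    {x : ℝ} {j : ℕ} (hx : x ∈ Set.Icc (a j) (b j)) : 0 < otherFactors a b μ j x := by
  obtain ⟨r, q, -, -, hq, hq1, hqb⟩ := h.exists_ratios j
  obtain ⟨h2, -⟩ := h.tprod_realFactor_tail_bounds hμ hx.1 hq hq1 hqb
  exact mul_pos (Finset.prod_pos fun k hk =>
      h.realFactor_pos_of_lt hμ (hx.2.trans_lt (h.b_lt_a (Finset.mem_range.1 hk))))
    ((Real.sqrt_pos.2 hq).trans_le h2)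

/-- Moving the other zeros to the right multiplies the weight by an increasing function, stated
without division. -/
theorem otherFactors_cross (h : GapsDecreaseToZero a b) {c c' : ℕ → ℝ}
    (hc : ∀ j, c j ∈ Set.Icc (a j) (b j)) (hc' : ∀ j, c' j ∈ Set.Icc (a j) (b j))
    (hle : ∀ j, c j ≤ c' j) {x y : ℝ} {j : ℕ} (hx : x ∈ Set.Icc (a j) (b j))
    (hy : y ∈ Set.Icc (a j) (b j)) (hxy : x ≤ y) :
    otherFactors a b c' j x * otherFactors a b c j y ≤
      otherFactors a b c' j y * otherFactors a b c j x := by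
  have hlim : ∀ μ : ℕ → ℝ, (∀ j, μ j ∈ Set.Icc (a j) (b j)) → ∀ z ∈ Set.Icc (a j) (b j),
      Tendsto (fun n => (∏ k ∈ Finset.range j, realFactor a b μ z k) *
        ∏ i ∈ Finset.range n, realFactor a b μ z (i + (j + 1))) atTop
        (𝓝 (otherFactors a b μ j z)) := fun μ hμ z hz =>
    ((tprod_ofReal_of_summable
      (h.summable_realFactor_sub_one_tail hμ hz.1)).1.hasProd.tendsto_prod_nat).const_mul _
  refine le_of_tendsto_of_tendsto' ((hlim c' hc' x hx).mul (hlim c hc y hy))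
    ((hlim c' hc' y hy).mul (hlim c hc x hx)) fun n => ?_
  rw [mul_mul_mul_comm, mul_mul_mul_comm (∏ k ∈ Finset.range j, realFactor a b c' y k),
    ← Finset.prod_mul_distrib, ← Finset.prod_mul_distrib, ← Finset.prod_mul_distrib,
    ← Finset.prod_mul_distrib]
  have hnn : ∀ (μ ν : ℕ → ℝ) (z w : ℝ) (k : ℕ),
      0 ≤ realFactor a b μ z k * realFactor a b ν w k := fun μ ν z w k =>
    mul_nonneg (realFactor_nonneg _ _ _ _ _) (realFactor_nonneg _ _ _ _ _)
  refine mul_le_mul (Finset.prod_le_prod (fun k _ => hnn _ _ _ _ _) fun k hk => ?_)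
    (Finset.prod_le_prod (fun k _ => hnn _ _ _ _ _) fun k _ => ?_)
    (Finset.prod_nonneg fun k _ => hnn _ _ _ _ _) (Finset.prod_nonneg fun k _ => hnn _ _ _ _ _)
  · exact realFactor_cross hc hc' (hle k) hxy
      (Or.inl (hy.2.trans_lt (h.b_lt_a (Finset.mem_range.1 hk))))
  · exact realFactor_cross hc hc' (hle _) hxy
      (Or.inr ((h.b_lt_a (by omega)).trans_le hx.1))

/-- The barycenter increases with the zeros: the quotient of the two weights is increasing, so
replacing `c` by `c'` shifts mass from the left of the barycenter `m` to its right. -/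
theorem gapMean_mono (h : GapsDecreaseToZero a b) {c c' : ℕ → ℝ}
    (hc : ∀ j, c j ∈ Set.Icc (a j) (b j)) (hc' : ∀ j, c' j ∈ Set.Icc (a j) (b j))
    (hle : ∀ j, c j ≤ c' j) (j : ℕ) : gapMean a b c j ≤ gapMean a b c' j := by
  set m := gapMean a b c j with hm
  have hmem : m ∈ Set.Icc (a j) (b j) := h.gapMean_mem hc j
  have hG := h.otherFactors_pos hc hmem
  have hw : ∀ μ x, gapWeight a b μ j x =
      1 / (2 * √x) * otherFactors a b μ j x / (√(x - a j) * √(b j - x)) := by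
    intro μ x; rw [gapWeight, otherFactors]; ring
  have hpt : ∀ x ∈ Set.Ioo (a j) (b j),
      otherFactors a b c' j m * ((x - m) * gapWeight a b c j x) ≤
        otherFactors a b c j m * ((x - m) * gapWeight a b c' j x) := by
    intro x hx
    have hx' := Set.Ioo_subset_Icc_self hx
    have h1 : 0 ≤ (x - m) * (otherFactors a b c' j x * otherFactors a b c j m -
        otherFactors a b c' j m * otherFactors a b c j x) := by
      rcases le_total x m with hxm | hxm
      · exact mul_nonneg_of_nonpos_of_nonpos (by linarith)
          (by linarith [h.otherFactors_cross hc hc' hle hx' hmem hxm])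
      · exact mul_nonneg (by linarith)
          (by linarith [h.otherFactors_cross hc hc' hle hmem hx' hxm])
    have h2 : 0 ≤ 1 / (2 * √x) / (√(x - a j) * √(b j - x)) := by positivity
    rw [hw, hw]
    have h3 := mul_nonneg h2 h1
    have h4 : otherFactors a b c j m *
        ((x - m) * (1 / (2 * √x) * otherFactors a b c' j x / (√(x - a j) * √(b j - x)))) -
        otherFactors a b c' j m *
        ((x - m) * (1 / (2 * √x) * otherFactors a b c j x / (√(x - a j) * √(b j - x)))) =
        1 / (2 * √x) / (√(x - a j) * √(b j - x)) *
        ((x - m) * (otherFactors a b c' j x * otherFactors a b c j m -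
        otherFactors a b c' j m * otherFactors a b c j x)) := by ring
    linarith
  have hcont : Continuous fun x : ℝ => x - m := by fun_prop
  have h5 := setIntegral_mono_on ((h.integrableOn_mul_gapWeight hc j hcont).const_mul _)
    ((h.integrableOn_mul_gapWeight hc' j hcont).const_mul _) measurableSet_Ioo hpt
  rw [integral_const_mul, integral_const_mul, h.integral_sub_mul_gapWeight hc,
    h.integral_sub_mul_gapWeight hc', ← hm, sub_self, zero_mul, mul_zero] at h5
  have h6 := h.integral_gapWeight_pos hc' j
  have h7 := nonneg_of_mul_nonneg_right h5 hG
  have h8 := nonneg_of_mul_nonneg_left h7 h6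
  linarith

/-- Balanced zeros exist: they are a fixed point of the barycenter map, which is monotone. -/
theorem exists_gapMean_eq (h : GapsDecreaseToZero a b) :
    ∃ c : ℕ → ℝ, (∀ j, c j ∈ Set.Icc (a j) (b j)) ∧ ∀ j, gapMean a b c j = c j :=
  exists_fixedPoint_of_monotone_box (fun j => (h.2.1 j).le) (fun c j => gapMean a b c j)
    (fun _ hc j => h.gapMean_mem hc j) (fun _ _ hc hc' hle j => h.gapMean_mono hc hc' hle j)

end GapsDecreaseToZero

/-! ### Estimates for balanced zeros -/

namespace GapsDecreaseToZero

variable {a b c : ℕ → ℝ}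

theorem prod_realFactor_zero_pos (h : GapsDecreaseToZero a b)
    (hc : ∀ j, c j ∈ Set.Icc (a j) (b j)) (j : ℕ) :
    0 < ∏ k ∈ Finset.range j, realFactor a b c 0 k :=
  Finset.prod_pos fun k _ => h.realFactor_pos_of_lt hc (h.1 k)

theorem integral_mul_gapWeight_le (h : GapsDecreaseToZero a b)
    (hc : ∀ j, c j ∈ Set.Icc (a j) (b j)) {r q : ℝ} {j : ℕ} (hr : 0 < r)
    (hrb : ∀ k < j, b j ≤ (1 - r) * a k) (hq : 0 < q) (hq1 : q ≤ 1)
    (hqb : b (j + 1) ≤ (1 - q) * a j) :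
    ∫ x in Set.Ioo (a j) (b j), x * gapWeight a b c j x ≤
      3 * √(b j) * ((r⁻¹) ^ j * (∏ k ∈ Finset.range j, realFactor a b c 0 k) * (√q)⁻¹) := by
  set D := (r⁻¹) ^ j * (∏ k ∈ Finset.range j, realFactor a b c 0 k) * (√q)⁻¹ with hD
  have hP := h.prod_realFactor_zero_pos hc j
  have hD0 : 0 < D := by have := Real.sqrt_pos.2 hq; positivity
  obtain ⟨hi, hle⟩ := integral_arcsine (h.2.1 j)
  calc ∫ x in Set.Ioo (a j) (b j), x * gapWeight a b c j x
      ≤ ∫ x in Set.Ioo (a j) (b j), √(b j) / 2 * D * (1 / (√(x - a j) * √(b j - x))) := by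
        refine setIntegral_mono_on (h.integrableOn_mul_gapWeight hc j continuous_id)
          (hi.const_mul _) measurableSet_Ioo fun x hx => ?_
        have hx0 : 0 < x := (h.1 j).trans hx.1
        have hsx : 0 < √x := Real.sqrt_pos.2 hx0
        have h1 := mul_le_mul_of_nonneg_left (h.gapWeight_le hc hx hr hrb hq hq1 hqb) hx0.le
        rw [← hD] at h1
        refine h1.trans ?_
        have h2 : x * (1 / (2 * √x) * D * (1 / (√(x - a j) * √(b j - x)))) =
            √x / 2 * D * (1 / (√(x - a j) * √(b j - x))) := by
          have h3 : x * (1 / (2 * √x)) = √x / 2 := by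
            have h4 := Real.mul_self_sqrt hx0.le
            field_simp
            linarith
          rw [← h3]; ring
        rw [h2]
        have h5 : √x ≤ √(b j) := Real.sqrt_le_sqrt hx.2.le
        gcongr
    _ = √(b j) / 2 * D * ∫ x in Set.Ioo (a j) (b j), 1 / (√(x - a j) * √(b j - x)) :=
        integral_const_mul _ _
    _ ≤ √(b j) / 2 * D * 6 := by gcongr
    _ = _ := by ring

theorem le_integral_gapWeight (h : GapsDecreaseToZero a b)
    (hc : ∀ j, c j ∈ Set.Icc (a j) (b j)) {q : ℝ} {j : ℕ} (hq : 0 < q) (hq1 : q ≤ 1)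
    (hqb : b (j + 1) ≤ (1 - q) * a j) (hab : 2 * a j ≤ b j) :
    ((2⁻¹ : ℝ) ^ j * (∏ k ∈ Finset.range j, realFactor a b c 0 k) * √q) / (2 * √(b j)) *
        (Real.log (b j / a j) - Real.log 2) ≤
      ∫ x in Set.Ioo (a j) (b j), gapWeight a b c j x := by
  set D := (2⁻¹ : ℝ) ^ j * (∏ k ∈ Finset.range j, realFactor a b c 0 k) * √q with hD
  have hP := h.prod_realFactor_zero_pos hc j
  have hD0 : 0 < D := by have := Real.sqrt_pos.2 hq; positivity
  have haj := h.1 j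
  have hbj := h.b_pos j
  have hsb : 0 < √(b j) := Real.sqrt_pos.2 hbj
  have hlog : ∫ x in Set.Ioo (a j) (b j / 2), x⁻¹ = Real.log (b j / a j) - Real.log 2 := by
    rw [← integral_Ioc_eq_integral_Ioo, ← intervalIntegral.integral_of_le (by linarith),
      integral_inv_of_pos haj (by linarith), ← Real.log_div (by positivity) two_ne_zero]
    congr 1; ring
  have hinv : IntegrableOn (fun x : ℝ => x⁻¹) (Set.Ioo (a j) (b j / 2)) := by
    have : IntegrableOn (fun x : ℝ => x⁻¹) (Set.Icc (a j) (b j / 2)) :=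
      (continuousOn_inv₀.mono fun x hx => by
        have := hx.1; simp only [Set.mem_compl_iff, Set.mem_singleton_iff]; linarith
        ).integrableOn_Icc
    exact this.mono_set Set.Ioo_subset_Icc_self
  have hsub : Set.Ioo (a j) (b j / 2) ⊆ Set.Ioo (a j) (b j) :=
    Set.Ioo_subset_Ioo_right (by linarith)
  calc D / (2 * √(b j)) * (Real.log (b j / a j) - Real.log 2)
      = ∫ x in Set.Ioo (a j) (b j / 2), D / (2 * √(b j)) * x⁻¹ := by
        rw [integral_const_mul, hlog]
    _ ≤ ∫ x in Set.Ioo (a j) (b j / 2), gapWeight a b c j x := by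
        refine setIntegral_mono_on (hinv.const_mul _)
          ((h.integrableOn_gapWeight hc j).mono_set hsub) measurableSet_Ioo fun x hx => ?_
        refine le_trans ?_ (h.le_gapWeight hc (hsub hx) hx.2.le hq hq1 hqb)
        rw [← hD]
        have hx0 : 0 < x := haj.trans hx.1
        have h1 : 0 < √(x - a j) := Real.sqrt_pos.2 (by linarith [hx.1])
        have h2 : 0 < √(b j - x) := Real.sqrt_pos.2 (by linarith [(hsub hx).2])
        have h3 : 0 < √x := Real.sqrt_pos.2 hx0
        have h4 : √(x - a j) ≤ √x := Real.sqrt_le_sqrt (by linarith)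
        have h5 : √(b j - x) ≤ √(b j) := Real.sqrt_le_sqrt (by linarith)
        have h6 : √x * √x = x := Real.mul_self_sqrt hx0.le
        calc D / (2 * √(b j)) * x⁻¹ = D / (2 * √(b j) * (√x * √x)) := by
              rw [h6, div_mul_eq_div_div _ _ x, div_eq_mul_inv _ x]
          _ ≤ D / (2 * √(b j - x) * (√x * √(x - a j))) := by gcongr
          _ = _ := by
              field_simp
    _ ≤ ∫ x in Set.Ioo (a j) (b j), gapWeight a b c j x := by
        refine setIntegral_mono_set (h.integrableOn_gapWeight hc j) ?_ hsub.eventuallyLE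
        rw [EventuallyLE, ae_restrict_iff' measurableSet_Ioo]
        exact ae_of_all _ fun x hx => (h.gapWeight_pos hc hx).le

/-- In a logarithmically long gap the balanced zero lies close to the left endpoint: near that
endpoint the weight is of size `1 / x`, hence has a large mass there. -/
theorem gapMean_mul_log_le (h : GapsDecreaseToZero a b)
    (hc : ∀ j, c j ∈ Set.Icc (a j) (b j)) {r q : ℝ} {j : ℕ} (hr : 0 < r)
    (hrb : ∀ k < j, b j ≤ (1 - r) * a k) (hq : 0 < q) (hq1 : q ≤ 1)
    (hqb : b (j + 1) ≤ (1 - q) * a j) (hab : 2 * a j ≤ b j) :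
    gapMean a b c j * (Real.log (b j / a j) - Real.log 2) ≤
      6 * 2 ^ j * (r⁻¹) ^ j * q⁻¹ * b j := by
  have h1 := h.integral_mul_gapWeight_le hc hr hrb hq hq1 hqb
  have h2 := h.le_integral_gapWeight hc hq hq1 hqb hab
  have h3 := h.integral_gapWeight_pos hc j
  set W := ∫ x in Set.Ioo (a j) (b j), gapWeight a b c j x with hW
  have h4 : gapMean a b c j * W = ∫ x in Set.Ioo (a j) (b j), x * gapWeight a b c j x := by
    rw [gapMean, div_mul_cancel₀ _ h3.ne']
  have h5 : 0 ≤ gapMean a b c j := (h.1 j).le.trans (h.gapMean_mem hc j).1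
  set M := gapMean a b c j
  set P := ∏ k ∈ Finset.range j, realFactor a b c 0 k
  set Λ := Real.log (b j / a j) - Real.log 2
  have hP : 0 < P := h.prod_realFactor_zero_pos hc j
  have hsq : 0 < √q := Real.sqrt_pos.2 hq
  have hsq2 : √q * √q = q := Real.mul_self_sqrt hq.le
  have hsb : 0 < √(b j) := Real.sqrt_pos.2 (h.b_pos j)
  have hsb2 : √(b j) * √(b j) = b j := Real.mul_self_sqrt (h.b_pos j).le
  have h6 : M * ((2⁻¹ : ℝ) ^ j * P * √q / (2 * √(b j)) * Λ) ≤
      3 * √(b j) * ((r⁻¹) ^ j * P * (√q)⁻¹) :=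
    (mul_le_mul_of_nonneg_left h2 h5).trans (h4.le.trans h1)
  have h7 : 0 < 2 ^ j * 2 * √(b j) / (P * √q) := by positivity
  have h8 := mul_le_mul_of_nonneg_right h6 h7.le
  have h9 : (2⁻¹ : ℝ) ^ j * 2 ^ j = 1 := by rw [← mul_pow]; norm_num
  calc M * Λ = M * ((2⁻¹ : ℝ) ^ j * P * √q / (2 * √(b j)) * Λ) *
        (2 ^ j * 2 * √(b j) / (P * √q)) := by
        generalize (2⁻¹ : ℝ) ^ j = t at h9
        have : M * (t * P * √q / (2 * √(b j)) * Λ) * (2 ^ j * 2 * √(b j) / (P * √q)) =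
            M * Λ * (t * 2 ^ j) := by
          field_simp
        rw [this, h9, mul_one]
    _ ≤ _ := h8
    _ = _ := by
        field_simp
        rw [Real.sq_sqrt hq.le, Real.sq_sqrt (h.b_pos j).le]
        ring

theorem gapProduct_eq_on_gap (h : GapsDecreaseToZero a b)
    (hc : ∀ j, c j ∈ Set.Icc (a j) (b j)) (j : ℕ) :
    Set.EqOn (fun t : ℝ => gapProduct a b c (t : ℂ))
      (fun t : ℝ => (((t - c j) * gapWeight a b c j t : ℝ) : ℂ)) (Set.Ioo (a j) (b j)) :=
  fun _ hx => h.gapProduct_of_mem_gap hc hx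

theorem intervalIntegrable_gapProduct (h : GapsDecreaseToZero a b)
    (hc : ∀ j, c j ∈ Set.Icc (a j) (b j)) (j : ℕ) :
    IntervalIntegrable (fun t : ℝ => gapProduct a b c (t : ℂ)) volume (a j) (b j) := by
  rw [intervalIntegrable_iff_integrableOn_Ioo_of_le (h.2.1 j).le]
  have h1 := (h.integrableOn_mul_gapWeight hc j (φ := fun x => x - c j) (by fun_prop)).ofReal
    (𝕜 := ℂ)
  exact IntegrableOn.congr_fun h1 (h.gapProduct_eq_on_gap hc j).symm measurableSet_Ioo

theorem integral_gapProduct_eq_zero (h : GapsDecreaseToZero a b)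
    (hc : ∀ j, c j ∈ Set.Icc (a j) (b j)) {j : ℕ} (hm : gapMean a b c j = c j) :
    ∫ t in (a j)..(b j), gapProduct a b c (t : ℂ) = 0 := by
  rw [intervalIntegral.integral_of_le (h.2.1 j).le, integral_Ioc_eq_integral_Ioo,
    setIntegral_congr_fun measurableSet_Ioo (h.gapProduct_eq_on_gap hc j),
    integral_complex_ofReal, h.integral_sub_mul_gapWeight hc, hm, sub_self, zero_mul,
    Complex.ofReal_zero]

/-- The height of the slit that the comb map attaches to the `j`-th gap is at most the first moment
of the weight. -/
theorem norm_height_le (h : GapsDecreaseToZero a b) (hc : ∀ j, c j ∈ Set.Icc (a j) (b j))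
    (j : ℕ) : ‖∫ t in (c j)..(b j), gapProduct a b c (t : ℂ)‖ ≤
      ∫ x in Set.Ioo (a j) (b j), x * gapWeight a b c j x := by
  have hsub : Set.Ioo (c j) (b j) ⊆ Set.Ioo (a j) (b j) := Set.Ioo_subset_Ioo_left (hc j).1
  have hi := h.integrableOn_mul_gapWeight hc j (φ := fun x => x) continuous_id
  rw [intervalIntegral.integral_of_le (hc j).2, integral_Ioc_eq_integral_Ioo,
    setIntegral_congr_fun measurableSet_Ioo ((h.gapProduct_eq_on_gap hc j).mono hsub)]
  refine (norm_integral_le_integral_norm _).trans ?_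
  calc ∫ x in Set.Ioo (c j) (b j), ‖(((x - c j) * gapWeight a b c j x : ℝ) : ℂ)‖
      ≤ ∫ x in Set.Ioo (c j) (b j), x * gapWeight a b c j x := by
        refine setIntegral_mono_on ?_ (hi.mono_set hsub) measurableSet_Ioo fun x hx => ?_
        · exact ((h.integrableOn_mul_gapWeight hc j (φ := fun x => x - c j)
            (by fun_prop)).mono_set hsub).ofReal.norm
        · have hw := (h.gapWeight_pos hc (hsub hx)).le
          rw [Complex.norm_real, Real.norm_of_nonneg (mul_nonneg (by linarith [hx.1]) hw)]
          have := (h.1 j).le.trans (hc j).1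
          gcongr
          linarith
    _ ≤ _ := by
        refine setIntegral_mono_set hi ?_ hsub.eventuallyLE
        rw [EventuallyLE, ae_restrict_iff' measurableSet_Ioo]
        exact ae_of_all _ fun x hx =>
          mul_nonneg ((h.1 j).le.trans hx.1.le) (h.gapWeight_pos hc hx).le

/-- The gaps whose scale is below `ε` contribute a bounded factor at `-ε`. -/
theorem prod_realFactor_neg_tail_le (h : GapsDecreaseToZero a b)
    (hc : ∀ j, c j ∈ Set.Icc (a j) (b j)) {ε : ℝ} (hε : 0 < ε) {j : ℕ} (hb : b (j + 1) ≤ 3 * ε)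
    (n : ℕ) : ∏ i ∈ Finset.range n, realFactor a b c (-ε) (i + (j + 1)) ≤ 2 := by
  set u : ℕ → ℝ := fun i => √(b (i + (j + 1)) + ε)
  set v : ℕ → ℝ := fun i => √(a (i + (j + 1)) + ε)
  have hu : ∀ i, 0 < u i := fun i => Real.sqrt_pos.2 (by linarith [h.b_pos (i + (j + 1))])
  have hv : ∀ i, 0 < v i := fun i => Real.sqrt_pos.2 (by linarith [h.1 (i + (j + 1))])
  have huv : ∀ i, (v i)⁻¹ ≤ (u (i + 1))⁻¹ := by
    intro i
    apply inv_anti₀ (hu _)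
    apply Real.sqrt_le_sqrt
    have := h.2.2.1 (i + (j + 1))
    rw [show i + 1 + (j + 1) = i + (j + 1) + 1 by ring]
    linarith
  have hfac : ∀ i, realFactor a b c (-ε) (i + (j + 1)) ≤ u i / v i := by
    intro i
    have ha := h.1 (i + (j + 1))
    rw [h.realFactor_of_lt hc (by linarith), sub_neg_eq_add, sub_neg_eq_add, sub_neg_eq_add,
      div_le_div_iff₀ (mul_pos (hv i) (hu i)) (hv i)]
    have h1 : u i * u i = b (i + (j + 1)) + ε :=
      Real.mul_self_sqrt (by linarith [h.b_pos (i + (j + 1))])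
    calc (c (i + (j + 1)) + ε) * v i ≤ (b (i + (j + 1)) + ε) * v i := by
          have := (hc (i + (j + 1))).2
          have := hv i
          gcongr
      _ = _ := by rw [← h1]; ring
  cases n with
  | zero => simp
  | succ n =>
    have h1 := div_le_prod_range_div (fun i => inv_pos.2 (hu i)) (fun i => inv_pos.2 (hv i)) huv n
    have h2 : ∏ i ∈ Finset.range (n + 1), (u i)⁻¹ / (v i)⁻¹ =
        (∏ i ∈ Finset.range (n + 1), u i / v i)⁻¹ := by
      rw [← Finset.prod_inv_distrib]
      refine Finset.prod_congr rfl fun i _ => ?_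
      rw [inv_div_inv, inv_div]
    rw [h2, inv_div_inv] at h1
    have h3 := inv_anti₀ (div_pos (hv n) (hu 0)) h1
    rw [inv_inv, inv_div] at h3
    refine (Finset.prod_le_prod (fun i _ => realFactor_nonneg _ _ _ _ _)
      fun i _ => hfac i).trans (h3.trans ?_)
    rw [div_le_iff₀ (hv n)]
    have h4 : √ε ≤ v n := Real.sqrt_le_sqrt (by linarith [h.1 (n + (j + 1))])
    have h5 : u 0 ≤ 2 * √ε := by
      have : (2 : ℝ) * √ε = √(4 * ε) := by
        rw [Real.sqrt_mul (by norm_num)]; congr 1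
        rw [show (4 : ℝ) = 2 ^ 2 by norm_num]; simp
      rw [this]
      apply Real.sqrt_le_sqrt
      rw [zero_add]; linarith
    linarith

/-- For `ε` between the scales of the gaps `j + 1` and `j - 1`: the gaps `k < j` contribute at most
`2 ^ j` times their value at the origin, the `j`-th gap at most `(c j + ε) / √(ε * β)`, and the
gaps `k > j` a bounded factor. -/
theorem norm_gapProduct_neg_le (h : GapsDecreaseToZero a b)
    (hc : ∀ j, c j ∈ Set.Icc (a j) (b j)) {ε β : ℝ} {j : ℕ} (hε : 0 < ε) (hβ : 0 < β)
    (hb : b (j + 1) ≤ 3 * ε) (hβb : β ≤ b j) (hεa : ∀ k < j, ε ≤ a k) :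
    ‖gapProduct a b c ((-ε : ℝ) : ℂ)‖ ≤
      2 ^ j * (∏ k ∈ Finset.range j, realFactor a b c 0 k) / √β * (c j * ε⁻¹ + 1) := by
  have hneg : -ε < 0 := by linarith
  set P := ∏ k ∈ Finset.range j, realFactor a b c 0 k
  have hP : 0 < P := h.prod_realFactor_zero_pos hc j
  have hs := h.summable_realFactor_sub_one_neg hc hneg
  have hs' : Summable fun k => realFactor a b c (-ε) (k + (j + 1)) - 1 :=
    (summable_nat_add_iff (f := fun k => realFactor a b c (-ε) k - 1) (j + 1)).2 hs
  have hm := (tprod_ofReal_of_summable hs').1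
  have htail : ∏' i, realFactor a b c (-ε) (i + (j + 1)) ≤ 2 :=
    le_of_tendsto' hm.hasProd.tendsto_prod_nat (h.prod_realFactor_neg_tail_le hc hε hb)
  have htail0 : 0 ≤ ∏' i, realFactor a b c (-ε) (i + (j + 1)) :=
    ge_of_tendsto' hm.hasProd.tendsto_prod_nat fun n =>
      Finset.prod_nonneg fun i _ => realFactor_nonneg _ _ _ _ _
  have hhead : ∏ k ∈ Finset.range j, realFactor a b c (-ε) k ≤ 2 ^ j * P := by
    rw [← Finset.card_range j, ← Finset.prod_const, Finset.card_range, ← Finset.prod_mul_distrib]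
    refine Finset.prod_le_prod (fun k _ => realFactor_nonneg _ _ _ _ _) fun k hk => ?_
    have ha := h.1 k
    have hbk := h.b_pos k
    have h1 := hεa k (Finset.mem_range.1 hk)
    have h2 := (hc k).1
    rw [h.realFactor_of_lt hc ha, h.realFactor_of_lt hc (by linarith)]
    simp only [sub_neg_eq_add, sub_zero]
    rw [← mul_div_assoc]
    have h3 : 0 < √(a k) := Real.sqrt_pos.2 ha
    have h4 : 0 < √(b k) := Real.sqrt_pos.2 hbk
    apply div_le_div₀ (by linarith) (by linarith) (by positivity)
    have h5 : √(a k) ≤ √(a k + ε) := Real.sqrt_le_sqrt (by linarith)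
    have h6 : √(b k) ≤ √(b k + ε) := Real.sqrt_le_sqrt (by linarith)
    gcongr
  have hsε : 0 < √ε := Real.sqrt_pos.2 hε
  have hsβ : 0 < √β := Real.sqrt_pos.2 hβ
  have haj := h.1 j
  have hcj := haj.trans_le (hc j).1
  have hmid : realFactor a b c (-ε) j ≤ (c j + ε) / (√ε * √β) := by
    rw [h.realFactor_of_lt hc (by linarith)]
    simp only [sub_neg_eq_add]
    have h5 : √ε ≤ √(a j + ε) := Real.sqrt_le_sqrt (by linarith)
    have h6 : √β ≤ √(b j + ε) := Real.sqrt_le_sqrt (by linarith)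
    gcongr
  rw [h.gapProduct_of_neg hc hneg, neg_neg, Complex.norm_real, ← hm.prod_mul_tprod_nat_mul',
    Finset.prod_range_succ]
  have hnn : 0 ≤ realFactor a b c (-ε) j := realFactor_nonneg _ _ _ _ _
  have hhnn : 0 ≤ ∏ k ∈ Finset.range j, realFactor a b c (-ε) k :=
    Finset.prod_nonneg fun k _ => realFactor_nonneg _ _ _ _ _
  rw [Real.norm_of_nonneg (by positivity)]
  calc 1 / (2 * √ε) * ((∏ k ∈ Finset.range j, realFactor a b c (-ε) k) *
        realFactor a b c (-ε) j * ∏' i, realFactor a b c (-ε) (i + (j + 1)))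
      ≤ 1 / (2 * √ε) * ((2 ^ j * P) * ((c j + ε) / (√ε * √β)) * 2) := by gcongr
    _ = 2 ^ j * P / √β * ((c j + ε) / (√ε * √ε)) := by field_simp
    _ = _ := by
      rw [Real.mul_self_sqrt hε.le]
      congr 1
      field_simp

theorem aestronglyMeasurable_gapProduct_neg (h : GapsDecreaseToZero a b)
    (hc : ∀ j, c j ∈ Set.Icc (a j) (b j)) :
    AEStronglyMeasurable (fun ε : ℝ => gapProduct a b c ((-ε : ℝ) : ℂ))
      (volume.restrict (Set.Ioi 0)) := by
  have hm : ∀ k, Measurable fun x => realFactor a b c (-x) k := by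
    intro k
    have hd : ∀ e : ℝ, Measurable fun x : ℝ => |-x - e| := fun e =>
      (continuous_abs.comp (continuous_neg.sub continuous_const)).measurable
    exact (hd _).div (((hd _).sqrt).mul ((hd _).sqrt))
  refine aestronglyMeasurable_of_tendsto_ae (u := atTop)
    (f := fun n (ε : ℝ) => ((1 / (2 * √ε) *
      ∏ k ∈ Finset.range n, realFactor a b c (-ε) k : ℝ) : ℂ)) (fun n => ?_) ?_
  · have h1 : Measurable fun x : ℝ => 1 / (2 * √x) := by fun_prop
    exact (Complex.measurable_ofReal.comp
      (h1.mul (Finset.measurable_prod _ fun i _ => hm _))).aestronglyMeasurable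
  · rw [ae_restrict_iff' measurableSet_Ioi]
    refine ae_of_all _ fun ε hε => ?_
    have hε : 0 < ε := hε
    have hneg : -ε < 0 := by linarith
    rw [h.gapProduct_of_neg hc hneg, neg_neg]
    exact (Complex.continuous_ofReal.tendsto _).comp (((tprod_ofReal_of_summable
      (h.summable_realFactor_sub_one_neg hc hneg)).1.hasProd.tendsto_prod_nat).const_mul _)

end GapsDecreaseToZero

/-! ### The choice of the gaps -/

/-- The constant in the estimate of the `j`-th balanced zero, for gaps that are separated from
their neighbours by the ratios `1 - 1 / (j + 1) ^ 2`, `1 - 1 / (j + 2) ^ 2`. -/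
noncomputable def gapConst (j : ℕ) : ℝ := 6 * 2 ^ j * (((j : ℝ) + 1) ^ 2) ^ j * ((j : ℝ) + 2) ^ 2

/-- The logarithmic length of the `j`-th gap. It is so large that the balanced zero of the
`j`-th gap is at most `4⁻¹ ^ (j + 1) / gapConst (j + 1)` times the right endpoint. -/
noncomputable def gapLogLength (j : ℕ) : ℝ :=
  Real.log 2 + 4 ^ (j + 1) * gapConst j * gapConst (j + 1)

/-- The scale of the right endpoint of the `j`-th gap. -/
noncomputable def gapScale (j : ℕ) : ℝ := Real.exp (-∑ k ∈ Finset.range j, gapLogLength k)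

/-- Left endpoints of the gaps. -/
noncomputable def leftEdge (j : ℕ) : ℝ := ((j : ℝ) + 2) / (j + 1) * gapScale (j + 1)

/-- Right endpoints of the gaps. The factor `(j + 2) / (j + 1)`, common to both endpoints of a gap,
leaves between consecutive gaps a band whose relative length is only `1 / (j + 2) ^ 2`. -/
noncomputable def rightEdge (j : ℕ) : ℝ := ((j : ℝ) + 2) / (j + 1) * gapScale j

theorem one_le_gapConst (j : ℕ) : 1 ≤ gapConst j := by
  have h0 : (0 : ℝ) ≤ j := Nat.cast_nonneg j
  have h1 : (1 : ℝ) ≤ 2 ^ j := one_le_pow₀ (by norm_num)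
  have h2 : (1 : ℝ) ≤ (((j : ℝ) + 1) ^ 2) ^ j := one_le_pow₀ (one_le_pow₀ (by linarith))
  have h3 : (1 : ℝ) ≤ ((j : ℝ) + 2) ^ 2 := one_le_pow₀ (by linarith)
  unfold gapConst
  exact one_le_mul_of_one_le_of_one_le (one_le_mul_of_one_le_of_one_le
    (one_le_mul_of_one_le_of_one_le (by norm_num) h1) h2) h3

theorem one_le_gapLogLength (j : ℕ) : Real.log 2 + 1 ≤ gapLogLength j := by
  have h1 : (1 : ℝ) ≤ 4 ^ (j + 1) := one_le_pow₀ (by norm_num)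
  exact add_le_add_right (one_le_mul_of_one_le_of_one_le (one_le_mul_of_one_le_of_one_le h1
    (one_le_gapConst j)) (one_le_gapConst (j + 1))) _

theorem gapScale_pos (j : ℕ) : 0 < gapScale j := Real.exp_pos _

theorem gapScale_zero : gapScale 0 = 1 := by simp [gapScale]

theorem gapScale_eq (j : ℕ) : gapScale j = gapScale (j + 1) * Real.exp (gapLogLength j) := by
  rw [gapScale, gapScale, ← Real.exp_add, Finset.sum_range_succ]
  congr 1; ring

theorem two_mul_gapScale_succ_le (j : ℕ) : 2 * gapScale (j + 1) ≤ gapScale j := by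
  have h1 : (2 : ℝ) ≤ Real.exp (gapLogLength j) := by
    rw [← Real.log_le_iff_le_exp two_pos]
    linarith [one_le_gapLogLength j]
  rw [gapScale_eq j]
  nlinarith [gapScale_pos (j + 1)]

theorem gapScale_lt (j : ℕ) : gapScale (j + 1) < gapScale j := by
  linarith [two_mul_gapScale_succ_le j, gapScale_pos (j + 1)]

theorem gapScale_antitone : Antitone gapScale := antitone_nat_of_succ_le fun j => (gapScale_lt j).le

theorem gapScale_le (j : ℕ) : gapScale j ≤ (2⁻¹ : ℝ) ^ j := by
  induction j with
  | zero => simp [gapScale_zero]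
  | succ j ih => rw [pow_succ]; linarith [two_mul_gapScale_succ_le j]

theorem tendsto_gapScale : Tendsto gapScale atTop (𝓝 0) :=
  squeeze_zero (fun j => (gapScale_pos j).le) gapScale_le
    (tendsto_pow_atTop_nhds_zero_of_lt_one (by norm_num) (by norm_num))

theorem one_le_edgeFactor (j : ℕ) : 1 ≤ ((j : ℝ) + 2) / (j + 1) := by
  rw [one_le_div (by positivity)]; linarith

theorem edgeFactor_le_two (j : ℕ) : ((j : ℝ) + 2) / (j + 1) ≤ 2 := by
  rw [div_le_iff₀ (by positivity)]; linarith [(Nat.cast_nonneg j : (0 : ℝ) ≤ j)]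

theorem gapScale_le_rightEdge (j : ℕ) : gapScale j ≤ rightEdge j :=
  le_mul_of_one_le_left (gapScale_pos j).le (one_le_edgeFactor j)

theorem rightEdge_le (j : ℕ) : rightEdge j ≤ 2 * gapScale j :=
  mul_le_mul_of_nonneg_right (edgeFactor_le_two j) (gapScale_pos j).le

theorem gapScale_succ_le_leftEdge (j : ℕ) : gapScale (j + 1) ≤ leftEdge j :=
  le_mul_of_one_le_left (gapScale_pos _).le (one_le_edgeFactor j)

theorem rightEdge_succ (j : ℕ) :
    rightEdge (j + 1) = (1 - (((j : ℝ) + 2) ^ 2)⁻¹) * leftEdge j := by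
  have h1 : (j : ℝ) + 1 ≠ 0 := by positivity
  have h2 : (j : ℝ) + 2 ≠ 0 := by positivity
  have h3 : (j : ℝ) + 1 + 1 ≠ 0 := by positivity
  rw [rightEdge, leftEdge, ← mul_assoc]
  congr 1
  push_cast
  field_simp
  ring

theorem two_mul_leftEdge_le (j : ℕ) : 2 * leftEdge j ≤ rightEdge j := by
  rw [leftEdge, rightEdge, mul_left_comm]
  exact mul_le_mul_of_nonneg_left (two_mul_gapScale_succ_le j) (by positivity)

theorem leftEdge_pos (j : ℕ) : 0 < leftEdge j :=
  mul_pos (by positivity) (gapScale_pos _)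

theorem gapsDecreaseToZero_edges : GapsDecreaseToZero leftEdge rightEdge := by
  refine ⟨leftEdge_pos, fun j => ?_, fun j => ?_, ?_⟩
  · linarith [two_mul_leftEdge_le j, leftEdge_pos j]
  · rw [rightEdge_succ, sub_mul, one_mul, sub_lt_self_iff]
    exact mul_pos (by positivity) (leftEdge_pos j)
  · refine squeeze_zero (fun j => (gapScale_pos j).le.trans (gapScale_le_rightEdge j)) rightEdge_le ?_
    simpa using tendsto_gapScale.const_mul 2

theorem leftEdge_antitone : Antitone leftEdge := by
  have h := gapsDecreaseToZero_edges
  exact antitone_nat_of_succ_le fun j => ((h.2.1 (j + 1)).trans (h.2.2.1 j)).le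

theorem rightEdge_le_leftEdge {j k : ℕ} (hkj : k < j) :
    rightEdge j ≤ (1 - (((j : ℝ) + 1) ^ 2)⁻¹) * leftEdge k := by
  obtain ⟨i, rfl⟩ : ∃ i, j = i + 1 := ⟨j - 1, by omega⟩
  have h1 : (((i + 1 : ℕ) : ℝ) + 1) = (i : ℝ) + 2 := by push_cast; ring
  rw [h1, rightEdge_succ]
  refine mul_le_mul_of_nonneg_left (leftEdge_antitone (Nat.lt_succ_iff.1 hkj)) ?_
  rw [sub_nonneg]
  exact inv_le_one_of_one_le₀ (one_le_pow₀ (by linarith [(Nat.cast_nonneg i : (0 : ℝ) ≤ i)]))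

theorem log_edge_ratio (j : ℕ) : Real.log (rightEdge j / leftEdge j) = gapLogLength j := by
  have h1 := (gapScale_pos (j + 1)).ne'
  have h2 : rightEdge j / leftEdge j = Real.exp (gapLogLength j) := by
    rw [rightEdge, leftEdge, gapScale_eq j]
    have h3 : (j : ℝ) + 1 ≠ 0 := by positivity
    have h4 : (j : ℝ) + 2 ≠ 0 := by positivity
    field_simp
  rw [h2, Real.log_exp]

/-- With zeros at the right endpoints the product grows like `1 / ε` at `-ε`: its factors are bounded
below by telescoping ones. -/
theorem half_le_mul_gapProduct_rightEdge {ε : ℝ} (hε : 0 < ε) :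
    1 / 2 ≤ ε * (gapProduct leftEdge rightEdge rightEdge ((-ε : ℝ) : ℂ)).re := by
  have h := gapsDecreaseToZero_edges
  have hμ : ∀ j, rightEdge j ∈ Set.Icc (leftEdge j) (rightEdge j) :=
    fun j => ⟨(h.2.1 j).le, le_rfl⟩
  have hneg : -ε < 0 := by linarith
  have hfac : ∀ k, √(gapScale k + ε) / √(gapScale (k + 1) + ε) ≤
      realFactor leftEdge rightEdge rightEdge (-ε) k := by
    intro k
    have ha := h.1 k
    have hb := h.b_pos k
    have hs := one_le_edgeFactor k
    have hβ := gapScale_pos (k + 1)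
    have hββ := gapScale_lt k
    have hsq : 0 < √(rightEdge k + ε) := Real.sqrt_pos.2 (by linarith)
    have hsq2 : √(rightEdge k + ε) * √(rightEdge k + ε) = rightEdge k + ε :=
      Real.mul_self_sqrt (by linarith)
    rw [h.realFactor_of_lt hμ (by linarith)]
    simp only [sub_neg_eq_add]
    have hquot : (rightEdge k + ε) / (√(leftEdge k + ε) * √(rightEdge k + ε)) =
        √(rightEdge k + ε) / √(leftEdge k + ε) := by
      rw [← mul_div_mul_right _ (√(leftEdge k + ε)) hsq.ne', hsq2]
    rw [hquot, ← Real.sqrt_div (by linarith), ← Real.sqrt_div (by linarith)]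
    apply Real.sqrt_le_sqrt
    rw [div_le_div_iff₀ (by linarith) (by linarith), rightEdge, leftEdge]
    have h1 : 0 ≤ (((k : ℝ) + 2) / (k + 1) - 1) * (gapScale k - gapScale (k + 1)) * ε :=
      mul_nonneg (mul_nonneg (by linarith) (by linarith)) hε.le
    linarith
  have hprod : ∀ n, 1 / √(gapScale n + ε) ≤
      ∏ k ∈ Finset.range n, realFactor leftEdge rightEdge rightEdge (-ε) k := by
    intro n
    refine le_trans ?_ (Finset.prod_le_prod (fun k _ => by positivity) fun k _ => hfac k)
    have hne : ∀ k, √(gapScale k + ε) ≠ 0 := fun k =>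
      (Real.sqrt_pos.2 (by linarith [gapScale_pos k])).ne'
    have htel : ∀ n, ∏ k ∈ Finset.range n, √(gapScale k + ε) / √(gapScale (k + 1) + ε) =
        √(1 + ε) / √(gapScale n + ε) := by
      intro n
      induction n with
      | zero => rw [Finset.prod_range_zero, gapScale_zero, div_self (gapScale_zero ▸ hne 0)]
      | succ n ih => rw [Finset.prod_range_succ, ih, div_mul_div_cancel₀ (hne n)]
    rw [htel]
    have : 1 ≤ √(1 + ε) := Real.one_le_sqrt.2 (by linarith)
    gcongr
  have hlim : Tendsto (fun n => 1 / √(gapScale n + ε)) atTop (𝓝 (1 / √ε)) := by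
    have h1 := (tendsto_gapScale.add_const ε).sqrt
    rw [zero_add] at h1
    exact tendsto_const_nhds.div h1 (Real.sqrt_pos.2 hε).ne'
  have hle := le_of_tendsto_of_tendsto' hlim (tprod_ofReal_of_summable
    (h.summable_realFactor_sub_one_neg hμ hneg)).1.hasProd.tendsto_prod_nat hprod
  have hs : 0 < √ε := Real.sqrt_pos.2 hε
  rw [h.gapProduct_of_neg hμ hneg, neg_neg, Complex.ofReal_re]
  calc (1 : ℝ) / 2 = ε * (1 / (2 * √ε) * (1 / √ε)) := by
        have := Real.mul_self_sqrt hε.le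
        field_simp
        linarith
    _ ≤ _ := by gcongr

/-! ### Balanced zeros for the chosen gaps -/

section BalancedZeros

variable {c : ℕ → ℝ}

/-- The balanced zeros lie close to the left endpoints, on the scale of the right endpoints. -/
theorem balancedZero_le (hc : ∀ j, c j ∈ Set.Icc (leftEdge j) (rightEdge j))
    (hm : ∀ j, gapMean leftEdge rightEdge c j = c j) (j : ℕ) :
    c j * (gapLogLength j - Real.log 2) ≤ gapConst j * rightEdge j ∧
      c j * (4 ^ (j + 1) * gapConst (j + 1)) ≤ rightEdge j := by
  have h := gapsDecreaseToZero_edges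
  have h1 := h.gapMean_mul_log_le hc (r := (((j : ℝ) + 1) ^ 2)⁻¹) (q := (((j : ℝ) + 2) ^ 2)⁻¹)
    (j := j) (by positivity) (fun k hk => rightEdge_le_leftEdge hk) (by positivity)
    (inv_le_one_of_one_le₀ (one_le_pow₀ (by linarith [(Nat.cast_nonneg j : (0 : ℝ) ≤ j)])))
    (rightEdge_succ j).le (two_mul_leftEdge_le j)
  rw [hm, log_edge_ratio, inv_inv, inv_inv] at h1
  have h2 : c j * (gapLogLength j - Real.log 2) ≤ gapConst j * rightEdge j := h1
  refine ⟨h2, ?_⟩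
  have hA : 0 < gapConst j := one_pos.trans_le (one_le_gapConst j)
  refine le_of_mul_le_mul_left ?_ hA
  refine le_trans (le_of_eq ?_) h2
  rw [gapLogLength]; ring

/-- Each step from `j` to `j + 1` multiplies `P j * √(gapScale j)` by `c j / rightEdge j`, where `P j`
is the product on the left; the logarithmic lengths of the gaps are made for this factor to
absorb the growth of `gapConst j * 4 ^ j`. -/
theorem prod_realFactor_zero_mul_le (hc : ∀ j, c j ∈ Set.Icc (leftEdge j) (rightEdge j))
    (hm : ∀ j, gapMean leftEdge rightEdge c j = c j) (j : ℕ) :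
    (∏ k ∈ Finset.range j, realFactor leftEdge rightEdge c 0 k) * √(gapScale j) *
      (gapConst j * 4 ^ j) ≤ gapConst 0 := by
  have h := gapsDecreaseToZero_edges
  induction j with
  | zero => simp [gapScale_zero]
  | succ j ih =>
    refine le_trans ?_ ih
    have hP := h.prod_realFactor_zero_pos hc j
    rw [Finset.prod_range_succ, h.realFactor_of_lt hc (h.1 j), sub_zero, sub_zero, sub_zero]
    set P := ∏ k ∈ Finset.range j, realFactor leftEdge rightEdge c 0 k
    have hβ := Real.sqrt_pos.2 (gapScale_pos j)
    have hβ' := Real.sqrt_pos.2 (gapScale_pos (j + 1))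
    have hβ2 : √(gapScale j) * √(gapScale j) = gapScale j := Real.mul_self_sqrt (gapScale_pos j).le
    have hs : (0 : ℝ) < ((j : ℝ) + 2) / (j + 1) := by positivity
    have hss := Real.sqrt_pos.2 hs
    have hss2 : √(((j : ℝ) + 2) / (j + 1)) * √(((j : ℝ) + 2) / (j + 1)) = ((j : ℝ) + 2) / (j + 1) :=
      Real.mul_self_sqrt hs.le
    have hb := h.b_pos j
    have h1 : √(leftEdge j) * √(rightEdge j) * √(gapScale j) = rightEdge j * √(gapScale (j + 1)) := by
      rw [leftEdge, rightEdge, Real.sqrt_mul hs.le, Real.sqrt_mul hs.le]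
      linear_combination (√(gapScale (j + 1)) * √(gapScale j) * √(gapScale j)) * hss2 +
        (((j : ℝ) + 2) / (j + 1) * √(gapScale (j + 1))) * hβ2
    have h2 : c j / (√(leftEdge j) * √(rightEdge j)) * √(gapScale (j + 1)) =
        √(gapScale j) * (c j / rightEdge j) := by
      have h3 := Real.sqrt_pos.2 (h.1 j)
      have h4 := Real.sqrt_pos.2 hb
      rw [div_mul_eq_mul_div, ← mul_div_assoc, div_eq_div_iff (by positivity) hb.ne']
      linear_combination (-c j) * h1
    have h5 : c j / rightEdge j * (gapConst (j + 1) * 4 ^ (j + 1)) ≤ 1 := by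
      rw [div_mul_eq_mul_div, div_le_one hb, mul_comm (gapConst (j + 1))]
      exact (balancedZero_le hc hm j).2
    have h6 : 1 ≤ gapConst j * 4 ^ j :=
      one_le_mul_of_one_le_of_one_le (one_le_gapConst j) (one_le_pow₀ (by norm_num))
    calc _ = P * √(gapScale j) * (c j / rightEdge j * (gapConst (j + 1) * 4 ^ (j + 1))) := by
          linear_combination P * (gapConst (j + 1) * 4 ^ (j + 1)) * h2
      _ ≤ P * √(gapScale j) * (gapConst j * 4 ^ j) := by
          exact mul_le_mul_of_nonneg_left (h5.trans h6) (by positivity)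

theorem norm_balancedHeight_le (hc : ∀ j, c j ∈ Set.Icc (leftEdge j) (rightEdge j))
    (hm : ∀ j, gapMean leftEdge rightEdge c j = c j) (j : ℕ) :
    ‖∫ t in (c j)..(rightEdge j), gapProduct leftEdge rightEdge c (t : ℂ)‖ ≤
      gapConst 0 * (4⁻¹ : ℝ) ^ j := by
  have h := gapsDecreaseToZero_edges
  have hP := h.prod_realFactor_zero_pos hc j
  have hj : (0 : ℝ) ≤ j := Nat.cast_nonneg j
  have h1 := h.integral_mul_gapWeight_le hc (r := (((j : ℝ) + 1) ^ 2)⁻¹)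
    (q := (((j : ℝ) + 2) ^ 2)⁻¹)
    (j := j) (by positivity) (fun k hk => rightEdge_le_leftEdge hk) (by positivity)
    (inv_le_one_of_one_le₀ (one_le_pow₀ (by linarith))) (rightEdge_succ j).le
  rw [inv_inv, Real.sqrt_inv, inv_inv, Real.sqrt_sq (by linarith)] at h1
  refine (h.norm_height_le hc j).trans (h1.trans ?_)
  have h3 := prod_realFactor_zero_mul_le hc hm j
  set P := ∏ k ∈ Finset.range j, realFactor leftEdge rightEdge c 0 k
  have h2 : √(rightEdge j) ≤ 2 * √(gapScale j) := by
    have : (2 : ℝ) * √(gapScale j) = √(2 ^ 2 * gapScale j) := by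
      rw [Real.sqrt_mul (by norm_num), Real.sqrt_sq (by norm_num)]
    rw [this]
    apply Real.sqrt_le_sqrt
    linarith [rightEdge_le j, gapScale_pos j]
  have h4 : (4⁻¹ : ℝ) ^ j * 4 ^ j = 1 := by rw [← mul_pow]; norm_num
  have h5 : (1 : ℝ) ≤ 2 ^ j := one_le_pow₀ (by norm_num)
  calc 3 * √(rightEdge j) * ((((j : ℝ) + 1) ^ 2) ^ j * P * ((j : ℝ) + 2))
      ≤ 3 * (2 * √(gapScale j)) * ((((j : ℝ) + 1) ^ 2) ^ j * P * ((j : ℝ) + 2)) := by gcongr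
    _ = P * √(gapScale j) * (6 * 1 * (((j : ℝ) + 1) ^ 2) ^ j * ((j : ℝ) + 2)) := by ring
    _ ≤ P * √(gapScale j) * gapConst j := by
        rw [gapConst]
        have : (j : ℝ) + 2 ≤ ((j : ℝ) + 2) ^ 2 := by nlinarith
        gcongr
    _ = P * √(gapScale j) * (gapConst j * 4 ^ j) * (4⁻¹ : ℝ) ^ j := by
        linear_combination (-(P * √(gapScale j) * gapConst j)) * h4
    _ ≤ gapConst 0 * (4⁻¹ : ℝ) ^ j := by gcongr

theorem integrableOn_and_integral_inv_Ioc_gapScale (j : ℕ) :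
    IntegrableOn (fun ε : ℝ => ε⁻¹) (Set.Ioc (gapScale (j + 1)) (gapScale j)) ∧
      ∫ ε in Set.Ioc (gapScale (j + 1)) (gapScale j), ε⁻¹ = gapLogLength j := by
  have h0 := gapScale_pos (j + 1)
  have h1 := gapScale_lt j
  constructor
  · refine IntegrableOn.mono_set (ContinuousOn.integrableOn_Icc ?_) Set.Ioc_subset_Icc_self
    exact continuousOn_inv₀.mono fun x hx => (h0.trans_le hx.1).ne'
  · rw [← intervalIntegral.integral_of_le h1.le, integral_inv_of_pos h0 (gapScale_pos j),
      gapScale_eq j, mul_div_cancel_left₀ _ h0.ne', Real.log_exp]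

/-- The contribution of a scale to the integral over the negative half-axis. -/
theorem integrableOn_and_integral_norm_gapProduct_neg_le
    (hc : ∀ j, c j ∈ Set.Icc (leftEdge j) (rightEdge j))
    (hm : ∀ j, gapMean leftEdge rightEdge c j = c j) (j : ℕ) :
    IntegrableOn (fun ε : ℝ => gapProduct leftEdge rightEdge c ((-ε : ℝ) : ℂ))
        (Set.Ioc (gapScale (j + 1)) (gapScale j)) ∧
      ∫ ε in Set.Ioc (gapScale (j + 1)) (gapScale j),
        ‖gapProduct leftEdge rightEdge c ((-ε : ℝ) : ℂ)‖ ≤ 5 * gapConst 0 * (2⁻¹ : ℝ) ^ j := by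
  have h := gapsDecreaseToZero_edges
  have hP := h.prod_realFactor_zero_pos hc j
  have h3 := prod_realFactor_zero_mul_le hc hm j
  have hβ := gapScale_pos j
  have hβ' := gapScale_pos (j + 1)
  have hlt := gapScale_lt j
  have hbound : ∀ ε ∈ Set.Ioc (gapScale (j + 1)) (gapScale j),
      ‖gapProduct leftEdge rightEdge c ((-ε : ℝ) : ℂ)‖ ≤
        2 ^ j * (∏ k ∈ Finset.range j, realFactor leftEdge rightEdge c 0 k) / √(gapScale j) *
          (c j * ε⁻¹ + 1) := by
    intro ε hε
    refine h.norm_gapProduct_neg_le hc (hβ'.trans hε.1) hβ ?_ (gapScale_le_rightEdge j) ?_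
    · linarith [rightEdge_le (j + 1), hε.1]
    · exact fun k hk => hε.2.trans ((gapScale_antitone hk).trans (gapScale_succ_le_leftEdge k))
  set P := ∏ k ∈ Finset.range j, realFactor leftEdge rightEdge c 0 k
  obtain ⟨hinv, hlog⟩ := integrableOn_and_integral_inv_Ioc_gapScale j
  have hone : IntegrableOn (fun _ : ℝ => (1 : ℝ)) (Set.Ioc (gapScale (j + 1)) (gapScale j)) :=
    integrableOn_const (by simp)
  have hmaj : IntegrableOn (fun ε => 2 ^ j * P / √(gapScale j) * (c j * ε⁻¹ + 1))
      (Set.Ioc (gapScale (j + 1)) (gapScale j)) :=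
    ((hinv.const_mul (c j)).add hone).const_mul (2 ^ j * P / √(gapScale j))
  have hint : IntegrableOn (fun ε : ℝ => gapProduct leftEdge rightEdge c ((-ε : ℝ) : ℂ))
      (Set.Ioc (gapScale (j + 1)) (gapScale j)) := by
    refine Integrable.mono' hmaj ((h.aestronglyMeasurable_gapProduct_neg hc).mono_measure
      (Measure.restrict_mono_set _ fun ε hε => hβ'.trans hε.1)) ?_
    rw [ae_restrict_iff' measurableSet_Ioc]
    exact ae_of_all _ hbound
  refine ⟨hint, (setIntegral_mono_on hint.norm hmaj measurableSet_Ioc hbound).trans ?_⟩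
  have hI : ∫ ε in Set.Ioc (gapScale (j + 1)) (gapScale j),
      2 ^ j * P / √(gapScale j) * (c j * ε⁻¹ + 1) =
      2 ^ j * P / √(gapScale j) * (c j * gapLogLength j + (gapScale j - gapScale (j + 1))) := by
    rw [integral_const_mul, integral_add (hinv.const_mul _) hone, integral_const_mul, hlog]
    simp [hlt.le]
  refine hI.le.trans ?_
  have hcj := (h.1 j).trans_le (hc j).1
  have hA := one_le_gapConst j
  have h4 : c j * gapLogLength j ≤ 4 * gapConst j * gapScale j := by
    have h5 := (balancedZero_le hc hm j).1
    have h6 : c j * Real.log 2 ≤ rightEdge j * 1 :=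
      mul_le_mul (hc j).2 (by linarith [Real.log_two_lt_d9]) (Real.log_nonneg (by norm_num))
        (h.b_pos j).le
    have h7 := rightEdge_le j
    nlinarith
  have hsβ := Real.sqrt_pos.2 hβ
  have hsβ2 : √(gapScale j) * √(gapScale j) = gapScale j := Real.mul_self_sqrt hβ.le
  have h8 : (2⁻¹ : ℝ) ^ j * 4 ^ j = 2 ^ j := by rw [← mul_pow]; norm_num
  calc 2 ^ j * P / √(gapScale j) * (c j * gapLogLength j + (gapScale j - gapScale (j + 1)))
      ≤ 2 ^ j * P / √(gapScale j) * (5 * gapConst j * (√(gapScale j) * √(gapScale j))) := by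
        rw [hsβ2]
        gcongr
        nlinarith
    _ = 5 * (P * √(gapScale j) * (gapConst j * 2 ^ j)) := by field_simp
    _ = 5 * (P * √(gapScale j) * (gapConst j * 4 ^ j)) * (2⁻¹ : ℝ) ^ j := by rw [← h8]; ring
    _ ≤ 5 * gapConst 0 * (2⁻¹ : ℝ) ^ j := by gcongr

theorem intervalIntegrable_gapProduct_neg
    (hc : ∀ j, c j ∈ Set.Icc (leftEdge j) (rightEdge j))
    (hm : ∀ j, gapMean leftEdge rightEdge c j = c j) :
    IntervalIntegrable (fun t : ℝ => gapProduct leftEdge rightEdge c (t : ℂ)) volume (-1) 0 := by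
  rw [IntervalIntegrable.iff_comp_neg, neg_neg, neg_zero]
  refine IntervalIntegrable.symm ?_
  rw [intervalIntegrable_iff_integrableOn_Ioc_of_le zero_le_one]
  have h1 : IntegrableOn (fun ε : ℝ => gapProduct leftEdge rightEdge c ((-ε : ℝ) : ℂ))
      (⋃ j, Set.Ioc (gapScale (j + 1)) (gapScale j)) := by
    refine integrableOn_iUnion_of_summable_integral_norm
      (fun j => (integrableOn_and_integral_norm_gapProduct_neg_le hc hm j).1) ?_
    exact Summable.of_nonneg_of_le (fun j => integral_nonneg fun _ => norm_nonneg _)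
      (fun j => (integrableOn_and_integral_norm_gapProduct_neg_le hc hm j).2)
      ((summable_geometric_of_lt_one (by norm_num) (by norm_num)).mul_left _)
  refine h1.mono_set fun ε hε => ?_
  obtain ⟨n, hn⟩ := (tendsto_gapScale.eventually_lt_const hε.1).exists
  classical
  have hex : ∃ n, gapScale n < ε := ⟨n, hn⟩
  obtain ⟨i, hi⟩ : ∃ i, Nat.find hex = i + 1 := by
    refine Nat.exists_eq_succ_of_ne_zero fun h0 => ?_
    have := Nat.find_spec hex
    rw [h0, gapScale_zero] at this
    linarith [hε.2]
  refine Set.mem_iUnion.2 ⟨i, hi ▸ Nat.find_spec hex, not_lt.1 (Nat.find_min hex (by omega))⟩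

theorem isParreauWidomChoice_of_gapMean_eq
    (hc : ∀ j, c j ∈ Set.Icc (leftEdge j) (rightEdge j))
    (hm : ∀ j, gapMean leftEdge rightEdge c j = c j) :
    IsParreauWidomChoice leftEdge rightEdge c := by
  have h := gapsDecreaseToZero_edges
  have hl : ∀ j, IntervalIntegrable (fun t : ℝ => gapProduct leftEdge rightEdge c (t : ℂ)) volume
      (leftEdge j) (c j) := fun j => (h.intervalIntegrable_gapProduct hc j).mono_set
    (by rw [Set.uIcc_of_le (hc j).1, Set.uIcc_of_le (h.2.1 j).le]
        exact Set.Icc_subset_Icc_right (hc j).2)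
  have hr : ∀ j, IntervalIntegrable (fun t : ℝ => gapProduct leftEdge rightEdge c (t : ℂ)) volume
      (c j) (rightEdge j) := fun j => (h.intervalIntegrable_gapProduct hc j).mono_set
    (by rw [Set.uIcc_of_le (hc j).2, Set.uIcc_of_le (h.2.1 j).le]
        exact Set.Icc_subset_Icc_left (hc j).1)
  refine ⟨hc, hl, hr, fun j => ?_, intervalIntegrable_gapProduct_neg hc hm, ?_⟩
  · rw [neg_eq_iff_add_eq_zero, intervalIntegral.integral_add_adjacent_intervals (hl j) (hr j)]
    exact h.integral_gapProduct_eq_zero hc (hm j)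
  · exact Summable.of_norm_bounded
      ((summable_geometric_of_lt_one (by norm_num) (by norm_num)).mul_left _)
      (norm_balancedHeight_le hc hm)

end BalancedZeros

theorem theorem5p7 :
    ∃ (E : Set ℝ) (a b : ℕ → ℝ),
      IsClosed E ∧ E = Set.Ici 0 \ ⋃ j, Set.Ioo (a j) (b j) ∧ GapsDecreaseToZero a b ∧
      -- the choice `μ_j = b_j`
      (GapProductConverges E a b b ∧ IsHerglotz (gapProduct a b b) ∧
        ∃ σ : Measure ℝ, IsHerglotzMeasure E (gapProduct a b b) σ ∧ 0 < σ {0}) ∧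
      -- the choice `μ_j = c_j`
      (∃ c : ℕ → ℝ, IsParreauWidomChoice a b c) ∧
      ∀ c : ℕ → ℝ, IsParreauWidomChoice a b c →
        GapProductConverges E a b c ∧ IsHerglotz (gapProduct a b c) ∧
          ∃ ρ : Measure ℝ, IsHerglotzMeasure E (gapProduct a b c) ρ ∧ ρ ≪ volume := by
  have h := gapsDecreaseToZero_edges
  refine ⟨_, leftEdge, rightEdge, GapsDecreaseToZero.isClosed_spectrum _ _, rfl, h, ?_, ?_, ?_⟩
  · have hμ : ∀ j, rightEdge j ∈ Set.Icc (leftEdge j) (rightEdge j) :=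
      fun j => ⟨(h.2.1 j).le, le_rfl⟩
    obtain ⟨σ, -, hσ, -⟩ := h.exists_isHerglotzMeasure hμ
    exact ⟨h.gapProductConverges hμ, h.isHerglotz_gapProduct hμ, σ, hσ,
      h.measure_zero_singleton_pos hμ hσ one_half_pos
        fun ε hε _ => half_le_mul_gapProduct_rightEdge hε⟩
  · obtain ⟨c, hc, hm⟩ := h.exists_gapMean_eq
    exact ⟨c, isParreauWidomChoice_of_gapMean_eq hc hm⟩
  · intro c hc
    obtain ⟨ρ, hfin, hρ, hP⟩ := h.exists_isHerglotzMeasure hc.mem_gap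
    exact ⟨h.gapProductConverges hc.mem_gap, h.isHerglotz_gapProduct hc.mem_gap, ρ, hρ,
      h.absolutelyContinuous hc.mem_gap hρ hP hc.integrable_neg⟩
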